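/- Let $n\ge 2$ and let $\gamma:\mathbb C^n\to\mathbb C^n$ be an invertible holomorphic contraction centered in $0$, that is, a biholomorphic map with $\gamma(0)=0$ such that for every compact $K\subset\mathbb C^n$ and every open $U\ni 0$ all sufficiently high powers of $\gamma$ take $K$ into $U$. Let $H=(\mathbb C^n\setminus 0)/\langle\gamma\rangle$ be the corresponding Hopf manifold, $\pi:\mathbb C^n\setminus 0\to H$ the quotient map (the universal covering), and $j:\mathbb C^n\setminus 0\hookrightarrow\mathbb C^n$ the inclusion. Let $B_H$ be a Mall bundle on $H$, that is, a holomorphic vector bundle of finite rank on $H$ such that the sheaf $B:=j_*\pi^*B_H$ of $\mathcal O_{\mathbb C^n}$-modules is locally free of finite rank. The canonical identifications of the fibres of $\pi^*B_H$ at $z$ and at $\gamma(z)$ make $B$ a $\gamma$-equivariant holomorphic vector bundle on $\mathbb C^n$; in particular $\gamma$ acts linearly on the fibre $B|_0$. The bundle $B$ is called resonant if there are eigenvalues $\beta,\beta'$ (possibly equal) of the action of $\gamma$ on $B|_0$, an integer $k\ge 1$, and eigenvalues $\alpha_1,\dots,\alpha_k$ (possibly repeating) of the differential $D_0\gamma$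 such that $$\beta=\beta'\,\alpha_1\cdots\alpha_k .$$ Then $B$ is resonant if and only if $H^0(H,\Omega^1_H\otimes_{\mathcal O_H}\operatorname{End}B_H)\neq 0$. -/

import Mathlib

open scoped Manifold Topology ContDiff Bundle

set_option linter.unusedSectionVars false

noncomputable section

namespace HopfManifold

/-- The complex manifold `ℂⁿ`. -/
abbrev Cn (n : ℕ) : Type := EuclideanSpace ℂ (Fin n)

/-- `f` is a contraction centered in `x`: it fixes `x`, and for every compact set `K` and every
open set `U` containing `x`, all sufficiently high powers of `f` take `K` to `U`. -/
def IsContraction {M : Type*} [TopologicalSpace M] (f : M → M) (x : M) : Prop :=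
  f x = x ∧ ∀ K : Set M, IsCompact K → ∀ U : Set M, IsOpen U → x ∈ U →
    ∃ N : ℕ, ∀ k ≥ N, f^[k] '' K ⊆ U

/-- An invertible holomorphic contraction of `ℂⁿ` centered in `0`: a biholomorphic map
`ℂⁿ → ℂⁿ` which is a contraction centered in `0`. -/
structure HolContraction (n : ℕ) where
  toDiffeo : Diffeomorph 𝓘(ℂ, Cn n) 𝓘(ℂ, Cn n) (Cn n) (Cn n) ω
  isContraction : IsContraction toDiffeo 0

/-- `ℂⁿ ∖ 0`, as an open submanifold of `ℂⁿ`. -/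
def punctured (n : ℕ) : TopologicalSpace.Opens (Cn n) := ⟨{0}ᶜ, isOpen_compl_singleton⟩

lemma contMDiff_of_comp_val {n : ℕ} {f : punctured n → punctured n}
    (hf : ContMDiff 𝓘(ℂ, Cn n) 𝓘(ℂ, Cn n) ω (Subtype.val ∘ f)) :
    ContMDiff 𝓘(ℂ, Cn n) 𝓘(ℂ, Cn n) ω f :=
  fun x => (ChartedSpace.liftPropWithinAt_subtypeVal_comp_iff ..).1 (hf x)

instance (n : ℕ) : LocallyCompactSpace (punctured n) :=
  (punctured n).isOpen.locallyCompactSpace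

namespace HolContraction

variable {n : ℕ} (γ : HolContraction n)

lemma map_zero : γ.toDiffeo 0 = 0 := γ.isContraction.1

/-- The restriction of `γ` to `ℂⁿ ∖ 0`, as a permutation. -/
def perm : Equiv.Perm (punctured n) :=
  γ.toDiffeo.toEquiv.subtypeEquiv (fun z => by
    change z ≠ 0 ↔ γ.toDiffeo z ≠ 0
    rw [← γ.toDiffeo.injective.ne_iff (x := z) (y := 0)]
    exact Iff.of_eq (congrArg (γ.toDiffeo z ≠ ·) γ.map_zero))

lemma coe_perm (z : punctured n) : ((γ.perm z : punctured n) : Cn n) = γ.toDiffeo z := rfl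

lemma coe_perm_symm (z : punctured n) :
    ((γ.perm.symm z : punctured n) : Cn n) = γ.toDiffeo.symm z := rfl

lemma coe_perm_pow (k : ℕ) (z : punctured n) :
    (((γ.perm ^ k) z : punctured n) : Cn n) = (γ.toDiffeo)^[k] z := by
  induction k generalizing z with
  | zero => rfl
  | succ k ih => rw [pow_succ, Equiv.Perm.mul_apply, ih, coe_perm, Function.iterate_succ_apply]

lemma contMDiff_perm :
    ContMDiff 𝓘(ℂ, Cn n) 𝓘(ℂ, Cn n) ω (γ.perm : punctured n → punctured n) := by
  refine contMDiff_of_comp_val ?_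
  exact γ.toDiffeo.contMDiff.comp contMDiff_subtype_val

lemma contMDiff_perm_symm :
    ContMDiff 𝓘(ℂ, Cn n) 𝓘(ℂ, Cn n) ω (γ.perm.symm : punctured n → punctured n) := by
  refine contMDiff_of_comp_val ?_
  exact γ.toDiffeo.symm.contMDiff.comp contMDiff_subtype_val

/-- The group `⟨γ⟩` of automorphisms of `ℂⁿ ∖ 0` generated by `γ`. -/
abbrev deckGroup : Subgroup (Equiv.Perm (punctured n)) := Subgroup.zpowers γ.perm

lemma contMDiff_smul (g : γ.deckGroup) :
    ContMDiff 𝓘(ℂ, Cn n) 𝓘(ℂ, Cn n) ω (fun z : punctured n => g • z) := by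
  obtain ⟨g, k, rfl⟩ := g
  change ContMDiff 𝓘(ℂ, Cn n) 𝓘(ℂ, Cn n) ω (fun z : punctured n => (γ.perm ^ k) z)
  induction k using Int.induction_on with
  | zero => exact contMDiff_id
  | succ k ih =>
    simp only [zpow_add_one, Equiv.Perm.mul_apply]
    exact ih.comp γ.contMDiff_perm
  | pred k ih =>
    simp only [zpow_sub_one, Equiv.Perm.mul_apply]
    exact ih.comp γ.contMDiff_perm_symm

instance : ContinuousConstSMul γ.deckGroup (punctured n) :=
  ⟨fun g => (γ.contMDiff_smul g).continuous⟩

lemma exists_forall_pow_notMem {K L : Set (punctured n)} (hK : IsCompact K) (hL : IsCompact L) :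
    ∃ N : ℕ, ∀ k ≥ N, ∀ z ∈ K, (γ.perm ^ k) z ∉ L := by
  obtain ⟨N, hN⟩ := γ.isContraction.2 (Subtype.val '' K) (hK.image continuous_subtype_val)
    (Subtype.val '' L)ᶜ (hL.image continuous_subtype_val).isClosed.isOpen_compl
    (by rintro ⟨z, -, hz⟩; exact z.2 hz)
  refine ⟨N, fun k hk z hz hzL => ?_⟩
  exact hN k hk ⟨z, ⟨z, hz, rfl⟩, rfl⟩ ⟨_, hzL, γ.coe_perm_pow k z⟩

instance : ProperlyDiscontinuousSMul γ.deckGroup (punctured n) where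
  finite_disjoint_inter_image {K L} hK hL := by
    obtain ⟨N, hN⟩ := γ.exists_forall_pow_notMem hK hL
    obtain ⟨N', hN'⟩ := γ.exists_forall_pow_notMem hL hK
    refine ((Set.finite_Icc (-(N' : ℤ)) N).image
      (fun k : ℤ => (⟨γ.perm ^ k, k, rfl⟩ : γ.deckGroup))).subset ?_
    rintro ⟨g, k, rfl⟩ ⟨w, ⟨z, hz, hzw⟩, hw⟩
    refine ⟨k, ⟨?_, ?_⟩, rfl⟩
    · by_contra! h
      obtain ⟨m, hm⟩ := Int.eq_ofNat_of_zero_le (show 0 ≤ -k by omega)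
      refine hN' m (by omega) w hw ?_
      have hzw' : (γ.perm ^ k) z = w := hzw
      have : (γ.perm ^ m) w = z := by
        rw [← hzw', ← zpow_natCast, ← Equiv.Perm.mul_apply, ← zpow_add, ← hm]
        simp
      rwa [this]
    · by_contra! h
      obtain ⟨m, rfl⟩ := Int.eq_ofNat_of_zero_le (show 0 ≤ k by omega)
      refine hN m (by omega) z hz ?_
      have hzw' : (γ.perm ^ (m : ℤ)) z = w := hzw
      rw [zpow_natCast] at hzw'
      rwa [hzw']

lemma zpow_eq_zero_of_apply_eq {k : ℤ} {z : punctured n} (h : (γ.perm ^ k) z = z) : k = 0 := by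
  obtain ⟨N, hN⟩ := γ.exists_forall_pow_notMem (isCompact_singleton (x := z))
    (isCompact_singleton (x := z))
  by_contra hk
  have key : (γ.perm ^ k.natAbs) z = z := by
    rcases Int.natAbs_eq k with h' | h'
    · rw [h', zpow_natCast] at h
      exact h
    · rw [h', zpow_neg, zpow_natCast, Equiv.Perm.inv_eq_iff_eq] at h
      exact h.symm
  refine hN (k.natAbs * N) (Nat.le_mul_of_pos_left _ (Int.natAbs_pos.2 hk)) z rfl ?_
  rw [pow_mul, Set.mem_singleton_iff]
  exact Function.IsFixedPt.perm_pow key N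

instance : IsCancelSMul γ.deckGroup (punctured n) where
  right_cancel' := by
    rintro ⟨g, k, rfl⟩ ⟨g', l, rfl⟩ z h
    have h' : (γ.perm ^ k) z = (γ.perm ^ l) z := h
    have : (γ.perm ^ (-l + k)) z = z := by
      rw [zpow_add, Equiv.Perm.mul_apply, h', ← Equiv.Perm.mul_apply, ← zpow_add]
      simp
    have := γ.zpow_eq_zero_of_apply_eq this
    obtain rfl : k = l := by omega
    rfl

/-- The Hopf manifold `H = (ℂⁿ ∖ 0) / ⟨γ⟩`. Its topology is the quotient topology, and its charts
are local inverses of the quotient map. -/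
abbrev Hopf : Type := MulAction.orbitRel.Quotient γ.deckGroup (punctured n)

/-- The covering `π : ℂⁿ ∖ 0 → H`. -/
def proj (z : punctured n) : γ.Hopf := Quotient.mk _ z

lemma proj_perm_symm (z : punctured n) : γ.proj (γ.perm.symm z) = γ.proj z :=
  Quotient.sound ⟨⟨γ.perm⁻¹, Subgroup.inv_mem _ (Subgroup.mem_zpowers _)⟩, rfl⟩

lemma isLocalHomeomorph_proj : IsLocalHomeomorph γ.proj :=
  isQuotientCoveringMap_quotientMk_of_properlyDiscontinuousSMul.isCoveringMap.isLocalHomeomorph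

lemma proj_eq_iff {z w : punctured n} : γ.proj z = γ.proj w ↔ ∃ g : γ.deckGroup, g • w = z :=
  Quotient.eq''

lemma eventuallyEq_localInverseAt {a z : punctured n}
    (hz : γ.proj z ∈ (γ.isLocalHomeomorph_proj.localInverseAt a).source) :
    ∃ g : γ.deckGroup, ∀ᶠ w in 𝓝 z,
      γ.isLocalHomeomorph_proj.localInverseAt a (γ.proj w) = g • w := by
  set e := γ.isLocalHomeomorph_proj.localInverseAt a with he
  have hcont := γ.isLocalHomeomorph_proj.continuous
  obtain ⟨g, hg⟩ := γ.proj_eq_iff.1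
    (γ.isLocalHomeomorph_proj.apply_localInverseAt_of_mem hz)
  refine ⟨g, ?_⟩
  have h1 : ∀ᶠ w in 𝓝 z, γ.proj w ∈ e.source :=
    hcont.continuousAt.eventually (e.open_source.mem_nhds hz)
  have h2 : ∀ᶠ w in 𝓝 z, g • w ∈ e.target := by
    refine (continuous_const_smul g).continuousAt.eventually (e.open_target.mem_nhds ?_)
    change g • z ∈ e.target
    rw [hg]
    exact e.map_source hz
  filter_upwards [h1, h2] with w hw1 hw2
  refine γ.isLocalHomeomorph_proj.injOn_localInverseAt_target (e.map_source hw1) hw2 ?_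
  rw [γ.isLocalHomeomorph_proj.apply_localInverseAt_of_mem hw1]
  exact (γ.proj_eq_iff.2 ⟨g, rfl⟩).symm

lemma contDiffOn_transition (a b : punctured n) :
    ContDiffOn ℂ ω
      ((γ.isLocalHomeomorph_proj.localInverseAt a ≫ₕ chartAt (Cn n) a).symm ≫ₕ
        (γ.isLocalHomeomorph_proj.localInverseAt b ≫ₕ chartAt (Cn n) b))
      ((γ.isLocalHomeomorph_proj.localInverseAt a ≫ₕ chartAt (Cn n) a).symm ≫ₕ
        (γ.isLocalHomeomorph_proj.localInverseAt b ≫ₕ chartAt (Cn n) b)).source := by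
  intro x hx
  simp only [OpenPartialHomeomorph.trans_symm_eq_symm_trans_symm,
    OpenPartialHomeomorph.trans_source, OpenPartialHomeomorph.symm_source, Set.mem_inter_iff,
    Set.mem_preimage, OpenPartialHomeomorph.coe_trans, Function.comp_apply,
    IsLocalHomeomorph.localInverseAt_symm] at hx
  obtain ⟨⟨hxa, -⟩, hxb, hxc⟩ := hx
  obtain ⟨g, hg⟩ := γ.eventuallyEq_localInverseAt hxb
  rw [hg.self_of_nhds] at hxc
  have hsymm : ContMDiffAt 𝓘(ℂ, Cn n) 𝓘(ℂ, Cn n) ω (chartAt (Cn n) a).symm x :=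
    contMDiffOn_chart_symm.contMDiffAt ((chartAt (Cn n) a).open_target.mem_nhds hxa)
  have hchart : ContMDiffAt 𝓘(ℂ, Cn n) 𝓘(ℂ, Cn n) ω (chartAt (Cn n) b)
      (g • (chartAt (Cn n) a).symm x) :=
    contMDiffOn_chart.contMDiffAt ((chartAt (Cn n) b).open_source.mem_nhds hxc)
  have hcomp : ContMDiffAt 𝓘(ℂ, Cn n) 𝓘(ℂ, Cn n) ω
      (fun y => chartAt (Cn n) b (g • (chartAt (Cn n) a).symm y)) x :=
    hchart.comp x ((γ.contMDiff_smul g).contMDiffAt.comp x hsymm)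
  refine (hcomp.contDiffAt.congr_of_eventuallyEq ?_).contDiffWithinAt
  filter_upwards [hsymm.continuousAt.eventually hg] with y hy
  simp only [OpenPartialHomeomorph.trans_symm_eq_symm_trans_symm,
    OpenPartialHomeomorph.coe_trans, Function.comp_apply, IsLocalHomeomorph.localInverseAt_symm]
  rw [hy]

instance : IsManifold 𝓘(ℂ, Cn n) ω γ.Hopf := by
  refine isManifold_of_contDiffOn _ _ _ ?_
  rintro _ _ ⟨q, rfl⟩ ⟨q', rfl⟩
  refine (γ.contDiffOn_transition _ _).mono ?_
  exact Set.inter_subset_left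

lemma contMDiff_proj : ContMDiff 𝓘(ℂ, Cn n) 𝓘(ℂ, Cn n) ω γ.proj := by
  intro z
  refine contMDiffAt_iff_target.2 ⟨γ.isLocalHomeomorph_proj.continuous.continuousAt, ?_⟩
  obtain ⟨b, e, he, hz, hzc⟩ : ∃ b : punctured n, ∃ e : OpenPartialHomeomorph γ.Hopf (punctured n),
      e = γ.isLocalHomeomorph_proj.localInverseAt b ∧ γ.proj z ∈ (e ≫ₕ chartAt (Cn n) b).source ∧
      chartAt (Cn n) (γ.proj z) = e ≫ₕ chartAt (Cn n) b :=
    ⟨_, _, rfl, mem_chart_source (Cn n) (γ.proj z), rfl⟩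
  subst he
  rw [OpenPartialHomeomorph.trans_source] at hz
  obtain ⟨g, hg⟩ := γ.eventuallyEq_localInverseAt hz.1
  have hz2 := hz.2
  rw [Set.mem_preimage, hg.self_of_nhds] at hz2
  have hchart : ContMDiffAt 𝓘(ℂ, Cn n) 𝓘(ℂ, Cn n) ω (chartAt (Cn n) b) (g • z) :=
    contMDiffOn_chart.contMDiffAt ((chartAt (Cn n) b).open_source.mem_nhds hz2)
  refine (hchart.comp z (γ.contMDiff_smul g).contMDiffAt).congr_of_eventuallyEq ?_
  filter_upwards [hg] with w hw
  simp [extChartAt, hzc, hw]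

section Bundle

variable (F : Type*) [NormedAddCommGroup F] [NormedSpace ℂ F]
  (E : γ.Hopf → Type*) [TopologicalSpace (Bundle.TotalSpace F E)]
  [∀ x, AddCommGroup (E x)] [∀ x, Module ℂ (E x)] [∀ x, TopologicalSpace (E x)]
  [FiberBundle F E] [VectorBundle ℂ F E]

/-- `s` is a holomorphic section of the pullback bundle `π^* B_H` over the subset `W` of
`ℂⁿ ∖ 0`. The fibre of `π^* B_H` over `z` is the fibre `E (π z)` of `B_H`, and holomorphic sections
of `π^* B_H` are the holomorphic lifts of `π` to the total space of `B_H`. Values of `s` outside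
`W` are irrelevant. -/
def IsHolSection (W : Set (punctured n)) (s : ∀ z : punctured n, E (γ.proj z)) : Prop :=
  ContMDiffOn 𝓘(ℂ, Cn n) (𝓘(ℂ, Cn n).prod 𝓘(ℂ, F)) ω
    (fun z => (⟨γ.proj z, s z⟩ : Bundle.TotalSpace F E)) W

/-- `s` is a section over the subset `U` of `ℂⁿ` of the sheaf `j_* π^* B_H`, where
`j : ℂⁿ ∖ 0 → ℂⁿ` is the inclusion: a holomorphic section of `π^* B_H` over `j⁻¹(U)`. -/
def IsPushforwardSection (U : Set (Cn n)) (s : ∀ z : punctured n, E (γ.proj z)) : Prop :=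
  γ.IsHolSection F E (Subtype.val ⁻¹' U) s

/-- `B_H` is a Mall bundle: the sheaf `j_* π^* B_H` of `𝒪`-modules on `ℂⁿ` is locally free of
finite rank. That is, every point `p` of `ℂⁿ` has an open neighbourhood `U` with sections
`e₁, …, e_r` of `j_* π^* B_H` over `U` such that over every open `V ⊆ U`, every section `s` of
`j_* π^* B_H` is `∑ fᵢ eᵢ` for unique holomorphic functions `fᵢ` on `V`. -/
def IsMall : Prop :=
  ∀ p : Cn n, ∃ U : Set (Cn n), IsOpen U ∧ p ∈ U ∧
    ∃ (r : ℕ) (e : Fin r → ∀ z : punctured n, E (γ.proj z)),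
      (∀ i, γ.IsPushforwardSection F E U (e i)) ∧
      ∀ V : Set (Cn n), IsOpen V → V ⊆ U →
        ∀ s : ∀ z : punctured n, E (γ.proj z), γ.IsPushforwardSection F E V s →
          ∃ f : Fin r → Cn n → ℂ,
            ((∀ i, AnalyticOnNhd ℂ (f i) V) ∧
              ∀ z : punctured n, (z : Cn n) ∈ V → s z = ∑ i, f i z • e i z) ∧
            ∀ f' : Fin r → Cn n → ℂ,
              ((∀ i, AnalyticOnNhd ℂ (f' i) V) ∧
                ∀ z : punctured n, (z : Cn n) ∈ V → s z = ∑ i, f' i z • e i z) →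
              ∀ i, Set.EqOn (f' i) (f i) V

variable {F E} in
lemma IsHolSection.mono {W W' : Set (punctured n)} {s : ∀ z : punctured n, E (γ.proj z)}
    (hs : γ.IsHolSection F E W s) (h : W' ⊆ W) : γ.IsHolSection F E W' s :=
  ContMDiffOn.mono hs h

lemma isHolSection_zero (W : Set (punctured n)) : γ.IsHolSection F E W 0 :=
  ((Bundle.contMDiff_zeroSection ℂ E).comp γ.contMDiff_proj).contMDiffOn

variable {F E} in
lemma IsHolSection.linearComb {W : Set (punctured n)} {s t : ∀ z : punctured n, E (γ.proj z)}
    (hs : γ.IsHolSection F E W s) (ht : γ.IsHolSection F E W t) (c : ℂ) :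
    γ.IsHolSection F E W (s + c • t) := by
  intro z hz
  have h1 := (Bundle.contMDiffWithinAt_totalSpace (F := F) (E := E)).1 (hs z hz)
  have h2 := (Bundle.contMDiffWithinAt_totalSpace (F := F) (E := E)).1 (ht z hz)
  refine (Bundle.contMDiffWithinAt_totalSpace (F := F) (E := E)).2 ⟨h1.1, ?_⟩
  have key : ∀ w, γ.proj w ∈ (trivializationAt F E (γ.proj z)).baseSet →
      (trivializationAt F E (γ.proj z) ⟨γ.proj w, (s + c • t) w⟩).2 =
      (trivializationAt F E (γ.proj z) ⟨γ.proj w, s w⟩).2 +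
        c • (trivializationAt F E (γ.proj z) ⟨γ.proj w, t w⟩).2 := by
    intro w hw
    have hl := (trivializationAt F E (γ.proj z)).linear ℂ hw
    rw [← hl.map_smul, ← hl.map_add]
    rfl
  have hmem : ∀ᶠ w in 𝓝 z, γ.proj w ∈ (trivializationAt F E (γ.proj z)).baseSet :=
    γ.contMDiff_proj.continuous.continuousAt.eventually
      ((trivializationAt F E (γ.proj z)).open_baseSet.mem_nhds
        (FiberBundle.mem_baseSet_trivializationAt F E _))
  refine (h1.2.add ((contMDiffWithinAt_const (I' := 𝓘(ℂ, ℂ)) (c := c)).smul h2.2)).congr_of_eventuallyEq ?_ ?_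
  · filter_upwards [mem_nhdsWithin_of_mem_nhds hmem] with w hw using key w hw
  · exact key z hmem.self_of_nhds

/-- The sections of `j_* π^* B_H` defined on some open neighbourhood of `0` in `ℂⁿ`. -/
def sectionsNearZero : Submodule ℂ (∀ z : punctured n, E (γ.proj z)) where
  carrier := {s | ∃ U : Set (Cn n), IsOpen U ∧ 0 ∈ U ∧ γ.IsPushforwardSection F E U s}
  zero_mem' := ⟨Set.univ, isOpen_univ, trivial, γ.isHolSection_zero F E _⟩
  add_mem' := by
    rintro s t ⟨U, hU, h0, hs⟩ ⟨U', hU', h0', ht⟩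
    refine ⟨U ∩ U', hU.inter hU', ⟨h0, h0'⟩, ?_⟩
    rw [← one_smul ℂ t]
    exact (hs.mono γ fun z hz => hz.1).linearComb γ (ht.mono γ fun z hz => hz.2) 1
  smul_mem' := by
    rintro c t ⟨U, hU, h0, ht⟩
    refine ⟨U, hU, h0, ?_⟩
    rw [← zero_add (c • t)]
    exact (γ.isHolSection_zero F E _).linearComb γ ht c

/-- The sections near `0` whose germ at `0` lies in `𝔪₀ (j_* π^* B_H)₀`, where `𝔪₀` is the maximal
ideal of the local ring `𝒪₀` of germs of holomorphic functions at `0`. In particular all sections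
that vanish near `0` are in here. -/
def maximalIdealSections : Submodule ℂ (γ.sectionsNearZero F E) :=
  Submodule.span ℂ {t | ∃ f : Cn n → ℂ, AnalyticAt ℂ f 0 ∧ f 0 = 0 ∧
    ∃ s : γ.sectionsNearZero F E,
      ∀ᶠ z : punctured n in Filter.comap Subtype.val (𝓝 0), t.1 z = f z • s.1 z}

/-- The fibre `B|₀ = B₀ / 𝔪₀ B₀` at `0` of the sheaf `B = j_* π^* B_H`. -/
abbrev FibreAtZero : Type _ := γ.sectionsNearZero F E ⧸ γ.maximalIdealSections F E

/-- The canonical equivariant action of `γ` on sections of `π^* B_H`: the value of `γ s` at `z` is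
`s (γ⁻¹ z)`, where the fibres of `π^* B_H` at `γ⁻¹ z` and at `z` are both the fibre of `B_H` at
`π (γ⁻¹ z) = π z`. -/
def equivariantAction :
    (∀ z : punctured n, E (γ.proj z)) →ₗ[ℂ] (∀ z : punctured n, E (γ.proj z)) where
  toFun s z := LinearEquiv.cast (R := ℂ) (M := E) (γ.proj_perm_symm z) (s (γ.perm.symm z))
  map_add' s t := by ext z; exact map_add _ _ _
  map_smul' c s := by ext z; exact map_smul _ _ _

variable {E} in
lemma mk_equivariantAction (s : ∀ z : punctured n, E (γ.proj z)) (z : punctured n) :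
    (⟨γ.proj z, γ.equivariantAction E s z⟩ : Bundle.TotalSpace F E) =
      ⟨γ.proj (γ.perm.symm z), s (γ.perm.symm z)⟩ := by
  have : ∀ {x y : γ.Hopf} (h : x = y) (v : E x),
      (⟨y, LinearEquiv.cast (R := ℂ) (M := E) h v⟩ : Bundle.TotalSpace F E) = ⟨x, v⟩ := by
    rintro x _ rfl v
    rfl
  exact this (γ.proj_perm_symm z) _

lemma symm_zero : γ.toDiffeo.symm 0 = 0 := by
  have h := γ.toDiffeo.symm_apply_apply 0
  rwa [γ.map_zero] at h

lemma equivariantAction_mem {s : ∀ z : punctured n, E (γ.proj z)}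
    (hs : s ∈ γ.sectionsNearZero F E) :
    γ.equivariantAction E s ∈ γ.sectionsNearZero F E := by
  obtain ⟨U, hU, h0, hs⟩ := hs
  refine ⟨γ.toDiffeo.symm ⁻¹' U, hU.preimage γ.toDiffeo.symm.continuous, ?_, ?_⟩
  · rwa [Set.mem_preimage, γ.symm_zero]
  · refine ContMDiffOn.congr (f := fun z => (⟨γ.proj (γ.perm.symm z), s (γ.perm.symm z)⟩ :
      Bundle.TotalSpace F E)) ?_ fun z _ => γ.mk_equivariantAction F s z
    exact ContMDiffOn.comp (t := Subtype.val ⁻¹' U) hs γ.contMDiff_perm_symm.contMDiffOn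
      fun z hz => hz

/-- The action of `γ` on the sections of `j_* π^* B_H` near `0`. -/
def actionNearZero : Module.End ℂ (γ.sectionsNearZero F E) :=
  (γ.equivariantAction E).restrict fun _ hs => γ.equivariantAction_mem F E hs

lemma maximalIdealSections_le_comap :
    γ.maximalIdealSections F E ≤
      (γ.maximalIdealSections F E).comap (γ.actionNearZero F E) := by
  refine Submodule.span_le.2 ?_
  rintro t ⟨f, hf, hf0, s, hts⟩
  refine Submodule.subset_span ⟨f ∘ γ.toDiffeo.symm, ?_, ?_, γ.actionNearZero F E s, ?_⟩
  · refine AnalyticAt.comp (by rwa [γ.symm_zero]) ?_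
    exact γ.toDiffeo.symm.contMDiff.contDiff.contDiffAt.analyticAt
  · rw [Function.comp_apply, γ.symm_zero, hf0]
  · have htend : Filter.Tendsto γ.perm.symm (Filter.comap Subtype.val (𝓝 (0 : Cn n)))
        (Filter.comap Subtype.val (𝓝 (0 : Cn n))) := by
      rw [Filter.tendsto_comap_iff]
      have h := γ.toDiffeo.symm.continuous.tendsto 0
      rw [γ.symm_zero] at h
      exact h.comp Filter.tendsto_comap
    filter_upwards [htend.eventually hts] with z hz
    change LinearEquiv.cast (R := ℂ) (M := E) (γ.proj_perm_symm z) (t.1 (γ.perm.symm z)) = _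
    rw [hz, map_smul]
    rfl

/-- The equivariant action of `γ` on the fibre `B|₀` of `B = j_* π^* B_H`. -/
def fibreAction : Module.End ℂ (γ.FibreAtZero F E) :=
  Submodule.mapQ _ _ (γ.actionNearZero F E) (γ.maximalIdealSections_le_comap F E)

/-- The differential `D₀γ` of `γ` at `0`. -/
def differential : Module.End ℂ (Cn n) := (fderiv ℂ γ.toDiffeo 0 : Cn n →ₗ[ℂ] Cn n)

/-- The `γ`-equivariant bundle `B = j_* π^* B_H` on `ℂⁿ` is resonant: there is a relation
`β = β' α₁ ⋯ α_k` with `k ≥ 1`, where `β`, `β'` are eigenvalues of the equivariant action of `γ` on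
the fibre `B|₀`, possibly equal, and `α₁, …, α_k` are eigenvalues of `D₀γ`, possibly repeating. -/
def IsResonant : Prop :=
  ∃ β β' : ℂ, (γ.fibreAction F E).HasEigenvalue β ∧ (γ.fibreAction F E).HasEigenvalue β' ∧
    ∃ k : ℕ, 1 ≤ k ∧ ∃ α : Fin k → ℂ, (∀ i, γ.differential.HasEigenvalue (α i)) ∧
      β = β' * ∏ i, α i

end Bundle

section Sections

variable (F : Type*) [NormedAddCommGroup F] [NormedSpace ℂ F]
  (E : γ.Hopf → Type*) [TopologicalSpace (Bundle.TotalSpace F E)]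
  [∀ x, AddCommGroup (E x)] [∀ x, Module ℂ (E x)] [∀ x, TopologicalSpace (E x)]
  [∀ x, IsTopologicalAddGroup (E x)] [∀ x, ContinuousSMul ℂ (E x)]
  [FiberBundle F E] [VectorBundle ℂ F E]

/-- The space `H⁰(H, Ω¹_H ⊗ End B_H)` of global holomorphic sections of the bundle
`Ω¹_H ⊗ End B_H = Hom(T H, End B_H)`. -/
abbrev EndValuedOneForms : Type _ :=
  ContMDiffSection 𝓘(ℂ, Cn n) (Cn n →L[ℂ] F →L[ℂ] F) ω
    (fun x : γ.Hopf => TangentSpace 𝓘(ℂ, Cn n) x →L[ℂ] E x →L[ℂ] E x)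

end Sections

end HolContraction

end HopfManifold

end

/-! Choose a frame of `B` near `0`. A global section of `Ω¹ ⊗ End B_H` lifts to a `γ`-invariant form
on `ℂⁿ ∖ 0`. Since `B` is the locally free sheaf `j_* π^* B_H`, the coordinates of sections of `π^*
B_H` extend holomorphically over `0`, so the form becomes a matrix-valued germ `Φ` at `0` with `Φ z
v * B z = B z * Φ (γ z) (Dγ v)`, where `B z` is the matrix of the identification of the fibre at `γ
z` with the fibre at `z`. In the frame, `B 0` is the inverse of the action of `γ` on `B|₀`. Every
orbit enters each neighbourhood of `0`, so conversely an invariant germ determines a global form.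

It remains to decide when an invariant germ `Φ ≠ 0` exists. If it does, its leading Taylor term is a
nonzero multilinear map with values in `Hom(V, End W)` that is invariant under the linear parts.
Removing its arguments one at a time by passing to quotients gives eigenvalues satisfying the
resonance relation; one of the `αᵢ` comes from the form direction, so `k ≥ 1`
(`isResonantPair_of_invariant`).

Conversely, a resonance gives a product of eigen-covectors and an eigenvector that is invariant
modulo higher order. Write invariance as `T Φ = Φ` for the twisted pullback `T`. On functions
vanishing to high order `1 - T` is inverted by a Neumann series, because `γ` contracts; modulo such
functions the problem is finite dimensional. Thus on functions of any given vanishing order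
injectivity of `1 - T` implies surjectivity: either `T` already has a nonzero fixed function there,
or the error of the approximate solution can be corrected without destroying its leading term
(`exists_invariant_of_approximately_invariant`). No convergence of normal forms is needed. -/

noncomputable section

namespace HopfManifold

/-! ### Cauchy estimates and series of analytic maps in several variables -/

section AnalyticSeries

open Metric Nat NNReal ENNReal

variable {V X : Type*} [NormedAddCommGroup V] [NormedSpace ℂ V] [NormedAddCommGroup X]
  [NormedSpace ℂ X]

/-- Cauchy estimates for iterated derivatives, with a non-optimal constant. -/
lemma norm_iteratedFDeriv_le_of_norm_le [CompleteSpace X] {f : V → X} {c : V} {R M δ : ℝ}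
    (hδ : 0 < δ)
    (hf : AnalyticOnNhd ℂ f (ball c R)) (hM : ∀ z ∈ ball c R, ‖f z‖ ≤ M) (k : ℕ) :
    ∀ z ∈ ball c (R - k * δ), ‖iteratedFDeriv ℂ k f z‖ ≤ (2 / δ) ^ k * M := by
  induction k with
  | zero => intro z hz; simpa using hM z (by simpa using hz)
  | succ k ih =>
    intro z hz
    rw [← norm_fderiv_iteratedFDeriv]
    have hsub : ball z δ ⊆ ball c (R - k * δ) := by
      refine ball_subset_ball' ?_
      rw [mem_ball] at hz
      push_cast at hz
      linarith
    have hsub' : ball c (R - k * δ) ⊆ ball c R := ball_subset_ball (by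
      have : 0 ≤ k * δ := by positivity
      linarith)
    -- Each derivative costs `δ` of the radius; the factor `2` arises because the estimate is
    -- applied to the oscillation around the value at `z`.
    have := Complex.norm_fderiv_le_div_of_mapsTo_ball (f := iteratedFDeriv ℂ k f) (c := z)
      (R₁ := δ) (R₂ := 2 * ((2 / δ) ^ k * M))
      ((hf.iteratedFDeriv k).differentiableOn.mono (hsub.trans hsub')) (fun w hw => by
        rw [mem_closedBall, dist_eq_norm]
        refine (norm_sub_le _ _).trans ?_
        have h1 := ih w (hsub hw)
        have h2 := ih z (hsub (mem_ball_self hδ))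
        linarith) hδ
    refine this.trans (le_of_eq ?_)
    rw [pow_succ]
    ring

/-- The `n` derivatives are taken in `n` equal steps, which gives `(4n / R) ^ n`; division by `n!`
turns `n ^ n` into at most `e ^ n`. -/
lemma norm_taylorCoeff_le [CompleteSpace X] {f : V → X} {c : V} {R M : ℝ} (hR : 0 < R)
    (hf : AnalyticOnNhd ℂ f (ball c R)) (hM : ∀ z ∈ ball c R, ‖f z‖ ≤ M) (n : ℕ) :
    ‖((n ! : ℂ))⁻¹ • iteratedFDeriv ℂ n f c‖ ≤ M * (4 * Real.exp 1 / R) ^ n := by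
  have hM0 : 0 ≤ M := (norm_nonneg _).trans (hM c (mem_ball_self hR))
  rcases Nat.eq_zero_or_pos n with rfl | hn
  · simpa using hM c (mem_ball_self hR)
  have hn' : (0 : ℝ) < n := by exact_mod_cast hn
  -- With this `δ` the `n` steps use up only half of the radius, so `c` stays in the remaining ball.
  have h1 := norm_iteratedFDeriv_le_of_norm_le (δ := R / (2 * n)) (by positivity) hf hM n c
    (mem_ball_self (by field_simp; linarith))
  have h2 := Real.pow_div_factorial_le_exp (x := n) hn'.le n
  rw [norm_smul, norm_inv, Complex.norm_natCast]
  have h3 : (Real.exp n) = Real.exp 1 ^ n := by rw [← Real.exp_nat_mul, mul_one]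
  have hfac : (0 : ℝ) < n ! := by exact_mod_cast n.factorial_pos
  calc (n ! : ℝ)⁻¹ * ‖iteratedFDeriv ℂ n f c‖
      ≤ (n ! : ℝ)⁻¹ * ((2 / (R / (2 * n))) ^ n * M) := by gcongr
    _ = M * ((4 / R) ^ n * ((n : ℝ) ^ n / n !)) := by
        have : 2 / (R / (2 * (n : ℝ))) = 4 / R * n := by field_simp; norm_num
        rw [this, mul_pow]
        field_simp
    _ ≤ M * ((4 / R) ^ n * Real.exp n) := by gcongr
    _ = M * (4 * Real.exp 1 / R) ^ n := by rw [h3, ← mul_pow]; congr 2; ring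

/-- The point is a radius of convergence that depends on `R` alone and so serves a whole sequence of
functions. The series converges there by the coefficient bound and equals `f` by the identity
theorem on the ball. -/
lemma hasSum_taylor_of_norm_le [CompleteSpace X] {f : V → X} {c : V} {R M : ℝ} (hR : 0 < R)
    (hf : AnalyticOnNhd ℂ f (ball c R)) (hM : ∀ z ∈ ball c R, ‖f z‖ ≤ M) {y : V}
    (hy : ‖y‖ < R / (4 * Real.exp 1)) :
    HasSum (fun n : ℕ => ((n ! : ℂ))⁻¹ • iteratedFDeriv ℂ n f c (fun _ => y)) (f (c + y)) := by
  set ρ : ℝ := R / (4 * Real.exp 1) with hρ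
  have he := Real.exp_pos 1
  have hρ0 : 0 < ρ := by positivity
  have hρR : ρ ≤ R := div_le_self hR.le (by have := Real.add_one_le_exp (1 : ℝ); linarith)
  let p : FormalMultilinearSeries ℂ V X := fun n => ((n ! : ℂ))⁻¹ • iteratedFDeriv ℂ n f c
  have hrad : ENNReal.ofReal ρ ≤ p.radius := by
    refine p.le_radius_of_bound (r := ρ.toNNReal) M fun n => ?_
    have h := norm_taylorCoeff_le hR hf hM n
    rw [Real.coe_toNNReal _ hρ0.le]
    calc ‖p n‖ * ρ ^ n ≤ M * (4 * Real.exp 1 / R) ^ n * ρ ^ n := by gcongr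
      _ = M := by
        rw [mul_assoc, ← mul_pow, hρ]
        have : 4 * Real.exp 1 / R * (R / (4 * Real.exp 1)) = 1 := by field_simp
        rw [this, one_pow, mul_one]
  have hpos : 0 < p.radius := lt_of_lt_of_le (by simpa using hρ0) hrad
  have hp := (p.hasFPowerSeriesOnBall hpos).mono (by simpa using hρ0) hrad
  have hball : Metric.eball (0 : V) (ENNReal.ofReal ρ) = ball 0 ρ := Metric.eball_ofReal
  have han : AnalyticOnNhd ℂ p.sum (ball 0 ρ) := hball ▸ hp.analyticOnNhd
  have hshift : AnalyticOnNhd ℂ (fun y => f (c + y)) (ball 0 ρ) := by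
    intro z hz
    refine AnalyticAt.comp (g := f) (f := fun y => c + y) (hf _ ?_)
      (analyticAt_const.add analyticAt_id)
    rw [mem_ball, dist_eq_norm, add_sub_cancel_left]
    rw [mem_ball_zero_iff] at hz
    linarith
  have heq : Set.EqOn p.sum (fun y => f (c + y)) (ball 0 ρ) := by
    refine han.eqOn_of_preconnected_of_eventuallyEq hshift
      (convex_ball _ _).isPreconnected (mem_ball_self hρ0) ?_
    obtain ⟨q, r, hq⟩ := hf c (mem_ball_self hR)
    have : ∀ᶠ z in 𝓝 (0 : V), z ∈ Metric.eball (0 : V) r := Metric.eball_mem_nhds _ hq.r_pos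
    filter_upwards [this] with z hz
    exact ((hq.hasSum_iteratedFDeriv hz).tsum_eq.symm ▸ rfl : p.sum z = f (c + z))
  have hy' : y ∈ ball (0 : V) ρ := by simpa using hy
  have := hp.hasSum (y := y) (by rw [hball]; exact hy')
  rw [zero_add, heq hy'] at this
  exact this

/-- The sum of a uniformly summable series of analytic functions is analytic. -/
lemma analyticAt_tsum_of_norm_le [CompleteSpace X] {f : ℕ → V → X} {c : V} {R : ℝ} {M : ℕ → ℝ}
    (hR : 0 < R) (hf : ∀ k, AnalyticOnNhd ℂ (f k) (ball c R))
    (hM : ∀ k, ∀ z ∈ ball c R, ‖f k z‖ ≤ M k) (hs : Summable M) :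
    AnalyticAt ℂ (fun z => ∑' k, f k z) c := by
  set K : ℝ := 4 * Real.exp 1 / R with hK
  have hK0 : 0 < K := by positivity
  have hM0 : ∀ k, 0 ≤ M k := fun k => (norm_nonneg _).trans (hM k c (mem_ball_self hR))
  let a : ℕ → ∀ n : ℕ, V [×n]→L[ℂ] X := fun k n => ((n ! : ℂ))⁻¹ • iteratedFDeriv ℂ n (f k) c
  have ha : ∀ k n, ‖a k n‖ ≤ M k * K ^ n := fun k n => norm_taylorCoeff_le hR (hf k) (hM k) n
  have hsa : ∀ n, Summable (fun k => a k n) := fun n =>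
    Summable.of_norm_bounded (hs.mul_right (K ^ n)) fun k => ha k n
  let q : FormalMultilinearSeries ℂ V X := fun n => ∑' k, a k n
  have hq : ∀ n, ‖q n‖ ≤ (∑' k, M k) * K ^ n := fun n =>
    tsum_of_norm_bounded (hs.hasSum.mul_right (K ^ n)) fun k => ha k n
  have hρ0 : 0 < K⁻¹ := inv_pos.2 hK0
  have hrad : ENNReal.ofReal K⁻¹ ≤ q.radius := by
    refine q.le_radius_of_bound (r := K⁻¹.toNNReal) (∑' k, M k) fun n => ?_
    rw [Real.coe_toNNReal _ hρ0.le]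
    calc ‖q n‖ * K⁻¹ ^ n ≤ (∑' k, M k) * K ^ n * K⁻¹ ^ n := by
          gcongr
          exact hq n
      _ = ∑' k, M k := by rw [mul_assoc, ← mul_pow, mul_inv_cancel₀ hK0.ne', one_pow, mul_one]
  refine ⟨q, ENNReal.ofReal K⁻¹, hrad, by simpa using hρ0, fun {y} hy => ?_⟩
  rw [Metric.eball_ofReal, mem_ball_zero_iff] at hy
  have hy' : ‖y‖ < R / (4 * Real.exp 1) := by rwa [hK, inv_div] at hy
  have hfk : ∀ k, HasSum (fun n => a k n (fun _ => y)) (f k (c + y)) := fun k =>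
    hasSum_taylor_of_norm_le hR (hf k) (hM k) hy'
  have hKy : K * ‖y‖ < 1 := by
    calc K * ‖y‖ < K * K⁻¹ := by gcongr
      _ = 1 := mul_inv_cancel₀ hK0.ne'
  -- The double series is majorised by `M k * (K * ‖y‖) ^ n`, so the sums over functions and over
  -- degrees may be exchanged.
  have hbound : Summable (fun p : ℕ × ℕ => a p.1 p.2 (fun _ => y)) := by
    refine Summable.of_norm_bounded
      (hs.mul_of_nonneg (summable_geometric_of_lt_one (by positivity) hKy) hM0
        (fun n => by positivity)) fun p => ?_
    refine ((a p.1 p.2).le_opNorm _).trans ?_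
    simp only [Finset.prod_const, Finset.card_univ, Fintype.card_fin, mul_pow]
    rw [← mul_assoc]
    gcongr
    exact ha _ _
  have hsum2 : HasSum (fun n => ∑' k, a k n (fun _ => y)) (∑' k, f k (c + y)) := by
    have h1 := hbound.prod_symm
    have h2 := h1.hasSum.prod_fiberwise (fun n => ((h1.prod_factor n)).hasSum)
    have h3 : ∑' p : ℕ × ℕ, a p.swap.1 p.swap.2 (fun _ => y) = ∑' k, f k (c + y) :=
      ((Equiv.prodComm ℕ ℕ).tsum_eq (fun p : ℕ × ℕ => a p.1 p.2 (fun _ => y))).trans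
        (hbound.hasSum.prod_fiberwise hfk).tsum_eq.symm
    rw [h3] at h2
    exact h2
  convert hsum2 using 2 with n
  exact ContinuousMultilinearMap.tsum_eval (hsa n) _

end AnalyticSeries

/-! ### Eigenvalues from intertwining relations, and a Fredholm alternative -/

section LinearAlgebra

/-- If `T` preserves `N`, `1 - T` maps `N` onto itself, and `N` contains the kernel of a linear map
to a finite-dimensional space, then injectivity of `1 - T` implies surjectivity. -/
lemma surjective_sub_of_injective {K M Z : Type*} [Field K] [AddCommGroup M] [Module K M]
    [AddCommGroup Z] [Module K Z] [FiniteDimensional K Z] (T : Module.End K M)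
    (N : Submodule K M) (J : M →ₗ[K] Z) (hJ : LinearMap.ker J ≤ N) (hT : N ≤ N.comap T)
    (hN : ∀ f ∈ N, ∃ g ∈ N, g - T g = f) (hinj : ∀ f, T f = f → f = 0) (f : M) :
    ∃ g, g - T g = f := by
  have hfin : FiniteDimensional K (M ⧸ LinearMap.ker J) :=
    Module.Finite.equiv J.quotKerEquivRange.symm
  have hfin' : FiniteDimensional K (M ⧸ N) :=
    Module.Finite.of_surjective (Submodule.factor hJ) (Submodule.factor_surjective hJ)
  have hS : N ≤ N.comap (1 - T) := fun x hx => N.sub_mem hx (hT hx)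
  let S : (M ⧸ N) →ₗ[K] (M ⧸ N) := N.mapQ N (1 - T) hS
  -- If `x - T x` lies in `N`, it equals `g - T g` with `g ∈ N`; then `x - g` is fixed by `T`, so `x
  -- = g ∈ N`.
  have hSinj : Function.Injective S := by
    rw [← LinearMap.ker_eq_bot, LinearMap.ker_eq_bot']
    intro x hx
    obtain ⟨x, rfl⟩ := N.mkQ_surjective x
    have hx' : x - T x ∈ N := by
      rw [← Submodule.Quotient.mk_eq_zero]
      exact hx
    obtain ⟨g, hg, hgx⟩ := hN _ hx'
    have : x - g = 0 := hinj _ (by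
      rw [map_sub]
      have : T x = x - (g - T g) := by rw [hgx]; abel
      rw [this]; abel)
    rw [sub_eq_zero] at this
    subst this
    simpa using hg
  have hSsurj : Function.Surjective S := LinearMap.injective_iff_surjective.1 hSinj
  obtain ⟨x, hx⟩ := hSsurj (N.mkQ f)
  obtain ⟨x, rfl⟩ := N.mkQ_surjective x
  have hx' : f - (x - T x) ∈ N := by
    rw [← Submodule.Quotient.mk_eq_zero, Submodule.Quotient.mk_sub, sub_eq_zero]
    exact hx.symm
  obtain ⟨g, -, hg⟩ := hN _ hx'
  refine ⟨x + g, ?_⟩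
  have : x + g - T (x + g) = (x - T x) + (g - T g) := by rw [map_add]; abel
  rw [this, hg]; abel

universe u

variable {V Y : Type u} [AddCommGroup V] [Module ℂ V] [FiniteDimensional ℂ V]
  [AddCommGroup Y] [Module ℂ Y]

/-- If `P ≠ 0` satisfies `S ∘ P ∘ L = c P`, then `S` has the eigenvalue `c / α` for some eigenvalue
`α` of `L`. -/
lemma exists_eigenvector_of_intertwining {P : V →ₗ[ℂ] Y} (hP : P ≠ 0) {S : Y →ₗ[ℂ] Y}
    (hS : Function.Injective S) {L : Module.End ℂ V} (hL : Function.Injective L) {c : ℂ}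
    (h : ∀ v, S (P (L v)) = c • P v) :
    ∃ α, L.HasEigenvalue α ∧ ∃ y ≠ 0, S y = (c / α) • y := by
  have hker : LinearMap.ker P ≤ (LinearMap.ker P).comap L := fun v hv => by
    rw [Submodule.mem_comap, LinearMap.mem_ker]
    apply hS
    rw [h, LinearMap.mem_ker.1 hv, smul_zero, map_zero]
  -- An eigenvector of `L` itself might be killed by `P`; one of the induced map on `V / ker P` is
  -- not.
  let Q : Module.End ℂ (V ⧸ LinearMap.ker P) := (LinearMap.ker P).mapQ _ L hker
  have hnt : Nontrivial (V ⧸ LinearMap.ker P) := by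
    rw [Submodule.Quotient.nontrivial_iff, Ne, LinearMap.ker_eq_top]
    exact hP
  obtain ⟨α, hα⟩ := Module.End.exists_eigenvalue Q
  -- Otherwise `L - α` would be onto, hence so would `Q - α`, which is then injective by finite
  -- dimension.
  have hLα : L.HasEigenvalue α := by
    by_contra hcon
    have hinj : Function.Injective (L - algebraMap ℂ (Module.End ℂ V) α) := by
      rw [← LinearMap.ker_eq_bot]
      by_contra hne
      exact hcon (by rwa [Module.End.hasEigenvalue_iff, Module.End.eigenspace_def])
    have hsurj := LinearMap.injective_iff_surjective.1 hinj
    have hQsurj : Function.Surjective (Q - algebraMap ℂ (Module.End ℂ (V ⧸ LinearMap.ker P)) α) := by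
      intro x
      obtain ⟨x, rfl⟩ := (LinearMap.ker P).mkQ_surjective x
      obtain ⟨v, rfl⟩ := hsurj x
      exact ⟨(LinearMap.ker P).mkQ v, rfl⟩
    have hQinj := LinearMap.injective_iff_surjective.2 hQsurj
    rw [Module.End.hasEigenvalue_iff, Module.End.eigenspace_def] at hα
    exact hα (LinearMap.ker_eq_bot.2 hQinj)
  have hα0 : α ≠ 0 := by
    rintro rfl
    obtain ⟨v, hv⟩ := hLα.exists_hasEigenvector
    refine hv.2 (hL ?_)
    rw [hv.apply_eq_smul, zero_smul, map_zero]
  obtain ⟨x, hx⟩ := hα.exists_hasEigenvector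
  obtain ⟨v, rfl⟩ := (LinearMap.ker P).mkQ_surjective x
  refine ⟨α, hLα, P v, ?_, ?_⟩
  · intro hv
    exact hx.2 (by simpa using hv)
  · have h1 : (LinearMap.ker P).mkQ (L v) = (LinearMap.ker P).mkQ (α • v) := hx.apply_eq_smul
    have h2 : P (L v) = α • P v := by
      rw [← sub_eq_zero, ← map_sub] at h1
      have : L v - α • v ∈ LinearMap.ker P := (Submodule.Quotient.mk_eq_zero _).1 h1
      rw [LinearMap.mem_ker, map_sub, map_smul, sub_eq_zero] at this
      exact this
    have h3 := h v
    rw [h2, map_smul] at h3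
    rw [div_eq_inv_mul, mul_smul, ← h3, smul_smul, inv_mul_cancel₀ hα0, one_smul]

/-- The multilinear version of `exists_eigenvector_of_intertwining`. -/
lemma exists_eigenvector_of_multilinear {L : Module.End ℂ V} (hL : Function.Injective L) (d : ℕ) :
    ∀ {Y : Type u} [AddCommGroup Y] [Module ℂ Y] {P : MultilinearMap ℂ (fun _ : Fin d => V) Y}
      (_ : P ≠ 0) {S : Y →ₗ[ℂ] Y} (_ : Function.Injective S) {c : ℂ}
      (_ : ∀ v, S (P (fun i => L (v i))) = c • P v),
    ∃ α : Fin d → ℂ, (∀ i, L.HasEigenvalue (α i)) ∧ ∃ y ≠ 0, S y = (c / ∏ i, α i) • y := by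
  induction d with
  | zero =>
    intro Y _ _ P hP S hS c h
    refine ⟨fun _ => 0, fun i => i.elim0, P 0, fun h0 => hP ?_, ?_⟩
    · ext v
      rw [Subsingleton.elim v 0, h0]
      rfl
    · have := h 0
      rw [Subsingleton.elim (fun i => L ((0 : Fin 0 → V) i)) 0] at this
      simpa using this
  | succ d ih =>
    intro Y _ _ P hP S hS c h
    have hLs := LinearMap.injective_iff_surjective.1 hL
    -- After currying the first variable, `S` and the copies of `L` in the other variables together
    -- act on the new target space, so the linear case applies.
    let S' : MultilinearMap ℂ (fun _ : Fin d => V) Y →ₗ[ℂ] MultilinearMap ℂ (fun _ : Fin d => V) Y :=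
      { toFun := fun Q => S.compMultilinearMap (Q.compLinearMap fun _ => L)
        map_add' := fun Q Q' => by ext; simp
        map_smul' := fun a Q => by ext; simp }
    have hS' : Function.Injective S' := by
      intro Q Q' hQ
      ext v
      choose w hw using fun i => hLs (v i)
      have := hS (congrArg (fun R => R w) hQ : S (Q fun i => L (w i)) = S (Q' fun i => L (w i)))
      simpa [hw] using this
    obtain ⟨α, hα, Q, hQ, hQS⟩ := exists_eigenvector_of_intertwining (P := P.curryLeft)
      (fun h0 => hP (by
        ext v
        have := congrArg (fun R => R (v 0) (Fin.tail v)) h0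
        simpa using this)) hS' hL (c := c) (fun v => by
        ext w
        have h2 := h (Fin.cons v w)
        change S (P (Fin.cons (L v) fun i => L (w i))) = c • P (Fin.cons v w)
        rw [← h2]
        congr 2
        ext i
        refine Fin.cases ?_ (fun i => ?_) i <;> simp)
    obtain ⟨α', hα', y, hy, hyS⟩ := ih hQ hS (c := c / α) (fun v => by
      exact congrArg (fun R => R v) hQS)
    refine ⟨Fin.cons α α', fun i => ?_, y, hy, ?_⟩
    · refine Fin.cases ?_ (fun i => ?_) i
      · simpa using hα
      · simpa using hα' i
    · rw [hyS, Fin.prod_cons, div_div]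

/-- The range of `L - α` is a proper subspace, so some nonzero functional vanishes on it. -/
lemma exists_dual_eigenvector {L : Module.End ℂ V} {α : ℂ} (h : L.HasEigenvalue α) :
    ∃ ℓ : V →ₗ[ℂ] ℂ, ℓ ≠ 0 ∧ ∀ v, ℓ (L v) = α * ℓ v := by
  have h1 : ¬ Function.Surjective (L - algebraMap ℂ (Module.End ℂ V) α) := by
    rw [← LinearMap.injective_iff_surjective, ← LinearMap.ker_eq_bot]
    rwa [Module.End.hasEigenvalue_iff, Module.End.eigenspace_def] at h
  obtain ⟨ℓ, hℓ, hle⟩ := Submodule.exists_le_ker_of_lt_top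
    (LinearMap.range (L - algebraMap ℂ (Module.End ℂ V) α))
    (lt_top_iff_ne_top.2 fun h => h1 (LinearMap.range_eq_top.1 h))
  refine ⟨ℓ, hℓ, fun v => ?_⟩
  have : ℓ ((L - algebraMap ℂ (Module.End ℂ V) α) v) = 0 := hle ⟨v, rfl⟩
  simpa [sub_eq_zero] using this

end LinearAlgebra

/-! ### Solving the invariance equation near the fixed point of a contraction -/

section InvariantFunctions

open Metric Asymptotics Set

variable {V X : Type*} [NormedAddCommGroup V] [NormedSpace ℂ V] [FiniteDimensional ℂ V]
  [NormedAddCommGroup X] [NormedSpace ℂ X]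

lemma analyticAt_clm_apply {𝕜 E F G : Type*} [NontriviallyNormedField 𝕜] [NormedAddCommGroup E]
    [NormedSpace 𝕜 E] [NormedAddCommGroup F] [NormedSpace 𝕜 F] [NormedAddCommGroup G]
    [NormedSpace 𝕜 G] {f : E → F →L[𝕜] G} {g : E → F} {x : E} (hf : AnalyticAt 𝕜 f x)
    (hg : AnalyticAt 𝕜 g x) : AnalyticAt 𝕜 (fun y => f y (g y)) x :=
  ((ContinuousLinearMap.id 𝕜 (F →L[𝕜] G)).analyticAt_bilinear _).comp₂ hf hg

/-- Some iterate of a holomorphic contraction halves the norm on the unit ball. -/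
lemma IsContraction.exists_norm_iterate_le {γ : V → V} (hc : IsContraction γ 0)
    (hγ : Differentiable ℂ γ) :
    ∃ m : ℕ, ∀ z ∈ ball (0 : V) 1, ‖γ^[m] z‖ ≤ ‖z‖ / 2 := by
  have : ProperSpace V := FiniteDimensional.proper ℂ V
  obtain ⟨m, hm⟩ := hc.2 (closedBall 0 1) (isCompact_closedBall 0 1) (ball 0 (1 / 2)) isOpen_ball
    (mem_ball_self (by norm_num))
  refine ⟨m, fun z hz => ?_⟩
  have h0 : γ^[m] 0 = 0 := Function.iterate_fixed hc.1 m
  -- The Schwarz lemma: mapping the unit ball into the ball of radius `1 / 2` with `0` fixed halves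
  -- all norms.
  have := Complex.dist_le_div_mul_dist_of_mapsTo_ball (f := γ^[m]) (c := (0 : V)) (R₁ := 1)
    (R₂ := 1 / 2) (hγ.iterate m).differentiableOn (fun w hw => by
      rw [h0]
      exact ball_subset_closedBall (hm m le_rfl ⟨w, ball_subset_closedBall hw, rfl⟩)) hz
  rw [h0, dist_zero_right, dist_zero_right] at this
  linarith

/-- A small ball need not be mapped into itself by `γ`, but the set of points whose first `m`
iterates stay in it is, since the `m`-th iterate returns to the ball. For `m = 0` the hypothesis
forces `V = 0`. -/
lemma exists_open_mapsTo_of_norm_iterate_le {γ : V → V} (h0 : γ 0 = 0) (hγ : Continuous γ) {m : ℕ}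
    (hm : ∀ z ∈ ball (0 : V) 1, ‖γ^[m] z‖ ≤ ‖z‖ / 2) {s : Set V} (hs : s ∈ 𝓝 (0 : V)) :
    ∃ U : Set V, IsOpen U ∧ 0 ∈ U ∧ U ⊆ s ∧ U ⊆ ball 0 1 ∧ MapsTo γ U U := by
  obtain ⟨r, hr, hrs⟩ := Metric.mem_nhds_iff.1 (Filter.inter_mem hs (ball_mem_nhds (0 : V) one_pos))
  rcases Nat.eq_zero_or_pos m with rfl | hmpos
  · refine ⟨{0}, ?_, rfl, by simpa using mem_of_mem_nhds hs, by simp, by simp [MapsTo, h0]⟩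
    have : ball (0 : V) 1 = {0} := by
      ext z
      refine ⟨fun hz => ?_, ?_⟩
      · have := hm z hz
        simp only [Function.iterate_zero, id] at this
        have h' := norm_nonneg z
        exact norm_eq_zero.1 (by linarith)
      · rintro rfl
        exact mem_ball_self one_pos
    rw [← this]
    exact isOpen_ball
  refine ⟨⋂ j ∈ Finset.range m, γ^[j] ⁻¹' ball 0 r, ?_, ?_, ?_, ?_, ?_⟩
  · exact isOpen_biInter_finset fun j _ => isOpen_ball.preimage (hγ.iterate j)
  · simp [Function.iterate_fixed h0, hr]
  · intro z hz
    exact (hrs (by simpa using mem_iInter₂.1 hz 0 (by simpa using hmpos))).1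
  · intro z hz
    exact (hrs (by simpa using mem_iInter₂.1 hz 0 (by simpa using hmpos))).2
  · intro z hz
    refine mem_iInter₂.2 fun j hj => ?_
    rw [mem_preimage, ← Function.iterate_succ_apply]
    have hz0 : z ∈ ball (0 : V) r := by
      simpa using mem_iInter₂.1 hz 0 (by simpa using hmpos)
    rcases Nat.lt_or_ge (j + 1) m with h | h
    · exact mem_iInter₂.1 hz (j + 1) (by simpa using h)
    · obtain rfl : j + 1 = m := by
        have := Finset.mem_range.1 hj
        omega
      have := hm z (hrs hz0).2
      rw [mem_ball_zero_iff] at hz0 ⊢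
      linarith [norm_nonneg z]

/-- Bounded analytic functions on `U`, extended by zero, that vanish at `0` to order `d`. -/
def boundedAnalytic (X : Type*) [NormedAddCommGroup X] [NormedSpace ℂ X] (U : Set V) (d : ℕ) :
    Submodule ℂ (V → X) where
  carrier := {f | AnalyticOnNhd ℂ f U ∧ (∃ B, ∀ z, ‖f z‖ ≤ B) ∧ (∀ z ∉ U, f z = 0) ∧
    f =O[𝓝 0] fun z => ‖z‖ ^ d}
  zero_mem' := ⟨analyticOnNhd_const, ⟨0, by simp⟩, by simp, isBigO_zero _ _⟩
  add_mem' := by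
    rintro f g ⟨h1, ⟨B, h2⟩, h3, h4⟩ ⟨h1', ⟨B', h2'⟩, h3', h4'⟩
    exact ⟨h1.add h1', ⟨B + B', fun z => (norm_add_le _ _).trans (add_le_add (h2 z) (h2' z))⟩,
      fun z hz => by simp [h3 z hz, h3' z hz], h4.add h4'⟩
  smul_mem' := by
    rintro c f ⟨h1, ⟨B, h2⟩, h3, h4⟩
    refine ⟨analyticOnNhd_const.smul h1, ⟨‖c‖ * B, fun z => ?_⟩,
      fun z hz => by simp [h3 z hz], h4.const_smul_left c⟩
    rw [Pi.smul_apply, norm_smul]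
    gcongr
    exact h2 z

lemma isBigO_norm_pow_of_le {d e : ℕ} (h : d ≤ e) :
    (fun z : V => ‖z‖ ^ e) =O[𝓝 0] fun z => ‖z‖ ^ d := by
  refine IsBigO.of_bound 1 ?_
  filter_upwards [ball_mem_nhds (0 : V) one_pos] with z hz
  rw [mem_ball_zero_iff] at hz
  rw [one_mul, norm_pow, norm_pow, norm_norm]
  exact pow_le_pow_of_le_one (norm_nonneg _) hz.le h

lemma boundedAnalytic_mono {U : Set V} {d e : ℕ} (h : d ≤ e) :
    boundedAnalytic X U e ≤ boundedAnalytic X U d :=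
  fun _ hf => ⟨hf.1, hf.2.1, hf.2.2.1, hf.2.2.2.trans (isBigO_norm_pow_of_le h)⟩

/-- The order of vanishing gives the bound on some ball of radius `r`; outside it the global bound
is divided by `r ^ d`. The Neumann series needs an estimate valid everywhere. -/
lemma boundedAnalytic.exists_norm_le {U : Set V} {d : ℕ} {f : V → X}
    (hf : f ∈ boundedAnalytic X U d) : ∃ B, 0 ≤ B ∧ ∀ z, ‖f z‖ ≤ B * ‖z‖ ^ d := by
  obtain ⟨-, ⟨B, hB⟩, -, hO⟩ := hf
  obtain ⟨C, hC0, hC⟩ := hO.exists_pos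
  obtain ⟨r, hr, hrC⟩ := Metric.eventually_nhds_iff_ball.1 hC.bound
  have hB0 : 0 ≤ B := (norm_nonneg _).trans (hB 0)
  refine ⟨max C (B / r ^ d), le_max_of_le_left hC0.le, fun z => ?_⟩
  rcases lt_or_ge ‖z‖ r with h | h
  · refine (hrC z (by simpa using h)).trans ?_
    rw [norm_pow, norm_norm]
    gcongr
    exact le_max_left _ _
  · calc ‖f z‖ ≤ B := hB z
      _ = B / r ^ d * r ^ d := by field_simp
      _ ≤ max C (B / r ^ d) * ‖z‖ ^ d := by
        gcongr
        exact le_max_right _ _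

/-- The operator `Φ ↦ (z ↦ A(z) Φ(γ z))` on functions on `U`, extended by zero. -/
def twistedPullback (U : Set V) (A : V → X →L[ℂ] X) (γ : V → V) : Module.End ℂ (V → X) where
  toFun f := U.indicator fun z => A z (f (γ z))
  map_add' f g := by
    ext z
    by_cases hz : z ∈ U <;> simp [hz]
  map_smul' c f := by
    ext z
    by_cases hz : z ∈ U <;> simp [hz]

section

variable {U : Set V} {A : V → X →L[ℂ] X} {γ : V → V}

lemma twistedPullback_apply {z : V} (hz : z ∈ U) (f : V → X) :
    twistedPullback U A γ f z = A z (f (γ z)) :=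
  indicator_of_mem hz fun z => A z (f (γ z))

lemma twistedPullback_apply_of_notMem {z : V} (hz : z ∉ U) (f : V → X) :
    twistedPullback U A γ f z = 0 :=
  indicator_of_notMem hz fun z => A z (f (γ z))

lemma twistedPullback_mem_boundedAnalytic (hU : IsOpen U) (hUγ : MapsTo γ U U)
    (hγ : AnalyticOnNhd ℂ γ univ) (h0 : γ 0 = 0)
    (hA : AnalyticOnNhd ℂ A U) {C : ℝ} (hC : ∀ z ∈ U, ‖A z‖ ≤ C) {d : ℕ} {f : V → X}
    (hf : f ∈ boundedAnalytic X U d) : twistedPullback U A γ f ∈ boundedAnalytic X U d := by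
  obtain ⟨h1, ⟨B, h2⟩, h3, h4⟩ := hf
  have hbound : ∀ z, ‖twistedPullback U A γ f z‖ ≤ max C 0 * ‖f (γ z)‖ := by
    intro z
    by_cases hz : z ∈ U
    · rw [twistedPullback_apply hz]
      refine ((A z).le_opNorm _).trans ?_
      gcongr
      exact (hC z hz).trans (le_max_left _ _)
    · rw [twistedPullback_apply_of_notMem hz, norm_zero]
      positivity
  refine ⟨fun z hz => ?_, ⟨max C 0 * B, fun z => (hbound z).trans ?_⟩,
    fun z hz => twistedPullback_apply_of_notMem hz f, ?_⟩
  · have : AnalyticAt ℂ (fun z => A z (f (γ z))) z :=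
      analyticAt_clm_apply (hA z hz) ((h1 _ (hUγ hz)).comp (hγ z trivial))
    refine this.congr ?_
    filter_upwards [hU.mem_nhds hz] with w hw
    exact (twistedPullback_apply hw f).symm
  · gcongr
    exact h2 _
  · have hg : γ =O[𝓝 0] fun z => z := by
      have := (hγ 0 trivial).differentiableAt.isBigO_sub
      simpa [h0] using this
    have hcont : Filter.Tendsto γ (𝓝 0) (𝓝 0) := by
      have := (hγ 0 trivial).continuousAt
      rwa [ContinuousAt, h0] at this
    have h5 : (fun z => f (γ z)) =O[𝓝 0] fun z => ‖z‖ ^ d :=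
      (h4.comp_tendsto hcont).trans ((hg.norm_norm).pow d)
    exact (IsBigO.of_bound (max C 0) (Filter.Eventually.of_forall hbound)).trans h5

/-- `Λ` is the product of `A` along the orbit of `z`. It does not depend on `f`, so it can be
applied to an infinite sum term by term. -/
lemma exists_twistedPullback_pow_apply (hUγ : MapsTo γ U U) {C : ℝ} (hC : ∀ z ∈ U, ‖A z‖ ≤ C)
    (k : ℕ) : ∀ z ∈ U, ∃ Λ : X →L[ℂ] X, ‖Λ‖ ≤ C ^ k ∧
      ∀ f, (twistedPullback U A γ ^ k) f z = Λ (f (γ^[k] z)) := by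
  induction k with
  | zero =>
    intro z _
    exact ⟨.id ℂ X, by simpa using ContinuousLinearMap.norm_id_le, fun f => by simp⟩
  | succ k ih =>
    intro z hz
    obtain ⟨Λ, hΛ, h⟩ := ih (γ z) (hUγ hz)
    refine ⟨(A z).comp Λ, ?_, fun f => ?_⟩
    · rw [pow_succ']
      refine (ContinuousLinearMap.opNorm_comp_le _ _).trans ?_
      have := (norm_nonneg _).trans (hC z hz)
      gcongr
      exact hC z hz
    · rw [pow_succ', Module.End.mul_apply, twistedPullback_apply hz, h,
        ContinuousLinearMap.comp_apply, Function.iterate_succ_apply]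

/-- On functions bounded by a multiple of `‖z‖ ^ N`, `T ^ m` costs a factor `C ^ m` from `A` and
gains `2 ^ (-N)` from `γ^[m]`, hence at least halves the bound. The Neumann series of `T ^ m`
therefore converges and inverts `1 - T ^ m`, of which `1 - T` is a factor. -/
lemma exists_sub_twistedPullback_eq [CompleteSpace X] (hU : IsOpen U) (hUγ : MapsTo γ U U)
    (hU1 : U ⊆ ball 0 1)
    (hγ : AnalyticOnNhd ℂ γ univ) (h0 : γ 0 = 0)
    (hA : AnalyticOnNhd ℂ A U) {C : ℝ} (hC0 : 0 ≤ C) (hC : ∀ z ∈ U, ‖A z‖ ≤ C) {m N : ℕ}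
    (hm : ∀ z ∈ ball (0 : V) 1, ‖γ^[m] z‖ ≤ ‖z‖ / 2) (hN : C ^ m ≤ 2 ^ N / 2) {f : V → X}
    (hf : f ∈ boundedAnalytic X U N) :
    ∃ g ∈ boundedAnalytic X U N, g - twistedPullback U A γ g = f := by
  set T := twistedPullback U A γ with hT
  have hTmem : ∀ k, ∀ g ∈ boundedAnalytic X U N, (T ^ k) g ∈ boundedAnalytic X U N := by
    intro k
    induction k with
    | zero => intro g hg; simpa using hg
    | succ k ih =>
      intro g hg
      rw [pow_succ', Module.End.mul_apply]
      exact twistedPullback_mem_boundedAnalytic hU hUγ hγ h0 hA hC (ih g hg)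
  obtain ⟨B, hB0, hB⟩ := boundedAnalytic.exists_norm_le hf
  have hbound : ∀ q : ℕ, ∀ z ∈ U, ‖((T ^ m) ^ q) f z‖ ≤ B * ‖z‖ ^ N * (1 / 2) ^ q := by
    intro q
    induction q with
    | zero => intro z _; simpa using hB z
    | succ q ih =>
      intro z hz
      rw [pow_succ', Module.End.mul_apply]
      obtain ⟨Λ, hΛ, h⟩ := exists_twistedPullback_pow_apply hUγ hC m z hz
      rw [h]
      have hz' : γ^[m] z ∈ U := hUγ.iterate m hz
      have h2 := hm z (hU1 hz)
      calc ‖Λ (((T ^ m) ^ q) f (γ^[m] z))‖ ≤ C ^ m * (B * ‖γ^[m] z‖ ^ N * (1 / 2) ^ q) :=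
            (Λ.le_opNorm _).trans (mul_le_mul hΛ (ih _ hz') (norm_nonneg _) (by positivity))
        _ ≤ (2 ^ N / 2) * (B * (‖z‖ / 2) ^ N * (1 / 2) ^ q) := by gcongr
        _ = B * ‖z‖ ^ N * (1 / 2) ^ (q + 1) := by
          rw [div_pow, pow_succ]
          field_simp
  have hgeom : Summable fun q : ℕ => (1 / 2 : ℝ) ^ q := summable_geometric_two
  have hsum : ∀ z ∈ U, Summable fun q => ((T ^ m) ^ q) f z := fun z hz =>
    Summable.of_norm_bounded (hgeom.mul_left (B * ‖z‖ ^ N)) fun q => hbound q z hz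
  set ψ : V → X := fun z => ∑' q, ((T ^ m) ^ q) f z with hψ
  have hmemq : ∀ q, ((T ^ m) ^ q) f ∈ boundedAnalytic X U N := fun q => by
    rw [← pow_mul]
    exact hTmem _ f hf
  have hψ0 : ∀ z ∉ U, ψ z = 0 := fun z hz => by
    rw [hψ]
    simp only [(hmemq _).2.2.1 z hz, tsum_zero]
  have hψbound : ∀ z, ‖ψ z‖ ≤ B * 2 * ‖z‖ ^ N := by
    intro z
    by_cases hz : z ∈ U
    · have := tsum_of_norm_bounded (hgeom.hasSum.mul_left (B * ‖z‖ ^ N)) fun q => hbound q z hz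
      rw [tsum_geometric_two] at this
      linarith
    · rw [hψ0 z hz, norm_zero]
      positivity
  have hψmem : ψ ∈ boundedAnalytic X U N := by
    refine ⟨fun z hz => ?_, ⟨B * 2, fun z => ?_⟩, hψ0, ?_⟩
    -- As `U` lies in the unit ball, the terms are bounded by a geometric series independent of the
    -- point.
    · obtain ⟨r, hr, hrU⟩ := Metric.isOpen_iff.1 hU z hz
      refine analyticAt_tsum_of_norm_le (M := fun q => B * (1 / 2) ^ q) hr
        (fun q => (hmemq q).1.mono hrU) (fun q w hw => (hbound q w (hrU hw)).trans ?_)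
        (hgeom.mul_left B)
      have : ‖w‖ ^ N ≤ 1 := pow_le_one₀ (norm_nonneg _) (by
        have := hU1 (hrU hw)
        rw [mem_ball_zero_iff] at this
        exact this.le)
      gcongr
      exact mul_le_of_le_one_right hB0 this
    · by_cases hz : z ∈ U
      · refine (hψbound z).trans (mul_le_of_le_one_right (by positivity) ?_)
        refine pow_le_one₀ (norm_nonneg _) ?_
        have := hU1 hz
        rw [mem_ball_zero_iff] at this
        exact this.le
      · rw [hψ0 z hz, norm_zero]
        positivity
    · refine IsBigO.of_bound (B * 2) (Filter.Eventually.of_forall fun z => ?_)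
      rw [norm_pow, norm_norm]
      exact hψbound z
  have hψeq : ψ - (T ^ m) ψ = f := by
    ext z
    by_cases hz : z ∈ U
    · obtain ⟨Λ, -, h⟩ := exists_twistedPullback_pow_apply hUγ hC m z hz
      have h1 : (T ^ m) ψ z = ∑' q, ((T ^ m) ^ (q + 1)) f z := by
        rw [h, hψ, Λ.map_tsum (hsum _ (hUγ.iterate m hz))]
        refine tsum_congr fun q => ?_
        rw [pow_succ', Module.End.mul_apply, h]
      rw [Pi.sub_apply, h1, hψ]
      simp only
      rw [(hsum z hz).tsum_eq_zero_add]
      simp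
    · rw [Pi.sub_apply, hψ0 z hz, (hTmem m ψ hψmem).2.2.1 z hz, hf.2.2.1 z hz, sub_zero]
  -- From `(1 - T) * ∑ j < m, T ^ j = 1 - T ^ m`.
  refine ⟨∑ j ∈ Finset.range m, (T ^ j) ψ, Submodule.sum_mem _ fun j _ => hTmem j ψ hψmem, ?_⟩
  have := congrArg (fun S : Module.End ℂ (V → X) => S ψ) (mul_neg_geom_sum T m)
  simp only [Module.End.mul_apply, LinearMap.sub_apply, Module.End.one_apply,
    LinearMap.sum_apply] at this
  rw [this, hψeq]

end

lemma finiteDimensional_continuousMultilinearMap [FiniteDimensional ℂ X] (k : ℕ) :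
    FiniteDimensional ℂ (V [×k]→L[ℂ] X) :=
  Module.Finite.of_injective
    ({ toFun := ContinuousMultilinearMap.toMultilinearMap
       map_add' := fun _ _ => rfl
       map_smul' := fun _ _ => rfl } :
      (V [×k]→L[ℂ] X) →ₗ[ℂ] MultilinearMap ℂ (fun _ : Fin k => V) X)
    ContinuousMultilinearMap.toMultilinearMap_injective

/-- The Taylor polynomial of degree less than `N` vanishes. Hence the kernel of the jet map consists
of functions on which the Neumann series converges. -/
lemma isBigO_of_iteratedFDeriv_eq_zero {f : V → X} (hf : AnalyticAt ℂ f 0) {N : ℕ}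
    [CompleteSpace X]
    (h : ∀ k < N, iteratedFDeriv ℂ k f 0 = 0) : f =O[𝓝 0] fun z => ‖z‖ ^ N := by
  obtain ⟨p, r, hp⟩ := hf
  have h1 := hp.hasFPowerSeriesAt.isBigO_sub_partialSum_pow N
  refine h1.congr_left fun y => ?_
  rw [zero_add, sub_eq_self, FormalMultilinearSeries.partialSum]
  refine Finset.sum_eq_zero fun k hk => ?_
  have h2 := hp.factorial_smul y k
  rw [h k (Finset.mem_range.1 hk), ← Nat.cast_smul_eq_nsmul ℂ] at h2
  exact (smul_eq_zero.1 h2).resolve_left (by exact_mod_cast k.factorial_ne_zero)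

/-- The Taylor coefficients of order less than `N` at `0`. -/
def taylorJet {U : Set V} (h0 : (0 : V) ∈ U) (d N : ℕ) [CompleteSpace X] :
    boundedAnalytic X U d →ₗ[ℂ] (∀ k : Fin N, V [×k]→L[ℂ] X) where
  toFun f k := iteratedFDeriv ℂ k f.1 0
  map_add' f g := by
    ext1 k
    exact iteratedFDeriv_add_apply (f.2.1 0 h0).contDiffAt (g.2.1 0 h0).contDiffAt
  map_smul' c f := by
    ext1 k
    exact iteratedFDeriv_const_smul_apply (f.2.1 0 h0).contDiffAt

/-- Let `γ` be a holomorphic contraction. If `Φ₀` does not vanish to order `d`, but is invariant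
under `Φ ↦ A (Φ ∘ γ)` to order `d`, then there is a nonzero invariant analytic function near `0`. -/
lemma exists_invariant_of_approximately_invariant [Nontrivial V] [FiniteDimensional ℂ X] {γ : V → V}
    (hc : IsContraction γ 0) (hγ : AnalyticOnNhd ℂ γ univ) {A : V → X →L[ℂ] X}
    (hA : AnalyticAt ℂ A 0) {d : ℕ} {Φ₀ : V → X} (hΦ₀ : AnalyticAt ℂ Φ₀ 0)
    (happrox : (fun z => Φ₀ z - A z (Φ₀ (γ z))) =O[𝓝 0] fun z => ‖z‖ ^ d)
    (hnot : ¬ Φ₀ =O[𝓝 0] fun z => ‖z‖ ^ d) {s : Set V} (hs : s ∈ 𝓝 0) :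
    ∃ U : Set V, IsOpen U ∧ 0 ∈ U ∧ U ⊆ s ∧ MapsTo γ U U ∧ ∃ Φ : V → X, AnalyticOnNhd ℂ Φ U ∧
      (∀ z ∈ U, A z (Φ (γ z)) = Φ z) ∧ ∃ z ∈ U, z ≠ 0 ∧ Φ z ≠ 0 := by
  have : CompleteSpace X := FiniteDimensional.complete ℂ X
  have h0 := hc.1
  obtain ⟨m, hm⟩ := hc.exists_norm_iterate_le (fun z => (hγ z trivial).differentiableAt)
  set C : ℝ := ‖A 0‖ + 1 with hC
  have hCbd : ∀ᶠ z in 𝓝 (0 : V), ‖A z‖ < C :=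
    hA.continuousAt.norm.eventually_lt_const (lt_add_one _)
  have hΦbd : ∀ᶠ z in 𝓝 (0 : V), ‖Φ₀ z‖ < ‖Φ₀ 0‖ + 1 :=
    hΦ₀.continuousAt.norm.eventually_lt_const (lt_add_one _)
  obtain ⟨U, hU, h0U, hUs, hU1, hUγ⟩ := exists_open_mapsTo_of_norm_iterate_le h0
    (continuousOn_univ.1 hγ.continuousOn) hm
    (Filter.inter_mem hs (hA.eventually_analyticAt.and (hΦ₀.eventually_analyticAt.and
      (hCbd.and hΦbd))))
  refine ⟨U, hU, h0U, fun z hz => (hUs hz).1, hUγ, ?_⟩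
  have hAU : AnalyticOnNhd ℂ A U := fun z hz => (hUs hz).2.1
  have hCU : ∀ z ∈ U, ‖A z‖ ≤ C := fun z hz => (hUs hz).2.2.2.1.le
  have hC0 : 0 ≤ C := by positivity
  set T := twistedPullback U A γ with hT
  suffices h : ∃ f : V → X, AnalyticOnNhd ℂ f U ∧ T f = f ∧ (∀ z ∉ U, f z = 0) ∧ f ≠ 0 by
    obtain ⟨f, hf, hTf, hfU, hf0⟩ := h
    refine ⟨f, hf, fun z hz => ?_, ?_⟩
    · rw [← twistedPullback_apply (γ := γ) (A := A) hz, ← hT, hTf]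
    -- A function vanishing on `U ∖ 0` also vanishes at `0` by continuity, because `0` is not
    -- isolated in the nontrivial space `V`.
    · by_contra! hcon
      refine hf0 (funext fun z => ?_)
      by_cases hz : z ∈ U
      · by_cases hz0 : z = 0
        · subst hz0
          have hlim := (hf 0 hz).continuousAt.tendsto.mono_left
            (nhdsWithin_le_nhds (s := {(0 : V)}ᶜ))
          refine tendsto_nhds_unique hlim (tendsto_const_nhds.congr' ?_)
          filter_upwards [self_mem_nhdsWithin, mem_nhdsWithin_of_mem_nhds (hU.mem_nhds hz)]
            with w hw hwU using (hcon w hwU hw).symm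
        · exact hcon z hz hz0
      · exact hfU z hz
  have hTmem : ∀ e, ∀ g ∈ boundedAnalytic X U e, T g ∈ boundedAnalytic X U e :=
    fun e g hg => twistedPullback_mem_boundedAnalytic hU hUγ hγ h0 hAU hCU hg
  -- `N` must be large enough for the Neumann series, and at least `d` so that its solutions stay in
  -- the space of order `d`.
  obtain ⟨N₀, hN₀⟩ := pow_unbounded_of_one_lt (2 * C ^ m) (one_lt_two)
  set N := max N₀ d with hN
  have hCN : C ^ m ≤ 2 ^ N / 2 := by
    have : (2 : ℝ) ^ N₀ ≤ 2 ^ N := pow_le_pow_right₀ one_le_two (le_max_left _ _)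
    linarith
  -- Either a nonzero fixed function of order `d` exists, or `1 - T` is injective and hence
  -- surjective on that space and the error of `Φ₀` can be removed.
  by_cases hinj : ∀ f ∈ boundedAnalytic X U d, T f = f → f = 0
  · have hΦ₁ : U.indicator Φ₀ ∈ boundedAnalytic X U 0 := by
      refine ⟨fun z hz => (hUs hz).2.2.1.congr ?_, ⟨‖Φ₀ 0‖ + 1, fun z => ?_⟩,
        fun z hz => indicator_of_notMem hz _, ?_⟩
      · filter_upwards [hU.mem_nhds hz] with w hw using (indicator_of_mem hw _).symm
      · by_cases hz : z ∈ U
        · rw [indicator_of_mem hz]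
          exact (hUs hz).2.2.2.2.le
        · rw [indicator_of_notMem hz, norm_zero]
          positivity
      · simp only [pow_zero]
        refine (hΦ₀.continuousAt.norm.isBoundedUnder_le.isBigO_one ℝ).congr' ?_ .rfl
        filter_upwards [hU.mem_nhds h0U] with w hw using (indicator_of_mem hw _).symm
    have hΦ₂ : U.indicator Φ₀ - T (U.indicator Φ₀) ∈ boundedAnalytic X U d := by
      obtain ⟨h1, h2, h3, -⟩ := Submodule.sub_mem _ hΦ₁ (hTmem 0 _ hΦ₁)
      refine ⟨h1, h2, h3, happrox.congr' ?_ .rfl⟩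
      filter_upwards [hU.mem_nhds h0U] with w hw
      rw [Pi.sub_apply, hT, twistedPullback_apply hw, indicator_of_mem hw,
        indicator_of_mem (hUγ hw)]
    have hfin : ∀ k : Fin N, FiniteDimensional ℂ (V [×k]→L[ℂ] X) := fun k =>
      finiteDimensional_continuousMultilinearMap _
    obtain ⟨Ψ, hΨ⟩ := surjective_sub_of_injective (T.restrict (hTmem d))
      ((boundedAnalytic X U N).comap (boundedAnalytic X U d).subtype)
      (taylorJet h0U d N) (fun f hf => by
        refine ⟨f.2.1, f.2.2.1, f.2.2.2.1,
          isBigO_of_iteratedFDeriv_eq_zero (f.2.1 0 h0U) fun k hk => ?_⟩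
        exact congrFun (LinearMap.mem_ker.1 hf) ⟨k, hk⟩)
      (fun f hf => hTmem N _ hf)
      (fun f hf => by
        obtain ⟨g, hg, hgf⟩ := exists_sub_twistedPullback_eq hU hUγ hU1 hγ h0 hAU hC0 hCU hm hCN hf
        exact ⟨⟨g, boundedAnalytic_mono (le_max_right _ _) hg⟩, hg, Subtype.ext hgf⟩)
      (fun f hf => Subtype.ext (hinj f.1 f.2 (congrArg Subtype.val hf))) ⟨_, hΦ₂⟩
    have hΨ' : Ψ.1 - T Ψ.1 = U.indicator Φ₀ - T (U.indicator Φ₀) := congrArg Subtype.val hΨ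
    -- The correction `Ψ` vanishes to order `d` and `Φ₀` does not, so the difference is nonzero.
    refine ⟨U.indicator Φ₀ - Ψ.1, hΦ₁.1.sub Ψ.2.1, ?_, fun z hz => ?_, fun hzero => hnot ?_⟩
    · rw [map_sub, ← sub_eq_zero]
      rw [← sub_eq_zero] at hΨ'
      rw [← hΨ']
      abel
    · rw [Pi.sub_apply, indicator_of_notMem hz, Ψ.2.2.2.1 z hz, sub_zero]
    · rw [sub_eq_zero] at hzero
      refine (hzero ▸ Ψ.2.2.2.2 : U.indicator Φ₀ =O[𝓝 0] fun z => ‖z‖ ^ d).congr' ?_ .rfl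
      filter_upwards [hU.mem_nhds h0U] with w hw using indicator_of_mem hw _
  · push Not at hinj
    obtain ⟨f, hf, hTf, hf0⟩ := hinj
    exact ⟨f, hf.1, hTf, hf.2.2.1, hf0⟩

end InvariantFunctions

/-! ### Leading Taylor terms of invariant functions -/

section LeadingTerm

open Filter Asymptotics

variable {V X : Type*} [NormedAddCommGroup V] [NormedSpace ℂ V] [NormedAddCommGroup X]
  [NormedSpace ℂ X]

/-- If `Φ - P` vanishes to order `d + 1` for a homogeneous polynomial `P` of degree `d`, then
`t⁻ᵈ Φ(t w)` tends to `P(w₀)` for `t → 0` and `w → w₀`. -/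
lemma tendsto_rescale_leadingTerm {Φ : V → X} {d : ℕ} (P : V [×d]→L[ℂ] X)
    (h : (fun z => Φ z - P fun _ => z) =O[𝓝 0] fun z => ‖z‖ ^ (d + 1)) {w : ℂ → V} {w₀ : V}
    (hw : Tendsto w (𝓝[≠] 0) (𝓝 w₀)) :
    Tendsto (fun t => (t ^ d)⁻¹ • Φ (t • w t)) (𝓝[≠] 0) (𝓝 (P fun _ => w₀)) := by
  have hP : Tendsto (fun t => P fun _ => w t) (𝓝[≠] 0) (𝓝 (P fun _ => w₀)) :=
    (P.cont.tendsto _).comp (tendsto_pi_nhds.2 fun _ => hw)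
  have ht0 : Tendsto (fun t : ℂ => t) (𝓝[≠] 0) (𝓝 0) := tendsto_id.mono_left nhdsWithin_le_nhds
  have htw : Tendsto (fun t => t • w t) (𝓝[≠] 0) (𝓝 0) := by
    simpa using ht0.smul hw
  obtain ⟨C, hC⟩ := (h.comp_tendsto htw).bound
  have hrem : Tendsto (fun t => (t ^ d)⁻¹ • (Φ (t • w t) - P fun _ => t • w t)) (𝓝[≠] 0)
      (𝓝 0) := by
    have hlim : Tendsto (fun t => C * (‖t‖ * ‖w t‖ ^ (d + 1))) (𝓝[≠] 0) (𝓝 0) := by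
      simpa using (ht0.norm.mul (hw.norm.pow (d + 1))).const_mul C
    refine squeeze_zero_norm' ?_ hlim
    filter_upwards [hC, self_mem_nhdsWithin] with t ht htne
    have htne' : 0 < ‖t‖ := norm_pos_iff.2 htne
    rw [norm_smul, norm_inv, norm_pow, inv_mul_le_iff₀ (by positivity)]
    refine ht.trans (le_of_eq ?_)
    simp only [Function.comp_apply, norm_smul, norm_pow, norm_mul, norm_norm]
    ring
  have := hP.add hrem
  rw [add_zero] at this
  refine this.congr' ?_
  filter_upwards [self_mem_nhdsWithin] with t ht
  have htd : t ^ d ≠ 0 := pow_ne_zero _ ht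
  have hhom : (P fun _ => t • w t) = t ^ d • P fun _ => w t := by
    rw [P.map_smul_univ (fun _ => t) fun _ => w t]
    simp
  rw [smul_sub, hhom, smul_smul, inv_mul_cancel₀ htd, one_smul]
  abel

/-- The leading term of an invariant function is an invariant symmetric multilinear map. -/
lemma exists_invariant_multilinear {γ : V → V} {L : V →L[ℂ] V}
    (hγ : HasFDerivAt γ L 0) (h0 : γ 0 = 0) {A : V → X →L[ℂ] X} (hA : ContinuousAt A 0)
    {Φ : V → X} (hΦ : AnalyticAt ℂ Φ 0) (hne : ¬ ∀ᶠ z in 𝓝 0, Φ z = 0)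
    (hinv : ∀ᶠ z in 𝓝 0, A z (Φ (γ z)) = Φ z) :
    ∃ (d : ℕ) (M : V [×d]→L[ℂ] X), M ≠ 0 ∧ ∀ v, A 0 (M fun i => L (v i)) = M v := by
  obtain ⟨p, r, hp⟩ := hΦ
  have hex : ∃ d, ∃ z, p d (fun _ => z) ≠ 0 := by
    by_contra! hcon
    refine hne ?_
    filter_upwards [Metric.eball_mem_nhds (0 : V) hp.r_pos] with z hz
    have := hp.hasSum hz
    rw [zero_add] at this
    rw [← this.tsum_eq]
    simp [hcon]
  classical
  -- The degree is read off from the diagonal values: the coefficients of a power series need not be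
  -- symmetric, and only the homogeneous polynomials matter.
  set d := Nat.find hex with hd
  have hmin : ∀ k < d, ∀ z, p k (fun _ => z) = 0 := fun k hk z => by
    by_contra hz
    exact Nat.find_min hex hk ⟨z, hz⟩
  have hlead : (fun z => Φ z - p d fun _ => z) =O[𝓝 0] fun z => ‖z‖ ^ (d + 1) := by
    refine (hp.hasFPowerSeriesAt.isBigO_sub_partialSum_pow (d + 1)).congr_left fun z => ?_
    rw [zero_add, FormalMultilinearSeries.partialSum, Finset.sum_range_succ,
      Finset.sum_eq_zero fun k hk => hmin k (Finset.mem_range.1 hk) z, zero_add]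
  have hPinv : ∀ z, A 0 (p d fun _ => L z) = p d fun _ => z := by
    intro z
    -- The invariance equation at `t • z`, divided by `t ^ d`, is compared in the limit `t → 0`;
    -- writing `γ (t • z) = t • w t` with `w t → L z` gives the limit of the twisted side.
    have hslope : Tendsto (fun t : ℂ => t⁻¹ • γ (t • z)) (𝓝[≠] 0) (𝓝 (L z)) := by
      have := (hγ.hasLineDerivAt z).tendsto_slope_zero
      simpa [h0] using this
    have h1 := tendsto_rescale_leadingTerm (p d) hlead hslope
    have h2 := tendsto_rescale_leadingTerm (p d) hlead
      (tendsto_const_nhds : Tendsto (fun _ => z) (𝓝[≠] (0 : ℂ)) (𝓝 z))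
    have htz : Tendsto (fun t : ℂ => t • z) (𝓝[≠] 0) (𝓝 0) := by
      have : Tendsto (fun t : ℂ => t) (𝓝[≠] 0) (𝓝 0) := tendsto_id.mono_left nhdsWithin_le_nhds
      simpa using this.smul_const z
    have h3 := ((isBoundedBilinearMap_apply (𝕜 := ℂ) (E := X) (F := X)).continuous.tendsto _).comp
      ((hA.tendsto.comp htz).prodMk_nhds h1)
    refine tendsto_nhds_unique (h3.congr' ?_) h2
    filter_upwards [htz.eventually hinv, self_mem_nhdsWithin] with t ht htne
    have htne' : t ≠ 0 := htne
    simp only [Function.comp_apply]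
    rw [smul_smul, mul_inv_cancel₀ htne', one_smul, map_smul, ht]
  -- Polarisation: the `d`-th derivative of the leading polynomial is the sum of `p d` over all
  -- permutations of the arguments. It inherits the invariance known on the diagonal, and on the
  -- diagonal it is `d!` times the polynomial.
  let M : V [×d]→L[ℂ] X := iteratedFDeriv ℂ d (fun z => p d fun _ => z) 0
  have hM : ∀ v, M v = ∑ σ : Equiv.Perm (Fin d), p d (fun i => v (σ i)) :=
    (p d).iteratedFDeriv_comp_diagonal 0
  refine ⟨d, M, fun hM0 => ?_, fun v => ?_⟩
  · obtain ⟨z, hz⟩ := Nat.find_spec hex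
    have := hM fun _ => z
    rw [hM0, Finset.sum_const, Finset.card_univ, Fintype.card_perm, Fintype.card_fin,
      ← Nat.cast_smul_eq_nsmul ℂ] at this
    rcases smul_eq_zero.1 this.symm with h | h
    · exact d.factorial_ne_zero (by exact_mod_cast h)
    · exact hz h
  · let q : V [×d]→L[ℂ] X :=
      (A 0).compContinuousMultilinearMap ((p d).compContinuousLinearMap fun _ => L)
    have hq : (fun z => q fun _ => z) = fun z => p d fun _ => z := funext hPinv
    have h1 := q.iteratedFDeriv_comp_diagonal 0 v
    rw [hq] at h1
    change M v = _ at h1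
    rw [h1, hM, map_sum]
    rfl

end LeadingTerm

/-! ### Analytic families of operators -/

section ClmAnalytic

variable {𝕜 E F G H : Type*} [NontriviallyNormedField 𝕜] [NormedAddCommGroup E]
  [NormedSpace 𝕜 E] [NormedAddCommGroup F] [NormedSpace 𝕜 F] [NormedAddCommGroup G]
  [NormedSpace 𝕜 G] [NormedAddCommGroup H] [NormedSpace 𝕜 H]

lemma analyticAt_clm_comp {f : H → F →L[𝕜] G} {g : H → E →L[𝕜] F} {z : H}
    (hf : AnalyticAt 𝕜 f z) (hg : AnalyticAt 𝕜 g z) : AnalyticAt 𝕜 (fun z => f z ∘L g z) z :=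
  ((ContinuousLinearMap.compL 𝕜 E F G).analyticAt_bilinear _).comp₂ hf hg

lemma _root_.ContinuousLinearMap.analyticAt_apply (T : E →L[𝕜] F) {f : H → E} {z : H}
    (hf : AnalyticAt 𝕜 f z) : AnalyticAt 𝕜 (fun z => T (f z)) z :=
  (T.analyticAt _).comp hf

end ClmAnalytic

/-! ### Resonances and invariant endomorphism-valued germs -/

section Resonance

open Filter Asymptotics

universe u

set_option maxSynthPendingDepth 3

variable {V W : Type u} [NormedAddCommGroup V] [NormedSpace ℂ V]
  [NormedAddCommGroup W] [NormedSpace ℂ W]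

/-- The resonance relation `β = β' α₁ ⋯ α_k` for eigenvalues `β`, `β'` of `b⁻¹` and `αᵢ` of `L`. -/
def IsResonantPair (b : W →L[ℂ] W) (L : Module.End ℂ V) : Prop :=
  ∃ β β' : ℂ, (∃ x ≠ 0, b (β • x) = x) ∧ (∃ x ≠ 0, b (β' • x) = x) ∧
    ∃ k : ℕ, 1 ≤ k ∧ ∃ α : Fin k → ℂ, (∀ i, L.HasEigenvalue (α i)) ∧ β = β' * ∏ i, α i

/-- The operator `ξ ↦ (v ↦ b ξ(L v) c)` on endomorphism-valued forms. -/
def twistForm (L : V →L[ℂ] V) (b c : W →L[ℂ] W) :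
    (V →L[ℂ] W →L[ℂ] W) →L[ℂ] (V →L[ℂ] W →L[ℂ] W) :=
  (ContinuousLinearMap.compL ℂ V V (W →L[ℂ] W)).flip L ∘L
    ContinuousLinearMap.compL ℂ V (W →L[ℂ] W) (W →L[ℂ] W)
      ((ContinuousLinearMap.compL ℂ W W W).flip c ∘L ContinuousLinearMap.compL ℂ W W W b)

lemma twistForm_apply (L : V →L[ℂ] V) (b c : W →L[ℂ] W) (ξ : V →L[ℂ] W →L[ℂ] W) (v : V) :
    twistForm L b c ξ v = b * ξ (L v) * c := rfl

set_option synthInstance.maxHeartbeats 200000 in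
lemma analyticAt_twistForm {L : V → V →L[ℂ] V} {b c : V → W →L[ℂ] W} {z : V}
    (hL : AnalyticAt ℂ L z) (hb : AnalyticAt ℂ b z) (hc : AnalyticAt ℂ c z) :
    AnalyticAt ℂ (fun z => twistForm (L z) (b z) (c z)) z := by
  have h1 := analyticAt_clm_comp ((ContinuousLinearMap.compL ℂ W W W).flip.analyticAt_apply hc)
    ((ContinuousLinearMap.compL ℂ W W W).analyticAt_apply hb)
  exact analyticAt_clm_comp
    ((ContinuousLinearMap.compL ℂ V V (W →L[ℂ] W)).flip.analyticAt_apply hL)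
    ((ContinuousLinearMap.compL ℂ V (W →L[ℂ] W) (W →L[ℂ] W)).analyticAt_apply h1)

variable [FiniteDimensional ℂ V] [FiniteDimensional ℂ W]

lemma isUnit_continuousLinearMap_iff_injective {b : W →L[ℂ] W} :
    IsUnit b ↔ Function.Injective b := by
  constructor
  · rintro ⟨u, rfl⟩ x y hxy
    have := congrArg (u⁻¹ : (W →L[ℂ] W)ˣ).1 hxy
    simpa [← mul_apply_eq_comp] using this
  · intro h
    have : IsUnit (b : W →ₗ[ℂ] W) := (LinearMap.isUnit_iff_ker_eq_bot _).2
      (LinearMap.ker_eq_bot.2 h)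
    obtain ⟨c, hbc, hcb⟩ := isUnit_iff_exists.1 this
    refine isUnit_iff_exists.2 ⟨LinearMap.toContinuousLinearMap c, ?_, ?_⟩
    · ext x
      exact congrArg (fun f => f x) hbc
    · ext x
      exact congrArg (fun f => f x) hcb

lemma analyticAt_inverse_comp {b : V → W →L[ℂ] W} {z : V} (hb : AnalyticAt ℂ b z)
    (hu : IsUnit (b z)) : AnalyticAt ℂ (fun z => Ring.inverse (b z)) z := by
  have : CompleteSpace W := FiniteDimensional.complete ℂ W
  obtain ⟨u, hu⟩ := hu
  exact (hu ▸ analyticAt_inverse u : AnalyticAt ℂ Ring.inverse (b z)).comp hb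

lemma eventually_isUnit {b : V → W →L[ℂ] W} {z : V} (hb : ContinuousAt b z)
    (hu : IsUnit (b z)) : ∀ᶠ w in 𝓝 z, IsUnit (b w) := by
  have : CompleteSpace W := FiniteDimensional.complete ℂ W
  exact hb.eventually (Units.isOpen.mem_nhds hu)

/-- An invariant nonzero endomorphism-valued form forces a resonance. -/
lemma isResonantPair_of_invariant {γ : V → V} (hγ : AnalyticAt ℂ γ 0) (h0 : γ 0 = 0)
    (hL : Function.Injective (fderiv ℂ γ 0)) {b : V → W →L[ℂ] W} (hb : AnalyticAt ℂ b 0)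
    (hu : IsUnit (b 0)) {Φ : V → V →L[ℂ] W →L[ℂ] W} (hΦ : AnalyticAt ℂ Φ 0)
    (hne : ¬ ∀ᶠ z in 𝓝 0, Φ z = 0)
    (hinv : ∀ᶠ z in 𝓝 0, ∀ v, Φ z v * b z = b z * Φ (γ z) (fderiv ℂ γ z v)) :
    IsResonantPair (b 0) (fderiv ℂ γ 0 : V →ₗ[ℂ] V) := by
  set c : W →L[ℂ] W := Ring.inverse (b 0) with hc
  have hcb : c * b 0 = 1 := Ring.inverse_mul_cancel _ hu
  have hbc : b 0 * c = 1 := Ring.mul_inverse_cancel _ hu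
  have hbinj : Function.Injective (b 0) := isUnit_continuousLinearMap_iff_injective.1 hu
  have hcinj : Function.Injective c := isUnit_continuousLinearMap_iff_injective.1
    (isUnit_iff_exists.2 ⟨b 0, hcb, hbc⟩)
  have : CompleteSpace V := FiniteDimensional.complete ℂ V
  obtain ⟨d, M, hM, hMinv⟩ := exists_invariant_multilinear hγ.differentiableAt.hasFDerivAt h0
    (A := fun z => twistForm (fderiv ℂ γ z) (b z) (Ring.inverse (b z)))
    (analyticAt_twistForm hγ.fderiv hb (analyticAt_inverse_comp hb hu)).continuousAt hΦ hne (by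
      filter_upwards [hinv, eventually_isUnit hb.continuousAt hu] with z hz huz
      ext1 v
      rw [twistForm_apply, ← hz v, mul_assoc, Ring.mul_inverse_cancel _ huz, mul_one])
  have hconj : ∀ q : W →L[ℂ] W, b 0 * q * c = 0 → q = 0 := fun q hq => by
    have : c * (b 0 * q * c) * b 0 = (c * b 0) * q * (c * b 0) := by simp only [mul_assoc]
    rw [hq, hcb] at this
    simpa using this.symm
  have hLsurj : Function.Surjective (fderiv ℂ γ 0) :=
    (LinearMap.injective_iff_surjective (f := (fderiv ℂ γ 0 : V →ₗ[ℂ] V))).1 hL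
  have hS : Function.Injective (twistForm (fderiv ℂ γ 0) (b 0) c) := by
    refine (injective_iff_map_eq_zero _).2 fun ξ hξ => ?_
    ext1 v
    obtain ⟨w, rfl⟩ := hLsurj v
    exact hconj _ (congrArg (fun f => f w) hξ)
  -- Three reductions follow. This one removes the `d` Taylor arguments and leaves a form `ξ`; the
  -- next removes the tangent vector and leaves an endomorphism `q`; the last removes the argument
  -- of `q` and leaves a vector. Each divides the eigenvalue by the one it splits off.
  obtain ⟨α, hα, ξ, hξ, hξS⟩ := exists_eigenvector_of_multilinear
    (L := (fderiv ℂ γ 0 : V →ₗ[ℂ] V)) hL d (P := M.toMultilinearMap)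
    (fun h => hM (ContinuousMultilinearMap.toMultilinearMap_injective h))
    (S := (twistForm (fderiv ℂ γ 0) (b 0) c : _ →ₗ[ℂ] _)) hS (c := 1)
    (fun v => by rw [one_smul]; exact hMinv v)
  let conj : (W →L[ℂ] W) →ₗ[ℂ] (W →L[ℂ] W) :=
    LinearMap.mulLeft ℂ (b 0) ∘ₗ LinearMap.mulRight ℂ c
  have hconj_apply : ∀ q, conj q = b 0 * q * c := fun q => (mul_assoc _ _ _).symm
  obtain ⟨α₀, hα₀, q, hq, hqS⟩ := exists_eigenvector_of_intertwining
    (P := (ξ : V →ₗ[ℂ] W →L[ℂ] W)) (fun h => hξ (ContinuousLinearMap.coe_injective h))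
    (S := conj)
    ((injective_iff_map_eq_zero _).2 fun q hq => hconj q (by rwa [hconj_apply] at hq))
    (L := (fderiv ℂ γ 0 : V →ₗ[ℂ] V)) hL (c := 1 / ∏ i, α i)
    (fun v => (hconj_apply _).trans (congrArg (fun f => f v) hξS))
  obtain ⟨β', hβ', x, hx, hxS⟩ := exists_eigenvector_of_intertwining
    (P := (q : W →ₗ[ℂ] W)) (fun h => hq (ContinuousLinearMap.coe_injective h))
    (S := (b 0 : W →ₗ[ℂ] W)) hbinj (L := (c : W →ₗ[ℂ] W)) hcinj
    (c := 1 / (∏ i, α i) / α₀) (fun v => by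
      rw [hconj_apply] at hqS
      exact congrArg (fun f => f v) hqS)
  have hne0 : ∀ {E : Type u} [AddCommGroup E] [Module ℂ E] {T : Module.End ℂ E} {a : ℂ},
      Function.Injective T → T.HasEigenvalue a → a ≠ 0 := by
    rintro E _ _ T a hT ha rfl
    obtain ⟨v, hv⟩ := ha.exists_hasEigenvector
    refine hv.2 (hT ?_)
    rw [hv.apply_eq_smul, zero_smul, map_zero]
  have hβ0 : β' ≠ 0 := hne0 hcinj hβ'
  have hα₀0 : α₀ ≠ 0 := hne0 (T := (fderiv ℂ γ 0 : V →ₗ[ℂ] V)) hL hα₀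
  have hα0 : ∏ i, α i ≠ 0 := Finset.prod_ne_zero_iff.2 fun i _ =>
    hne0 (T := (fderiv ℂ γ 0 : V →ₗ[ℂ] V)) hL (hα i)
  -- The `d + 1` factors are the `d` of the leading term and one for the form itself, so `k ≥ 1`
  -- even when `Φ 0 ≠ 0`.
  refine ⟨β' * (α₀ * ∏ i, α i), β', ⟨x, hx, ?_⟩, ?_, d + 1, by omega, Fin.cons α₀ α,
    fun i => ?_, by rw [Fin.prod_cons]⟩
  · rw [map_smul]
    have : b 0 x = (1 / (∏ i, α i) / α₀ / β') • x := hxS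
    rw [this, smul_smul]
    have : β' * (α₀ * ∏ i, α i) * (1 / (∏ i, α i) / α₀ / β') = 1 := by field_simp
    rw [this, one_smul]
  · obtain ⟨y, hy⟩ := hβ'.exists_hasEigenvector
    refine ⟨y, hy.2, ?_⟩
    have : c y = β' • y := hy.apply_eq_smul
    rw [← this]
    exact congrArg (fun f => f y) hbc
  · refine Fin.cases ?_ (fun i => ?_) i
    · simpa using hα₀
    · simpa using hα i

/-- The factors are exchanged one at a time: `f F - g G = (f - g) F + g (F - G)`. It serves to
replace `γ` by its linear part in a product of linear forms. -/
lemma prod_sub_prod_isBigO {ι : Type*} {f g : ι → V → ℂ} (hf : ∀ i, f i =O[𝓝 0] fun z => ‖z‖)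
    (hg : ∀ i, g i =O[𝓝 0] fun z => ‖z‖)
    (hfg : ∀ i, (fun z => f i z - g i z) =O[𝓝 0] fun z => ‖z‖ ^ 2) (s : Finset ι) :
    (fun z => ∏ i ∈ s, f i z) =O[𝓝 0] (fun z => ‖z‖ ^ s.card) ∧
    (fun z => ∏ i ∈ s, f i z - ∏ i ∈ s, g i z) =O[𝓝 0] fun z => ‖z‖ ^ (s.card + 1) := by
  classical
  induction s using Finset.induction_on with
  | empty =>
    simp only [Finset.prod_empty, Finset.card_empty, pow_zero, sub_self]
    exact ⟨isBigO_const_const _ one_ne_zero _, isBigO_zero _ _⟩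
  | insert a s ha ih =>
    simp only [Finset.prod_insert ha, Finset.card_insert_of_notMem ha]
    refine ⟨((hf a).mul ih.1).congr_right fun z => by ring, ?_⟩
    have h1 := ((hfg a).mul ih.1).congr_right (g₂ := fun z : V => ‖z‖ ^ (s.card + 1 + 1))
      fun z => by ring
    have h2 := ((hg a).mul ih.2).congr_right (g₂ := fun z : V => ‖z‖ ^ (s.card + 1 + 1))
      fun z => by ring
    exact (h1.add h2).congr_left fun z => by ring

lemma isBigO_sub_fderiv {Y : Type*} [NormedAddCommGroup Y] [NormedSpace ℂ Y] {γ : V → Y}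
    (hγ : AnalyticAt ℂ γ 0) :
    (fun z => γ z - γ 0 - fderiv ℂ γ 0 z) =O[𝓝 0] fun z => ‖z‖ ^ 2 := by
  obtain ⟨p, hp⟩ := hγ
  refine (hp.isBigO_sub_partialSum_pow 2).congr_left fun z => ?_
  rw [zero_add, FormalMultilinearSeries.partialSum, Finset.sum_range_succ, Finset.sum_range_one,
    hp.fderiv_eq, hp.coeff_zero]
  rw [sub_sub]
  rfl

/-- A resonance yields an invariant nonzero endomorphism-valued form. -/
lemma IsResonantPair.exists_invariant [Nontrivial V] {γ : V → V} (hc : IsContraction γ 0)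
    (hγ : AnalyticOnNhd ℂ γ Set.univ) {b : V → W →L[ℂ] W} (hb : AnalyticAt ℂ b 0)
    (hu : IsUnit (b 0)) (hres : IsResonantPair (b 0) (fderiv ℂ γ 0 : V →ₗ[ℂ] V))
    {s : Set V} (hs : s ∈ 𝓝 0) :
    ∃ U : Set V, IsOpen U ∧ 0 ∈ U ∧ U ⊆ s ∧ Set.MapsTo γ U U ∧
      ∃ Φ : V → V →L[ℂ] W →L[ℂ] W, AnalyticOnNhd ℂ Φ U ∧
        (∀ z ∈ U, ∀ v, Φ z v * b z = b z * Φ (γ z) (fderiv ℂ γ z v)) ∧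
        ∃ z ∈ U, z ≠ 0 ∧ Φ z ≠ 0 := by
  have h0 := hc.1
  have : CompleteSpace V := FiniteDimensional.complete ℂ V
  have hγ0 := hγ 0 trivial
  set L : V →L[ℂ] V := fderiv ℂ γ 0 with hL
  set c : W →L[ℂ] W := Ring.inverse (b 0) with hcdef
  have hcb : c * b 0 = 1 := Ring.inverse_mul_cancel _ hu
  have hbc : b 0 * c = 1 := Ring.mul_inverse_cancel _ hu
  obtain ⟨β, β', ⟨w, hw, hbw⟩, ⟨y, hy, hby⟩, k, hk, α, hα, hrel⟩ := hres
  -- The first eigenvalue is spent on the form direction, the other `d` on a homogeneous polynomial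
  -- of degree `d`.
  obtain ⟨d, rfl⟩ : ∃ d, k = d + 1 := ⟨k - 1, by omega⟩
  have hβ0 : β ≠ 0 := by
    rintro rfl
    rw [zero_smul, map_zero] at hbw
    exact hw hbw.symm
  have hcy : (c : W →ₗ[ℂ] W) y = β' • y := by
    have : c (b 0 (β' • y)) = β' • y := congrArg (fun f => f (β' • y)) hcb
    rwa [hby] at this
  obtain ⟨μ, hμ, hμc⟩ := exists_dual_eigenvector
    (Module.End.hasEigenvalue_of_hasEigenvector (f := (c : W →ₗ[ℂ] W))
      ⟨Module.End.mem_eigenspace_iff.2 hcy, hy⟩)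
  choose ℓ hℓ hℓL using fun i => exists_dual_eigenvector (hα i)
  -- Finitely many hyperplanes do not cover `V`; at `v₀` the product of the `ℓ i` is visibly
  -- nonzero.
  obtain ⟨v₀, hv₀⟩ := Module.Dual.exists_forall_ne_zero_of_forall_exists ℓ fun i => by
    by_contra! hcon
    exact hℓ i (LinearMap.ext hcon)
  let ℓc : Fin (d + 1) → V →L[ℂ] ℂ := fun i => LinearMap.toContinuousLinearMap (ℓ i)
  let μc : W →L[ℂ] ℂ := LinearMap.toContinuousLinearMap μ
  -- An eigenvector of the linear twist with eigenvalue `α₀ β' / β`, which the resonance relation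
  -- makes inverse to the factor `∏ α i.succ` of the polynomial `P` below.
  let ξ : V →L[ℂ] W →L[ℂ] W := (ℓc 0).smulRight (μc.smulRight w)
  have hξ : ξ ≠ 0 := by
    intro h
    obtain ⟨x, hx⟩ : ∃ x, μ x ≠ 0 := by
      by_contra! hcon
      exact hμ (LinearMap.ext hcon)
    have h1 : ℓ 0 v₀ • μ x • w = 0 := congrArg (fun f => f v₀ x) h
    simp [hv₀ 0, hx, hw] at h1
  let A : V → (V →L[ℂ] W →L[ℂ] W) →L[ℂ] (V →L[ℂ] W →L[ℂ] W) :=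
    fun z => twistForm (fderiv ℂ γ z) (b z) (Ring.inverse (b z))
  have hA : AnalyticAt ℂ A 0 :=
    analyticAt_twistForm hγ0.fderiv hb (analyticAt_inverse_comp hb hu)
  have hAξ : A 0 ξ = (α 0 * β' * β⁻¹) • ξ := by
    ext v x
    have h1 : A 0 ξ v x = b 0 (ℓ 0 (L v) • μ (c x) • w) := rfl
    have h2 : ξ v x = ℓ 0 v • μ x • w := rfl
    have h3 : b 0 w = β⁻¹ • w := by
      rw [map_smul] at hbw
      rw [eq_inv_smul_iff₀ hβ0, hbw]
    have h4 : ℓ 0 (L v) = α 0 * ℓ 0 v := hℓL 0 v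
    have h5 : μ (c x) = β' * μ x := hμc x
    rw [h1, smul_apply, smul_apply, h2, map_smul, map_smul, h3, h4, h5]
    simp only [smul_smul]
    ring_nf
  have hκ : (α 0 * β' * β⁻¹) * ∏ i : Fin d, α i.succ = 1 := by
    rw [Fin.prod_univ_succ] at hrel
    field_simp
    rw [hrel]; ring
  set κ := α 0 * β' * β⁻¹ with hκdef
  let P : V → ℂ := fun z => ∏ i : Fin d, ℓc i.succ z
  let Φ₀ : V → V →L[ℂ] W →L[ℂ] W := fun z => P z • ξ
  have hP : AnalyticAt ℂ P 0 := by
    have := Finset.analyticAt_prod (Finset.univ : Finset (Fin d))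
      (f := fun i z => ℓc i.succ z) (c := (0 : V)) (𝕜 := ℂ)
      fun i _ => (ℓc i.succ).analyticAt _
    refine this.congr (Eventually.of_forall fun z => ?_)
    simp [P]
  have hΦ₀ : AnalyticAt ℂ Φ₀ 0 := hP.smul analyticAt_const
  have hγO : γ =O[𝓝 0] fun z => ‖z‖ := by
    have := hγ0.differentiableAt.isBigO_sub
    simpa [h0] using this.norm_right
  obtain ⟨hprod1, hprod2⟩ := prod_sub_prod_isBigO (f := fun (i : Fin d) z => ℓc i.succ (γ z))
    (g := fun i z => α i.succ * ℓc i.succ z)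
    (fun i => ((ℓc i.succ).isBigO_comp _ _).trans hγO)
    (fun i => (((ℓc i.succ).isBigO_id _).norm_right).const_mul_left _)
    (fun i => by
      have h1 := isBigO_sub_fderiv hγ0
      have h2 := ((ℓc i.succ).isBigO_comp (fun z => γ z - γ 0 - fderiv ℂ γ 0 z) (𝓝 0)).trans h1
      refine h2.congr_left fun z => ?_
      have : ℓc i.succ (L z) = α i.succ * ℓc i.succ z := hℓL i.succ z
      rw [h0, sub_zero, map_sub, ← hL, this]) Finset.univ
  simp only [Finset.card_univ, Fintype.card_fin, Finset.prod_mul_distrib] at hprod1 hprod2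
  -- `Φ₀` is exactly invariant for the linear parts. There are two errors, from replacing `γ` by its
  -- differential inside `P` and from replacing `A z` by `A 0`; each gains one order over `d`.
  have happrox : (fun z => Φ₀ z - A z (Φ₀ (γ z))) =O[𝓝 0] fun z => ‖z‖ ^ (d + 1) := by
    have h1 : (fun z => A z ξ - A 0 ξ) =O[𝓝 0] fun z => ‖z‖ := by
      have := (analyticAt_clm_apply hA (analyticAt_const (v := ξ))).differentiableAt.isBigO_sub
      simpa using this.norm_right
    have h2 := (hprod1.smul h1).congr_right (g₂ := fun z : V => ‖z‖ ^ (d + 1)) fun z => by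
      rw [smul_eq_mul, pow_succ]
    have h3 := (hprod2.const_mul_left κ).smul
      (isBigO_refl (fun _ : V => ξ) (𝓝 0)).norm_right
    have h4 : (fun z : V => ‖z‖ ^ (d + 1) • ‖ξ‖) =O[𝓝 0] fun z => ‖z‖ ^ (d + 1) :=
      ((isBigO_refl (fun z : V => ‖z‖ ^ (d + 1)) (𝓝 0)).const_mul_left ‖ξ‖).congr_left
        fun z => by rw [smul_eq_mul, mul_comm]
    refine ((h3.trans h4).add h2).neg_left.congr_left fun z => ?_
    have h5 : A z (Φ₀ (γ z)) = P (γ z) • A z ξ := map_smul _ _ _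
    have h6 : κ * (P (γ z) - (∏ i : Fin d, α i.succ) * P z) = κ * P (γ z) - P z := by
      rw [mul_sub, ← mul_assoc, hκ, one_mul]
    rw [h5]
    change -((κ * (P (γ z) - (∏ i : Fin d, α i.succ) * P z)) • ξ + P (γ z) • (A z ξ - A 0 ξ)) =
      P z • ξ - P (γ z) • A z ξ
    rw [h6, hAξ, smul_sub, sub_smul, smul_smul, mul_comm κ]
    abel
  -- Otherwise the leading term of degree `d` would be `0`, whereas rescaling along `v₀` reproduces
  -- `Φ₀ v₀ ≠ 0`.
  have hnot : ¬ Φ₀ =O[𝓝 0] fun z => ‖z‖ ^ (d + 1) := by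
    intro hO
    let Q : V [×d]→L[ℂ] (V →L[ℂ] W →L[ℂ] W) := 0
    have h1 := tendsto_rescale_leadingTerm (Φ := Φ₀) Q (by simpa [Q] using hO)
      (tendsto_const_nhds : Tendsto (fun _ => v₀) (𝓝[≠] (0 : ℂ)) (𝓝 v₀))
    have h2 : Tendsto (fun t : ℂ => (t ^ d)⁻¹ • Φ₀ (t • v₀)) (𝓝[≠] 0) (𝓝 (Φ₀ v₀)) := by
      refine tendsto_const_nhds.congr' ?_
      filter_upwards [self_mem_nhdsWithin] with t ht
      have htd : t ^ d ≠ 0 := pow_ne_zero _ ht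
      have : Φ₀ (t • v₀) = t ^ d • Φ₀ v₀ := by
        simp only [Φ₀, P, map_smul, smul_eq_mul, Finset.prod_mul_distrib, Finset.prod_const,
          Finset.card_univ, Fintype.card_fin, smul_smul]
      rw [this, smul_smul, inv_mul_cancel₀ htd, one_smul]
    have h3 : P v₀ • ξ = 0 := tendsto_nhds_unique h2 h1
    rcases smul_eq_zero.1 h3 with h | h
    · exact (Finset.prod_ne_zero_iff.2 fun i _ => hv₀ i.succ) h
    · exact hξ h
  obtain ⟨U, hU, h0U, hUs, hUγ, Φ, hΦ, hΦinv, hΦne⟩ :=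
    exists_invariant_of_approximately_invariant hc hγ hA hΦ₀ happrox hnot
      (Filter.inter_mem hs (eventually_isUnit hb.continuousAt hu))
  refine ⟨U, hU, h0U, fun z hz => (hUs hz).1, hUγ, Φ, hΦ, fun z hz v => ?_, hΦne⟩
  have hz' : IsUnit (b z) := (hUs hz).2
  rw [← hΦinv z hz, twistForm_apply, mul_assoc, Ring.inverse_mul_cancel _ hz', mul_one]

end Resonance

/-! ### A frame criterion for smoothness in Hom bundles -/

section HomBundle

open Bundle ContinuousLinearMap

variable {EB HB B EM HM M : Type*} [NormedAddCommGroup EB] [NormedSpace ℂ EB]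
  [TopologicalSpace HB] {IB : ModelWithCorners ℂ EB HB} [TopologicalSpace B] [ChartedSpace HB B]
  [NormedAddCommGroup EM] [NormedSpace ℂ EM] [TopologicalSpace HM] {IM : ModelWithCorners ℂ EM HM}
  [TopologicalSpace M] [ChartedSpace HM M]
  {F₁ F₂ : Type*} [NormedAddCommGroup F₁] [NormedSpace ℂ F₁] [FiniteDimensional ℂ F₁]
  [NormedAddCommGroup F₂] [NormedSpace ℂ F₂]
  {E₁ E₂ : B → Type*} [∀ x, AddCommGroup (E₁ x)] [∀ x, Module ℂ (E₁ x)]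
  [TopologicalSpace (TotalSpace F₁ E₁)] [∀ x, TopologicalSpace (E₁ x)]
  [∀ x, AddCommGroup (E₂ x)] [∀ x, Module ℂ (E₂ x)]
  [TopologicalSpace (TotalSpace F₂ E₂)] [∀ x, TopologicalSpace (E₂ x)]
  [∀ x, IsTopologicalAddGroup (E₂ x)] [∀ x, ContinuousSMul ℂ (E₂ x)]
  [FiberBundle F₁ E₁] [VectorBundle ℂ F₁ E₁] [FiberBundle F₂ E₂] [VectorBundle ℂ F₂ E₂]

/-- A family of linear maps between the fibres of two vector bundles is smooth if it maps a smooth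
frame to smooth sections. -/
lemma contMDiffAt_hom_of_frame {n : WithTop ℕ∞} {ι : Type*} [Fintype ι] {b : M → B} {m₀ : M}
    {u : ι → ∀ m, E₁ (b m)} {A : ∀ m, E₁ (b m) →L[ℂ] E₂ (b m)} (hb : ContMDiffAt IM IB n b m₀)
    (hu : ∀ i, ContMDiffAt IM (IB.prod 𝓘(ℂ, F₁)) n
      (fun m => (⟨b m, u i m⟩ : TotalSpace F₁ E₁)) m₀)
    (hAu : ∀ i, ContMDiffAt IM (IB.prod 𝓘(ℂ, F₂)) n
      (fun m => (⟨b m, A m (u i m)⟩ : TotalSpace F₂ E₂)) m₀)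
    (hind : LinearIndependent ℂ fun i => u i m₀)
    (hspan : ⊤ ≤ Submodule.span ℂ (Set.range fun i => u i m₀)) :
    ContMDiffAt IM (IB.prod 𝓘(ℂ, F₁ →L[ℂ] F₂)) n
      (fun m => (⟨b m, A m⟩ : TotalSpace (F₁ →L[ℂ] F₂) (fun x => E₁ x →L[ℂ] E₂ x))) m₀ := by
  refine (contMDiffAt_hom_bundle _).2 ⟨hb, ?_⟩
  set e₁ := trivializationAt F₁ E₁ (b m₀)
  set e₂ := trivializationAt F₂ E₂ (b m₀)
  have hmem₁ : ∀ᶠ m in 𝓝 m₀, b m ∈ e₁.baseSet := hb.continuousAt.eventually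
    (e₁.open_baseSet.mem_nhds (FiberBundle.mem_baseSet_trivializationAt F₁ E₁ _))
  have hmem₂ : ∀ᶠ m in 𝓝 m₀, b m ∈ e₂.baseSet := hb.continuousAt.eventually
    (e₂.open_baseSet.mem_nhds (FiberBundle.mem_baseSet_trivializationAt F₂ E₂ _))
  -- In local coordinates the family `A` is `Y ∘ U⁻¹`, where `U` holds the frame and `Y` its images;
  -- `U` is invertible near `m₀` and inversion is smooth.
  let U : M → (ι → ℂ) →L[ℂ] F₁ := fun m =>
    ∑ i, (proj i : (ι → ℂ) →L[ℂ] ℂ).smulRight (e₁ ⟨b m, u i m⟩).2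
  let Y : M → (ι → ℂ) →L[ℂ] F₂ := fun m =>
    ∑ i, (proj i : (ι → ℂ) →L[ℂ] ℂ).smulRight (e₂ ⟨b m, A m (u i m)⟩).2
  have hUs : ContMDiffAt IM 𝓘(ℂ, (ι → ℂ) →L[ℂ] F₁) n U m₀ :=
    ContMDiffAt.sum fun i _ =>
      (ContinuousLinearMap.contMDiff (smulRightL ℂ (ι → ℂ) F₁ (proj i))).contMDiffAt.comp m₀
        (contMDiffAt_totalSpace.1 (hu i)).2
  have hYs : ContMDiffAt IM 𝓘(ℂ, (ι → ℂ) →L[ℂ] F₂) n Y m₀ :=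
    ContMDiffAt.sum fun i _ =>
      (ContinuousLinearMap.contMDiff (smulRightL ℂ (ι → ℂ) F₂ (proj i))).contMDiffAt.comp m₀
        (contMDiffAt_totalSpace.1 (hAu i)).2
  have hUapply : ∀ m (h : b m ∈ e₁.baseSet) (x : ι → ℂ),
      U m x = e₁.continuousLinearEquivAt ℂ (b m) h (∑ i, x i • u i m) := by
    intro m h x
    rw [map_sum]
    simp [U]
  let basis := Module.Basis.mk hind hspan
  have hm₀ := hmem₁.self_of_nhds
  let Ue : (ι → ℂ) ≃L[ℂ] F₁ :=
    (basis.equivFun.symm.trans (e₁.continuousLinearEquivAt ℂ (b m₀) hm₀).toLinearEquiv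
      ).toContinuousLinearEquiv
  have hUe : (Ue : (ι → ℂ) →L[ℂ] F₁) = U m₀ := by
    ext1 x
    rw [hUapply m₀ hm₀]
    simp [Ue, Module.Basis.equivFun_symm_apply, basis]
  have hinv : ContMDiffAt IM 𝓘(ℂ, F₁ →L[ℂ] (ι → ℂ)) n (fun m => inverse (U m)) m₀ := by
    have h1 : ContDiffAt ℂ n inverse (U m₀) := hUe ▸ contDiffAt_map_inverse Ue
    exact h1.contMDiffAt.comp m₀ hUs
  refine (hYs.clm_comp hinv).congr_of_eventuallyEq ?_
  have hequiv : ∀ᶠ m in 𝓝 m₀, U m ∈ Set.range ((↑) : ((ι → ℂ) ≃L[ℂ] F₁) → _) :=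
    hUs.continuousAt.eventually (hUe ▸ Ue.nhds)
  filter_upwards [hmem₁, hmem₂, hequiv] with m h₁ h₂ h₃
  obtain ⟨e, he⟩ := h₃
  rw [inCoordinates_eq h₁ h₂, ← he, inverse_equiv]
  ext x
  obtain ⟨y, rfl⟩ := e.surjective x
  have hey : e y = e₁.continuousLinearEquivAt ℂ (b m) h₁ (∑ i, y i • u i m) := by
    rw [← hUapply m h₁, ← he]
    rfl
  simp only [comp_apply, ContinuousLinearEquiv.coe_coe, ContinuousLinearEquiv.symm_apply_apply]
  change e₂.continuousLinearEquivAt ℂ (b m) h₂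
    (A m ((e₁.continuousLinearEquivAt ℂ (b m) h₁).symm (e y))) = Y m y
  rw [hey, ContinuousLinearEquiv.symm_apply_apply, map_sum, map_sum]
  simp [Y]

end HomBundle

/-! ### The covering `π` and its differential -/

variable {n : ℕ}

open Classical in
/-- The identity map `ℂⁿ ∖ 0 → ℂⁿ ∖ 0`, extended by the value `p` at `0`. -/
def toPunctured (p : punctured n) (z : Cn n) : punctured n := if h : z ≠ 0 then ⟨z, h⟩ else p

@[simp]
lemma toPunctured_coe (p z : punctured n) : toPunctured p z = z := by
  have : (z : Cn n) ≠ 0 := z.2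
  simp [toPunctured, this]

lemma coe_toPunctured (p : punctured n) {z : Cn n} (hz : z ≠ 0) : (toPunctured p z : Cn n) = z := by
  simp [toPunctured, hz]

lemma eventually_coe_toPunctured (p : punctured n) {z : Cn n} (hz : z ≠ 0) :
    ∀ᶠ w in 𝓝 z, (toPunctured p w : Cn n) = w := by
  filter_upwards [isOpen_compl_singleton.mem_nhds (show z ∈ ({0} : Set (Cn n))ᶜ from hz)] with w hw
  exact coe_toPunctured p hw

lemma contMDiffAt_of_val_comp {E H M : Type*} [NormedAddCommGroup E] [NormedSpace ℂ E]
    [TopologicalSpace H] {I : ModelWithCorners ℂ E H} [TopologicalSpace M] [ChartedSpace H M]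
    {f : M → punctured n} {x : M}
    (hf : ContMDiffAt I 𝓘(ℂ, Cn n) ω (fun y => (f y : Cn n)) x) :
    ContMDiffAt I 𝓘(ℂ, Cn n) ω f x :=
  (ChartedSpace.liftPropWithinAt_subtypeVal_comp_iff ..).1 hf

lemma contMDiffAt_toPunctured (p : punctured n) {z : Cn n} (hz : z ≠ 0) :
    ContMDiffAt 𝓘(ℂ, Cn n) 𝓘(ℂ, Cn n) ω (toPunctured p) z :=
  contMDiffAt_of_val_comp
    (contMDiffAt_id.congr_of_eventuallyEq (eventually_coe_toPunctured p hz))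

lemma analyticAt_comp_toPunctured {X : Type*} [NormedAddCommGroup X] [NormedSpace ℂ X]
    [CompleteSpace X]
    {g : punctured n → X} {z : punctured n} (p : punctured n)
    (hg : ContMDiffAt 𝓘(ℂ, Cn n) 𝓘(ℂ, X) ω g z) :
    AnalyticAt ℂ (fun w => g (toPunctured p w)) (z : Cn n) := by
  have h := ContMDiffAt.comp (z : Cn n) (g := g) (by rwa [toPunctured_coe])
    (contMDiffAt_toPunctured p z.2)
  exact h.contDiffAt.analyticAt

namespace HolContraction

variable (γ : HolContraction n)

/-- The covering `π` is a local biholomorphism. -/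
lemma exists_contMDiffAt_localInverse (z : punctured n) :
    ∃ ρ : γ.Hopf → punctured n, ContMDiffAt 𝓘(ℂ, Cn n) 𝓘(ℂ, Cn n) ω ρ (γ.proj z) ∧
      ρ (γ.proj z) = z ∧ (∀ᶠ y in 𝓝 (γ.proj z), γ.proj (ρ y) = y) ∧
      ∀ᶠ w in 𝓝 z, ρ (γ.proj w) = w := by
  obtain ⟨b, e, he, hz, hzc⟩ : ∃ b : punctured n, ∃ e : OpenPartialHomeomorph γ.Hopf (punctured n),
      e = γ.isLocalHomeomorph_proj.localInverseAt b ∧ γ.proj z ∈ (e ≫ₕ chartAt (Cn n) b).source ∧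
      chartAt (Cn n) (γ.proj z) = e ≫ₕ chartAt (Cn n) b :=
    ⟨_, _, rfl, mem_chart_source (Cn n) (γ.proj z), rfl⟩
  have hzs : γ.proj z ∈ e.source := by
    rw [OpenPartialHomeomorph.trans_source] at hz
    exact hz.1
  subst he
  obtain ⟨g, hg⟩ := γ.eventuallyEq_localInverseAt hzs
  set e := γ.isLocalHomeomorph_proj.localInverseAt b with he
  have hes : ContMDiffAt 𝓘(ℂ, Cn n) 𝓘(ℂ, Cn n) ω e (γ.proj z) := by
    refine contMDiffAt_of_val_comp ?_
    have h1 : ContMDiffAt 𝓘(ℂ, Cn n) 𝓘(ℂ, Cn n) ω (chartAt (Cn n) (γ.proj z)) (γ.proj z) :=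
      contMDiffOn_chart.contMDiffAt ((chartAt (Cn n) _).open_source.mem_nhds
        (mem_chart_source (Cn n) (γ.proj z)))
    rw [hzc] at h1
    exact h1
  -- The branch `e` underlying the chart may send `π z` to another point `g • z` of the orbit; `g⁻¹`
  -- brings it back to `z`.
  refine ⟨fun y => g⁻¹ • e y, (γ.contMDiff_smul g⁻¹).contMDiffAt.comp _ hes, ?_, ?_, ?_⟩
  · change g⁻¹ • e (γ.proj z) = z
    rw [hg.self_of_nhds, inv_smul_smul]
  · filter_upwards [e.open_source.mem_nhds hzs] with y hy
    have h1 : γ.proj (e y) = y := γ.isLocalHomeomorph_proj.apply_localInverseAt_of_mem hy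
    have h2 : γ.proj (g⁻¹ • e y) = γ.proj (e y) := γ.proj_eq_iff.2 ⟨g⁻¹, rfl⟩
    rw [h2, h1]
  · filter_upwards [hg] with w hw
    rw [hw, inv_smul_smul]

lemma proj_perm (z : punctured n) : γ.proj (γ.perm z) = γ.proj z :=
  γ.proj_eq_iff.2 ⟨⟨γ.perm, Subgroup.mem_zpowers _⟩, rfl⟩

lemma contMDiffAt_proj_toPunctured (p : punctured n) {z : Cn n} (hz : z ≠ 0) :
    ContMDiffAt 𝓘(ℂ, Cn n) 𝓘(ℂ, Cn n) ω (fun w => γ.proj (toPunctured p w)) z :=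
  γ.contMDiff_proj.contMDiffAt.comp z (contMDiffAt_toPunctured p hz)

/-- The differential of `π` at `z`. -/
def tangentLift (z : punctured n) : Cn n →L[ℂ] TangentSpace 𝓘(ℂ, Cn n) (γ.proj z) :=
  (mfderiv 𝓘(ℂ, Cn n) 𝓘(ℂ, Cn n) (fun w => γ.proj (toPunctured z w)) (z : Cn n) :
    Cn n →L[ℂ] Cn n)

/-- The filler value `p` at `0` is irrelevant, as derivatives are local; fixing one `p` gives a
single map to differentiate at all points. -/
lemma tangentLift_eq (p z : punctured n) :
    (γ.tangentLift z : Cn n →L[ℂ] Cn n) =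
      mfderiv 𝓘(ℂ, Cn n) 𝓘(ℂ, Cn n) (fun w => γ.proj (toPunctured p w)) (z : Cn n) := by
  refine Filter.EventuallyEq.mfderiv_eq ?_
  filter_upwards [eventually_coe_toPunctured p z.2, eventually_coe_toPunctured z z.2] with w h1 h2
  rw [Subtype.ext (h1.trans h2.symm)]

/-- The constant vector field `v` is holomorphic, and so is its image under the tangent map of `π`.
-/
lemma contMDiff_tangentLift (v : Cn n) :
    ContMDiff 𝓘(ℂ, Cn n) (𝓘(ℂ, Cn n).prod 𝓘(ℂ, Cn n)) ω
      (fun z => (⟨γ.proj z, γ.tangentLift z v⟩ :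
        Bundle.TotalSpace (Cn n) (fun x : γ.Hopf => TangentSpace 𝓘(ℂ, Cn n) x))) := by
  intro z
  have hopen : IsOpen ({0}ᶜ : Set (Cn n)) := isOpen_compl_singleton
  set f : Cn n → γ.Hopf := fun w => γ.proj (toPunctured z w) with hf
  have hfs : ContMDiffOn 𝓘(ℂ, Cn n) 𝓘(ℂ, Cn n) ω f {0}ᶜ := fun w hw =>
    (γ.contMDiffAt_proj_toPunctured z hw).contMDiffWithinAt
  have h1 := hfs.contMDiffOn_tangentMapWithin (m := ω) le_rfl hopen.uniqueMDiffOn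
  have h2 : ContMDiff 𝓘(ℂ, Cn n) 𝓘(ℂ, Cn n).tangent ω
      (fun w : Cn n => (⟨w, v⟩ : TangentBundle 𝓘(ℂ, Cn n) (Cn n))) := fun w =>
    contMDiffAt_vectorSpace_iff_contDiffAt.2 contDiffAt_const
  have h3 := h1.comp (s := {0}ᶜ) h2.contMDiffOn (fun w hw => hw)
  have h4 := (h3.comp (s := Set.univ) contMDiff_subtype_val.contMDiffOn
    (fun w _ => w.2)).contMDiffAt (x := z) Filter.univ_mem
  refine h4.congr_of_eventuallyEq (Filter.Eventually.of_forall fun w => ?_)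
  have h5 := γ.tangentLift_eq z w
  rw [← mfderivWithin_of_isOpen hopen w.2] at h5
  have h6 : γ.proj w = f w := by rw [hf]; simp
  have key : ∀ (x y : γ.Hopf) (a c : Cn n), x = y → a = c →
      (⟨x, a⟩ : Bundle.TotalSpace (Cn n) (fun x : γ.Hopf => TangentSpace 𝓘(ℂ, Cn n) x)) =
        ⟨y, c⟩ := by
    rintro x _ a _ rfl rfl
    rfl
  exact key _ _ _ _ h6 (congrArg (fun T : Cn n →L[ℂ] Cn n => T v) h5)

lemma tangentLift_injective (z : punctured n) : Function.Injective (γ.tangentLift z) := by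
  obtain ⟨ρ, hρ, hρz, -, hρw⟩ := γ.exists_contMDiffAt_localInverse z
  set f : Cn n → γ.Hopf := fun w => γ.proj (toPunctured z w) with hf
  have hfz : f z = γ.proj z := by rw [hf]; simp
  have hfd : MDifferentiableAt 𝓘(ℂ, Cn n) 𝓘(ℂ, Cn n) f (z : Cn n) :=
    (γ.contMDiffAt_proj_toPunctured z z.2).mdifferentiableAt (by simp)
  have hg : MDifferentiableAt 𝓘(ℂ, Cn n) 𝓘(ℂ, Cn n) (fun y => (ρ y : Cn n)) (f z) := by
    rw [hfz]
    exact (contMDiff_subtype_val.contMDiffAt.comp _ hρ).mdifferentiableAt (by simp)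
  have h1 := mfderiv_comp (z : Cn n) hg hfd
  have h2 : (fun y => (ρ y : Cn n)) ∘ f =ᶠ[𝓝 (z : Cn n)] id := by
    have ht : Filter.Tendsto (toPunctured z) (𝓝 (z : Cn n)) (𝓝 z) := by
      have := (contMDiffAt_toPunctured z z.2).continuousAt.tendsto
      rwa [toPunctured_coe] at this
    filter_upwards [ht.eventually hρw, eventually_coe_toPunctured z z.2] with w hw hw'
    simp only [Function.comp_apply, hf, hw, hw', id]
  have h3 : (mfderiv 𝓘(ℂ, Cn n) 𝓘(ℂ, Cn n) ((fun y => (ρ y : Cn n)) ∘ f) (z : Cn n) :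
      Cn n →L[ℂ] Cn n) = ContinuousLinearMap.id ℂ (Cn n) :=
    (Filter.EventuallyEq.mfderiv_eq h2).trans mfderiv_id
  intro v w hvw
  have h4 : ∀ u : Cn n, (mfderiv 𝓘(ℂ, Cn n) 𝓘(ℂ, Cn n) (fun y => (ρ y : Cn n)) (f z) :
      Cn n →L[ℂ] Cn n) (γ.tangentLift z u : Cn n) = u := fun u => by
    have := congrArg (fun T : Cn n →L[ℂ] Cn n => T u) (h1.symm.trans h3)
    exact this
  rw [← h4 v, ← h4 w]
  exact congrArg _ hvw

/-- The chain rule for `π ∘ γ = π`. The two sides lie in tangent spaces at propositionally equal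
points, and are compared in the common model `Cn n`. -/
lemma tangentLift_perm (z : punctured n) (v : Cn n) :
    (γ.tangentLift (γ.perm z) (fderiv ℂ γ.toDiffeo z v) : Cn n) = (γ.tangentLift z v : Cn n) := by
  set f : Cn n → γ.Hopf := fun w => γ.proj (toPunctured z w) with hf
  have hγd : MDifferentiableAt 𝓘(ℂ, Cn n) 𝓘(ℂ, Cn n) γ.toDiffeo (z : Cn n) :=
    γ.toDiffeo.contMDiff.contMDiffAt.mdifferentiableAt (by simp)
  have hfd : MDifferentiableAt 𝓘(ℂ, Cn n) 𝓘(ℂ, Cn n) f (γ.toDiffeo z) :=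
    (γ.contMDiffAt_proj_toPunctured z (γ.perm z).2).mdifferentiableAt (by simp)
  have h1 := mfderiv_comp (z : Cn n) hfd hγd
  have h2 : f ∘ γ.toDiffeo =ᶠ[𝓝 (z : Cn n)] f := by
    filter_upwards [eventually_coe_toPunctured z z.2] with w hw
    have h3 : toPunctured z (γ.toDiffeo w) = γ.perm (toPunctured z w) := by
      have : γ.toDiffeo w = γ.perm (toPunctured z w) := by rw [coe_perm, hw]
      rw [this, toPunctured_coe]
    simp only [Function.comp_apply, hf, h3, γ.proj_perm]
  have h3 : (mfderiv 𝓘(ℂ, Cn n) 𝓘(ℂ, Cn n) (f ∘ γ.toDiffeo) (z : Cn n) : Cn n →L[ℂ] Cn n) =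
      mfderiv 𝓘(ℂ, Cn n) 𝓘(ℂ, Cn n) f (z : Cn n) := Filter.EventuallyEq.mfderiv_eq h2
  rw [mfderiv_eq_fderiv] at h1
  have h4 := γ.tangentLift_eq z z
  have h5 := γ.tangentLift_eq z (γ.perm z)
  have h6 := congrArg (fun T : Cn n →L[ℂ] Cn n => T v) (h1.symm.trans h3)
  exact (congrArg (fun T : Cn n →L[ℂ] Cn n => T (fderiv ℂ γ.toDiffeo z v)) h5).trans
    (h6.trans (congrArg (fun T : Cn n →L[ℂ] Cn n => T v) h4).symm)

end HolContraction

/-! ### Frames of `j_* π^* B_H` and their values away from `0` -/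

namespace HolContraction

variable {n : ℕ} (γ : HolContraction n)

section Frames

variable (F : Type*) [NormedAddCommGroup F] [NormedSpace ℂ F]
  (E : γ.Hopf → Type*) [TopologicalSpace (Bundle.TotalSpace F E)]
  [∀ x, AddCommGroup (E x)] [∀ x, Module ℂ (E x)] [∀ x, TopologicalSpace (E x)]
  [FiberBundle F E] [VectorBundle ℂ F E]

/-- `e` is a frame over `U` of the sheaf `j_* π^* B_H` of `𝒪`-modules. -/
def IsFrameOn (U : Set (Cn n)) {r : ℕ} (e : Fin r → ∀ z : punctured n, E (γ.proj z)) : Prop :=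
  IsOpen U ∧ (∀ i, γ.IsPushforwardSection F E U (e i)) ∧
    ∀ V : Set (Cn n), IsOpen V → V ⊆ U →
      ∀ s : ∀ z : punctured n, E (γ.proj z), γ.IsPushforwardSection F E V s →
        ∃ f : Fin r → Cn n → ℂ,
          ((∀ i, AnalyticOnNhd ℂ (f i) V) ∧
            ∀ z : punctured n, (z : Cn n) ∈ V → s z = ∑ i, f i z • e i z) ∧
          ∀ f' : Fin r → Cn n → ℂ,
            ((∀ i, AnalyticOnNhd ℂ (f' i) V) ∧
              ∀ z : punctured n, (z : Cn n) ∈ V → s z = ∑ i, f' i z • e i z) →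
            ∀ i, Set.EqOn (f' i) (f i) V

variable {F E} {γ}

lemma IsHolSection.congr {W : Set (punctured n)} {s t : ∀ z : punctured n, E (γ.proj z)}
    (hs : γ.IsHolSection F E W s) (h : ∀ z ∈ W, t z = s z) : γ.IsHolSection F E W t :=
  ContMDiffOn.congr hs fun z hz => by rw [h z hz]

lemma IsPushforwardSection.smul {U : Set (Cn n)} {s : ∀ z : punctured n, E (γ.proj z)}
    (hs : γ.IsPushforwardSection F E U s) {f : Cn n → ℂ} (hf : AnalyticOnNhd ℂ f U) :
    γ.IsPushforwardSection F E U (fun z => f z • s z) := by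
  intro z hz
  have h1 := (Bundle.contMDiffWithinAt_totalSpace (F := F) (E := E)).1 (hs z hz)
  refine (Bundle.contMDiffWithinAt_totalSpace (F := F) (E := E)).2 ⟨h1.1, ?_⟩
  have key : ∀ w : punctured n, γ.proj w ∈ (trivializationAt F E (γ.proj z)).baseSet →
      (trivializationAt F E (γ.proj z) ⟨γ.proj w, f w • s w⟩).2 =
      f w • (trivializationAt F E (γ.proj z) ⟨γ.proj w, s w⟩).2 := by
    intro w hw
    have hl := (trivializationAt F E (γ.proj z)).linear ℂ hw
    rw [← hl.map_smul]
  have hmem : ∀ᶠ w in 𝓝 z, γ.proj w ∈ (trivializationAt F E (γ.proj z)).baseSet :=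
    γ.contMDiff_proj.continuous.continuousAt.eventually
      ((trivializationAt F E (γ.proj z)).open_baseSet.mem_nhds
        (FiberBundle.mem_baseSet_trivializationAt F E _))
  have hfz : ContMDiffAt 𝓘(ℂ, Cn n) 𝓘(ℂ, ℂ) ω (fun w : punctured n => f w) z :=
    (hf z hz).contDiffAt.contMDiffAt.comp z contMDiff_subtype_val.contMDiffAt
  refine (hfz.contMDiffWithinAt.smul h1.2).congr_of_eventuallyEq ?_ ?_
  · filter_upwards [mem_nhdsWithin_of_mem_nhds hmem] with w hw using key w hw
  · exact key z hmem.self_of_nhds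

lemma isPushforwardSection_sum {ι : Type*} (t : Finset ι) {U : Set (Cn n)}
    {s : ι → ∀ z : punctured n, E (γ.proj z)}
    (hs : ∀ i ∈ t, γ.IsPushforwardSection F E U (s i)) :
    γ.IsPushforwardSection F E U (fun z => ∑ i ∈ t, s i z) := by
  classical
  induction t using Finset.induction_on with
  | empty => exact IsHolSection.congr (γ.isHolSection_zero F E _) fun z _ => by simp
  | insert a t ha ih =>
    refine IsHolSection.congr (IsHolSection.linearComb γ (hs a (Finset.mem_insert_self a t))
      (ih fun i hi => hs i (Finset.mem_insert_of_mem hi)) 1) fun z _ => ?_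
    simp [Finset.sum_insert ha]

/-- Every vector in a trivialisation extends to a holomorphic section. -/
lemma isHolSection_symm_const (x : γ.Hopf) (φ : F) [ContMDiffVectorBundle ω F E 𝓘(ℂ, Cn n)] :
    γ.IsHolSection F E (γ.proj ⁻¹' (trivializationAt F E x).baseSet)
      (fun w => (trivializationAt F E x).symm (γ.proj w) φ) := by
  refine ((trivializationAt F E x).contMDiffOn_iff fun w hw => ?_).2
    ⟨γ.contMDiff_proj.contMDiffOn, ?_⟩
  · rw [Bundle.Trivialization.mem_source]
    exact hw
  · refine contMDiffOn_const (c := φ) |>.congr fun w hw => ?_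
    exact congrArg Prod.snd ((trivializationAt F E x).apply_mk_symm hw φ)

namespace IsFrameOn

variable {U : Set (Cn n)} {r : ℕ} {e : Fin r → ∀ z : punctured n, E (γ.proj z)}

lemma isPushforwardSection_sum_smul (he : γ.IsFrameOn F E U e) {V : Set (Cn n)} (hVU : V ⊆ U)
    {f : Fin r → Cn n → ℂ} (hf : ∀ i, AnalyticOnNhd ℂ (f i) V) :
    γ.IsPushforwardSection F E V (fun z => ∑ i, f i z • e i z) :=
  isPushforwardSection_sum _ fun i _ =>
    IsPushforwardSection.smul ((he.2.1 i).mono γ fun _ hz => hVU hz) (hf i)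

lemma exists_coords (he : γ.IsFrameOn F E U e) {V : Set (Cn n)} (hV : IsOpen V) (hVU : V ⊆ U)
    {s : ∀ z : punctured n, E (γ.proj z)} (hs : γ.IsPushforwardSection F E V s) :
    ∃ f : Fin r → Cn n → ℂ, (∀ i, AnalyticOnNhd ℂ (f i) V) ∧
      ∀ z : punctured n, (z : Cn n) ∈ V → s z = ∑ i, f i z • e i z := by
  obtain ⟨f, hf, -⟩ := he.2.2 V hV hVU s hs
  exact ⟨f, hf⟩

lemma eqOn_coords (he : γ.IsFrameOn F E U e) {V : Set (Cn n)} (hV : IsOpen V) (hVU : V ⊆ U)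
    {f g : Fin r → Cn n → ℂ} (hf : ∀ i, AnalyticOnNhd ℂ (f i) V)
    (hg : ∀ i, AnalyticOnNhd ℂ (g i) V)
    (h : ∀ z : punctured n, (z : Cn n) ∈ V → ∑ i, f i z • e i z = ∑ i, g i z • e i z) (i : Fin r) :
    Set.EqOn (f i) (g i) V := by
  obtain ⟨f₀, -, hun⟩ := he.2.2 V hV hVU _ (he.isPushforwardSection_sum_smul hVU hf)
  exact (hun f ⟨hf, fun _ _ => rfl⟩ i).trans (hun g ⟨hg, h⟩ i).symm

variable [ContMDiffVectorBundle ω F E 𝓘(ℂ, Cn n)]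

lemma exists_trivializing_nhds (he : γ.IsFrameOn F E U e) {z : punctured n}
    (hz : (z : Cn n) ∈ U) : ∃ V : Set (Cn n), IsOpen V ∧ V ⊆ U ∧ 0 ∉ V ∧ (z : Cn n) ∈ V ∧
      ∀ w : punctured n, (w : Cn n) ∈ V →
        γ.proj w ∈ (trivializationAt F E (γ.proj z)).baseSet := by
  refine ⟨U ∩ Subtype.val '' (γ.proj ⁻¹' (trivializationAt F E (γ.proj z)).baseSet), ?_,
    Set.inter_subset_left, fun ⟨_, w, _, hw⟩ => w.2 hw,
    ⟨hz, z, FiberBundle.mem_baseSet_trivializationAt F E _, rfl⟩, ?_⟩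
  · exact he.1.inter ((punctured n).isOpen.isOpenMap_subtype_val _
      ((trivializationAt F E (γ.proj z)).open_baseSet.preimage γ.contMDiff_proj.continuous))
  · rintro w ⟨-, w', hw', hww'⟩
    rwa [← Subtype.ext hww']

/-- A vector extends to a holomorphic section by a trivialisation of `B_H`, and the section has
coordinates in the frame. -/
lemma exists_eq_sum (he : γ.IsFrameOn F E U e) {z : punctured n} (hz : (z : Cn n) ∈ U)
    (x : E (γ.proj z)) : ∃ c : Fin r → ℂ, x = ∑ i, c i • e i z := by
  obtain ⟨V, hV, hVU, hz0, hzV, hVb⟩ := he.exists_trivializing_nhds hz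
  set t := trivializationAt F E (γ.proj z) with ht
  obtain ⟨f, -, hf⟩ := he.exists_coords hV hVU
    ((isHolSection_symm_const (γ.proj z) (t ⟨γ.proj z, x⟩).2).mono γ fun w hw => hVb w hw)
  refine ⟨fun i => f i z, ?_⟩
  rw [← hf z hzV]
  exact (t.symm_apply_apply_mk (hVb z hzV) x).symm

variable [FiniteDimensional ℂ F]

/-- Uniqueness of coordinates concerns sections, while the relation holds at a single point. So `s =
∑ c i • e i` is expanded in a local trivialisation, with coefficients vanishing at `z`, and each
member of that local frame is expanded in `e` again. -/
lemma linearIndependent (he : γ.IsFrameOn F E U e) {z : punctured n} (hz : (z : Cn n) ∈ U) :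
    LinearIndependent ℂ fun i => e i z := by
  rw [Fintype.linearIndependent_iff]
  intro c hc
  obtain ⟨V, hV, hVU, hz0, hzV, hVb⟩ := he.exists_trivializing_nhds hz
  set t := trivializationAt F E (γ.proj z) with ht
  let φ := Module.finBasis ℂ F
  choose h hh hhs using fun k => he.exists_coords hV hVU
    ((isHolSection_symm_const (γ.proj z) (φ k)).mono γ fun w hw => hVb w hw)
  let s : ∀ w : punctured n, E (γ.proj w) := fun w => ∑ i, c i • e i w
  have hs : γ.IsPushforwardSection F E V s :=
    he.isPushforwardSection_sum_smul hVU (f := fun i _ => c i) fun i => analyticOnNhd_const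
  let g : punctured n → F := fun w => (t ⟨γ.proj w, s w⟩).2
  have hg : ∀ w : punctured n, (w : Cn n) ∈ V →
      AnalyticAt ℂ (fun y => g (toPunctured z y)) (w : Cn n) := by
    intro w hw
    have hVo : Subtype.val ⁻¹' V ∈ 𝓝 w := (hV.preimage continuous_subtype_val).mem_nhds hw
    refine analyticAt_comp_toPunctured z (g := g) ?_
    refine ((t.contMDiffAt_iff ?_).1 (hs.contMDiffAt hVo)).2
    rw [Bundle.Trivialization.mem_source]
    exact hVb w hw
  have hsg : ∀ w : punctured n, (w : Cn n) ∈ V →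
      s w = ∑ k, φ.repr (g w) k • t.symm (γ.proj w) (φ k) := by
    intro w hw
    rw [← t.symm_apply_apply_mk (hVb w hw) (s w)]
    have hlin : t.symm (γ.proj w) = t.symmₗ ℂ (γ.proj w) := (t.coe_symmₗ (hVb w hw)).symm
    rw [hlin]
    simp only [← map_smul, ← map_sum]
    congr 1
    exact (φ.sum_repr (g w)).symm
  -- Both families are coordinates of `s`, hence equal on `V`; at `z` the second is `0` because `g z
  -- = 0`.
  have key := he.eqOn_coords hV hVU (f := fun i _ => c i)
    (g := fun i y => ∑ k, φ.repr (g (toPunctured z y)) k * h k i y)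
    (fun i => analyticOnNhd_const) (fun i y hy => ?_) (fun w hw => ?_)
  · intro i
    have h1 := key i hzV
    simp only [toPunctured_coe] at h1
    rw [h1]
    have h2 : g z = 0 := by
      have h3 : s z = 0 := hc
      have hl := (t.linear ℂ (hVb z hzV)).map_zero
      simp only [g, h3]
      exact hl
    simp [h2]
  · refine Finset.analyticAt_fun_sum _ fun k _ => AnalyticAt.mul ?_ (hh k i y hy)
    have hy0 : y ≠ 0 := fun h0 => hz0 (h0 ▸ hy)
    have h1 := hg ⟨y, hy0⟩ hy
    exact ((LinearMap.toContinuousLinearMap (φ.coord k)).analyticAt _).comp h1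
  · change s w = _
    rw [hsg w hw]
    simp only [toPunctured_coe, Finset.sum_smul, mul_smul]
    rw [Finset.sum_comm]
    refine Finset.sum_congr rfl fun k _ => ?_
    rw [hhs k w hw, Finset.smul_sum]

end IsFrameOn

end Frames

end HolContraction

/-! ### The action of `γ` on the fibre at `0` in a frame -/

namespace HolContraction

variable {n : ℕ} (γ : HolContraction n)

section FibreAction

variable (F : Type*) [NormedAddCommGroup F] [NormedSpace ℂ F]
  (E : γ.Hopf → Type*) [TopologicalSpace (Bundle.TotalSpace F E)]
  [∀ x, AddCommGroup (E x)] [∀ x, Module ℂ (E x)] [∀ x, TopologicalSpace (E x)]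
  [FiberBundle F E] [VectorBundle ℂ F E]

/-- The canonical action of `γ⁻¹` on sections of `π^* B_H`. -/
def inverseAction :
    (∀ z : punctured n, E (γ.proj z)) →ₗ[ℂ] (∀ z : punctured n, E (γ.proj z)) where
  toFun s z := LinearEquiv.cast (R := ℂ) (M := E) (γ.proj_perm z) (s (γ.perm z))
  map_add' s t := by ext z; exact map_add _ _ _
  map_smul' c s := by ext z; exact map_smul _ _ _

variable {E} {γ}

lemma mk_cast {x y : γ.Hopf} (h : x = y) (v : E x) :
    (⟨y, LinearEquiv.cast (R := ℂ) (M := E) h v⟩ : Bundle.TotalSpace F E) = ⟨x, v⟩ := by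
  subst h
  rfl

lemma inverseAction_equivariantAction (s : ∀ z : punctured n, E (γ.proj z)) :
    γ.inverseAction E (γ.equivariantAction E s) = s := by
  ext z
  -- `γ⁻¹ (γ z)` is generalised to `w`, so that the equality of points can be substituted in the
  -- dependent fibres.
  have key : ∀ (w : punctured n) (h : γ.proj w = γ.proj (γ.perm z)) (_ : w = z),
      LinearEquiv.cast (R := ℂ) (M := E) (γ.proj_perm z)
        (LinearEquiv.cast (R := ℂ) (M := E) h (s w)) = s z := by
    rintro w h rfl
    have h2 : ∀ (x y : γ.Hopf) (h : x = y) (h' : y = x) (v : E x),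
        LinearEquiv.cast (R := ℂ) (M := E) h' (LinearEquiv.cast (R := ℂ) (M := E) h v) = v := by
      rintro x _ rfl _ v
      rfl
    exact h2 _ _ _ _ _
  exact key _ (γ.proj_perm_symm (γ.perm z)) (γ.perm.symm_apply_apply z)

variable {F}

lemma IsPushforwardSection.inverseAction {U : Set (Cn n)} {s : ∀ z : punctured n, E (γ.proj z)}
    (hs : γ.IsPushforwardSection F E U s) :
    γ.IsPushforwardSection F E (γ.toDiffeo ⁻¹' U) (γ.inverseAction E s) := by
  refine ContMDiffOn.congr (f := fun z => (⟨γ.proj (γ.perm z), s (γ.perm z)⟩ :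
    Bundle.TotalSpace F E)) ?_ fun z _ => mk_cast F (γ.proj_perm z) (s (γ.perm z))
  exact ContMDiffOn.comp (t := Subtype.val ⁻¹' U) hs γ.contMDiff_perm.contMDiffOn fun z hz => hz

/-- The linear map `ℂʳ → E (π z)` given by the sections `e₁, …, e_r`. -/
def frameMap {r : ℕ} (e : Fin r → ∀ z : punctured n, E (γ.proj z)) (z : punctured n) :
    (Fin r → ℂ) →ₗ[ℂ] E (γ.proj z) :=
  Fintype.linearCombination ℂ fun i => e i z

lemma frameMap_apply {r : ℕ} (e : Fin r → ∀ z : punctured n, E (γ.proj z)) (z : punctured n)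
    (x : Fin r → ℂ) : frameMap e z x = ∑ i, x i • e i z := rfl

/-- The continuous linear map with the given matrix. -/
def matrixCLM {r : ℕ} (m : Fin r → Fin r → ℂ) : (Fin r → ℂ) →L[ℂ] (Fin r → ℂ) :=
  ∑ j, ∑ i, m j i • (ContinuousLinearMap.proj i : (Fin r → ℂ) →L[ℂ] ℂ).smulRight (Pi.single j 1)

lemma matrixCLM_apply {r : ℕ} (m : Fin r → Fin r → ℂ) (x : Fin r → ℂ) (j : Fin r) :
    matrixCLM m x j = ∑ i, m j i * x i := by
  simp [matrixCLM, Pi.single_apply, Finset.sum_apply]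

lemma analyticAt_matrixCLM {V : Type*} [NormedAddCommGroup V] [NormedSpace ℂ V] {r : ℕ}
    {m : Fin r → Fin r → V → ℂ} {z : V} (hm : ∀ j i, AnalyticAt ℂ (m j i) z) :
    AnalyticAt ℂ (fun z => matrixCLM fun j i => m j i z) z :=
  Finset.analyticAt_fun_sum _ fun j _ => Finset.analyticAt_fun_sum _ fun i _ =>
    (hm j i).smul analyticAt_const

lemma frameMap_matrixCLM {r : ℕ} (e : Fin r → ∀ z : punctured n, E (γ.proj z)) (z : punctured n)
    (m : Fin r → Fin r → ℂ) (x : Fin r → ℂ) :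
    frameMap e z (matrixCLM m x) = ∑ i, x i • ∑ j, m j i • e j z := by
  rw [frameMap_apply]
  simp only [matrixCLM_apply, Finset.sum_smul, Finset.smul_sum, smul_smul]
  rw [Finset.sum_comm]
  simp only [mul_comm]

namespace IsFrameOn

variable {U : Set (Cn n)} {r : ℕ} {e : Fin r → ∀ z : punctured n, E (γ.proj z)}

/-- The matrix of the action of `γ` in a frame near `0`. -/
lemma exists_cocycle (he : γ.IsFrameOn F E U e) :
    ∃ B : Cn n → (Fin r → ℂ) →L[ℂ] (Fin r → ℂ),
      AnalyticOnNhd ℂ B (U ∩ γ.toDiffeo ⁻¹' U) ∧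
      ∀ z : punctured n, (z : Cn n) ∈ U → γ.toDiffeo z ∈ U → ∀ x,
        LinearEquiv.cast (R := ℂ) (M := E) (γ.proj_perm z) (frameMap e (γ.perm z) x) =
          frameMap e z (B z x) := by
  have hU' : IsOpen (U ∩ γ.toDiffeo ⁻¹' U) := he.1.inter (he.1.preimage γ.toDiffeo.continuous)
  -- The columns of `B` are the coordinates of the translates of the `e i` by `γ⁻¹`; these
  -- coordinates are holomorphic at `0` too when `0 ∈ U`.
  choose b hb hbe using fun i => he.exists_coords hU' Set.inter_subset_left
    ((he.2.1 i).inverseAction.mono γ fun z (hz : (z : Cn n) ∈ U ∩ γ.toDiffeo ⁻¹' U) => hz.2)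
  refine ⟨fun z => matrixCLM fun j i => b i j z, fun z hz =>
    analyticAt_matrixCLM fun j i => hb i j z hz, fun z hz hz' x => ?_⟩
  rw [frameMap_matrixCLM, frameMap_apply, map_sum]
  refine Finset.sum_congr rfl fun i _ => ?_
  rw [map_smul]
  congr 1
  exact hbe i z ⟨hz, hz'⟩

/-- `f` gives the coordinates of `s` near `0`. -/
def HasGerm (e : Fin r → ∀ z : punctured n, E (γ.proj z)) (s : ∀ z : punctured n, E (γ.proj z))
    (f : Cn n → Fin r → ℂ) : Prop :=
  AnalyticAt ℂ f 0 ∧ ∀ᶠ z : punctured n in Filter.comap Subtype.val (𝓝 0),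
    s z = frameMap e z (f z)

lemma exists_hasGerm (he : γ.IsFrameOn F E U e) (h0 : 0 ∈ U)
    {s : ∀ z : punctured n, E (γ.proj z)} (hs : s ∈ γ.sectionsNearZero F E) :
    ∃ f, HasGerm e s f := by
  obtain ⟨U', hU', h0', hs⟩ := hs
  obtain ⟨f, hf, hsf⟩ := he.exists_coords (he.1.inter hU') Set.inter_subset_left
    (hs.mono γ fun z (hz : (z : Cn n) ∈ U ∩ U') => hz.2)
  refine ⟨fun z i => f i z, analyticAt_pi_iff.2 fun i => hf i 0 ⟨h0, h0'⟩, ?_⟩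
  exact Filter.mem_of_superset (Filter.preimage_mem_comap ((he.1.inter hU').mem_nhds ⟨h0, h0'⟩))
    fun z hz => hsf z hz

lemma eventuallyEq_of_hasGerm (he : γ.IsFrameOn F E U e) (h0 : 0 ∈ U)
    {s : ∀ z : punctured n, E (γ.proj z)} {f g : Cn n → Fin r → ℂ} (hf : HasGerm e s f)
    (hg : HasGerm e s g) : f =ᶠ[𝓝 0] g := by
  have h1 := hf.2.and hg.2
  rw [Filter.eventually_comap] at h1
  have h2 := h1.and (hf.1.eventually_analyticAt.and
    (hg.1.eventually_analyticAt.and (he.1.mem_nhds h0)))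
  obtain ⟨V, hV, hVo, h0V⟩ := eventually_nhds_iff.1 h2
  have := he.eqOn_coords hVo (fun z hz => (hV z hz).2.2.2) (f := fun i z => f z i)
    (g := fun i z => g z i) (fun i z hz => analyticAt_pi_iff.1 (hV z hz).2.1 i)
    (fun i z hz => analyticAt_pi_iff.1 (hV z hz).2.2.1 i)
    (fun z hz => by
      obtain ⟨h3, h4⟩ := (hV z hz).1 z rfl
      exact h3.symm.trans h4)
  filter_upwards [hVo.mem_nhds h0V] with z hz
  ext i
  exact this i hz

lemma exists_section_of_germ (he : γ.IsFrameOn F E U e) (h0 : 0 ∈ U)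
    {f : Cn n → Fin r → ℂ} (hf : AnalyticAt ℂ f 0) :
    ∃ s : γ.sectionsNearZero F E, HasGerm e s.1 f := by
  have h2 := hf.eventually_analyticAt.and (he.1.mem_nhds h0)
  obtain ⟨V, hV, hVo, h0V⟩ := eventually_nhds_iff.1 h2
  refine ⟨⟨fun z => frameMap e z (f z), V, hVo, h0V, ?_⟩, hf, Filter.Eventually.of_forall
    fun _ => rfl⟩
  exact he.isPushforwardSection_sum_smul (fun z hz => (hV z hz).2) (f := fun i z => f z i)
    fun i z hz => analyticAt_pi_iff.1 (hV z hz).1 i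

/-- Near `0`, `s` is the sum of the `f i • e i` with `f i` vanishing at `0`. What remains vanishes
near `0` and is a generator with coefficient function `0`. -/
lemma mem_maximalIdealSections_of_hasGerm (he : γ.IsFrameOn F E U e) (h0 : 0 ∈ U)
    {s : γ.sectionsNearZero F E} {f : Cn n → Fin r → ℂ} (hf : HasGerm e s.1 f) (hf0 : f 0 = 0) :
    s ∈ γ.maximalIdealSections F E := by
  have hfi : ∀ i, AnalyticAt ℂ (fun z => f z i) 0 := analyticAt_pi_iff.1 hf.1
  choose u hu using fun i => he.exists_section_of_germ h0
    (f := fun z => Pi.single i (f z i)) (by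
      refine analyticAt_pi_iff.2 fun j => ?_
      rcases eq_or_ne j i with rfl | hji
      · simpa using hfi j
      · simpa [hji] using analyticAt_const)
  have hui : ∀ i, u i ∈ γ.maximalIdealSections F E := fun i => by
    refine Submodule.subset_span ⟨fun z => f z i, hfi i, by simp [hf0],
      ⟨e i, U, he.1, h0, he.2.1 i⟩, ?_⟩
    filter_upwards [(hu i).2] with z hz
    rw [hz, frameMap_apply, Finset.sum_eq_single i]
    · simp
    · intro j _ hji
      simp [hji]
    · simp
  have hrest : s - ∑ i, u i ∈ γ.maximalIdealSections F E := by
    refine Submodule.subset_span ⟨fun _ => 0, analyticAt_const, rfl, 0, ?_⟩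
    filter_upwards [hf.2, Filter.eventually_all.2 fun i => (hu i).2] with z hz hzu
    rw [zero_smul]
    have : (s - ∑ i, u i).1 z = s.1 z - ∑ i, (u i).1 z := by simp
    rw [this, hz, sub_eq_zero]
    simp only [hzu]
    rw [← map_sum]
    congr 1
    ext j
    simp [Finset.sum_apply, Pi.single_apply]
  have := Submodule.add_mem _ hrest (Submodule.sum_mem _ fun i (_ : i ∈ Finset.univ) => hui i)
  simpa using this

/-- The value of the coordinates at `0`. -/
def evalZero (he : γ.IsFrameOn F E U e) (h0 : 0 ∈ U) :
    γ.sectionsNearZero F E →ₗ[ℂ] (Fin r → ℂ) where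
  toFun s := (he.exists_hasGerm h0 s.2).choose 0
  map_add' s t := by
    have hs := (he.exists_hasGerm h0 s.2).choose_spec
    have ht := (he.exists_hasGerm h0 t.2).choose_spec
    refine (he.eventuallyEq_of_hasGerm h0 (he.exists_hasGerm h0 (s + t).2).choose_spec
      (g := fun z => (he.exists_hasGerm h0 s.2).choose z +
        (he.exists_hasGerm h0 t.2).choose z) ⟨hs.1.add ht.1, ?_⟩).self_of_nhds
    filter_upwards [hs.2, ht.2] with z h1 h2
    rw [map_add, ← h1, ← h2]
    rfl
  map_smul' c s := by
    have hs := (he.exists_hasGerm h0 s.2).choose_spec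
    refine (he.eventuallyEq_of_hasGerm h0 (he.exists_hasGerm h0 (c • s).2).choose_spec
      (g := fun z => c • (he.exists_hasGerm h0 s.2).choose z)
      ⟨(analyticAt_const (v := c)).fun_smul hs.1, ?_⟩).self_of_nhds
    filter_upwards [hs.2] with z h1
    rw [map_smul, ← h1]
    rfl

lemma evalZero_eq (he : γ.IsFrameOn F E U e) (h0 : 0 ∈ U) {s : γ.sectionsNearZero F E}
    {f : Cn n → Fin r → ℂ} (hf : HasGerm e s.1 f) : he.evalZero h0 s = f 0 :=
  (he.eventuallyEq_of_hasGerm h0 (he.exists_hasGerm h0 s.2).choose_spec hf).self_of_nhds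

lemma evalZero_surjective (he : γ.IsFrameOn F E U e) (h0 : 0 ∈ U) :
    Function.Surjective (he.evalZero h0) := fun x => by
  obtain ⟨s, hs⟩ := he.exists_section_of_germ h0 (f := fun _ => x) analyticAt_const
  exact ⟨s, he.evalZero_eq h0 hs⟩

/-- With surjectivity of `evalZero`, this identifies the fibre `B|₀` with `ℂʳ`. -/
lemma evalZero_eq_zero_iff (he : γ.IsFrameOn F E U e) (h0 : 0 ∈ U) (s : γ.sectionsNearZero F E) :
    he.evalZero h0 s = 0 ↔ s ∈ γ.maximalIdealSections F E := by
  constructor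
  · intro h
    obtain ⟨f, hf⟩ := he.exists_hasGerm h0 s.2
    exact he.mem_maximalIdealSections_of_hasGerm h0 hf (by rw [← he.evalZero_eq h0 hf, h])
  · intro h
    have hle : γ.maximalIdealSections F E ≤ LinearMap.ker (he.evalZero h0) := by
      refine Submodule.span_le.2 ?_
      rintro t ⟨f, hf, hf0, s, hts⟩
      obtain ⟨g, hg⟩ := he.exists_hasGerm h0 s.2
      have : HasGerm e t.1 fun z => f z • g z := by
        refine ⟨hf.smul hg.1, ?_⟩
        filter_upwards [hts, hg.2] with z h1 h2
        rw [h1, h2, map_smul]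
      change he.evalZero h0 t = 0
      rw [he.evalZero_eq h0 this, hf0, zero_smul]
    exact hle h

variable {B : Cn n → (Fin r → ℂ) →L[ℂ] (Fin r → ℂ)}

/-- If `f` gives the coordinates of `γ s`, then translating back by `γ⁻¹` gives `B z (f (γ z))` as
coordinates of `s`. Evaluation at the fixed point shows that `B 0` undoes the action on the fibre.
-/
lemma evalZero_actionNearZero (he : γ.IsFrameOn F E U e) (h0 : 0 ∈ U)
    (hB : AnalyticOnNhd ℂ B (U ∩ γ.toDiffeo ⁻¹' U))
    (hBe : ∀ z : punctured n, (z : Cn n) ∈ U → γ.toDiffeo z ∈ U → ∀ x,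
      LinearEquiv.cast (R := ℂ) (M := E) (γ.proj_perm z) (frameMap e (γ.perm z) x) =
        frameMap e z (B z x)) (s : γ.sectionsNearZero F E) :
    he.evalZero h0 s = B 0 (he.evalZero h0 (γ.actionNearZero F E s)) := by
  have hγ0 := γ.map_zero
  obtain ⟨f, hf⟩ := he.exists_hasGerm h0 (γ.actionNearZero F E s).2
  have h0' : (0 : Cn n) ∈ U ∩ γ.toDiffeo ⁻¹' U :=
    ⟨h0, by rwa [Set.mem_preimage, hγ0]⟩
  have hγan : AnalyticAt ℂ γ.toDiffeo 0 := γ.toDiffeo.contMDiff.contDiff.contDiffAt.analyticAt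
  have hgerm : HasGerm e s.1 fun z => B z (f (γ.toDiffeo z)) := by
    refine ⟨analyticAt_clm_apply (hB 0 h0') (AnalyticAt.comp (by rw [hγ0]; exact hf.1) hγan), ?_⟩
    have htend : Filter.Tendsto γ.perm (Filter.comap Subtype.val (𝓝 (0 : Cn n)))
        (Filter.comap Subtype.val (𝓝 (0 : Cn n))) := by
      rw [Filter.tendsto_comap_iff]
      have h := γ.toDiffeo.continuous.tendsto 0
      rw [hγ0] at h
      exact h.comp Filter.tendsto_comap
    have hU' := he.1.inter (he.1.preimage γ.toDiffeo.continuous)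
    filter_upwards [htend.eventually hf.2,
      Filter.preimage_mem_comap (hU'.mem_nhds h0')] with z hz hzU
    have h1 := congrFun (inverseAction_equivariantAction s.1) z
    rw [← h1, ← hBe z hzU.1 hzU.2]
    change LinearEquiv.cast (R := ℂ) (M := E) (γ.proj_perm z)
      ((γ.actionNearZero F E s).1 (γ.perm z)) = _
    rw [hz]
    rfl
  rw [he.evalZero_eq h0 hf, he.evalZero_eq h0 hgerm, hγ0]

/-- At `0` there is no fibre of `π^* B_H` to argue with. Instead `B 0` is onto since every value
`evalZero s` is in its range, and a surjective endomorphism of `ℂʳ` is injective. -/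
lemma cocycle_zero_injective (he : γ.IsFrameOn F E U e) (h0 : 0 ∈ U)
    (hB : AnalyticOnNhd ℂ B (U ∩ γ.toDiffeo ⁻¹' U))
    (hBe : ∀ z : punctured n, (z : Cn n) ∈ U → γ.toDiffeo z ∈ U → ∀ x,
      LinearEquiv.cast (R := ℂ) (M := E) (γ.proj_perm z) (frameMap e (γ.perm z) x) =
        frameMap e z (B z x)) : Function.Injective (B 0) := by
  refine (LinearMap.injective_iff_surjective (f := (B 0 : (Fin r → ℂ) →ₗ[ℂ] (Fin r → ℂ)))).2
    fun x => ?_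
  obtain ⟨s, rfl⟩ := he.evalZero_surjective h0 x
  exact ⟨_, (he.evalZero_actionNearZero h0 hB hBe s).symm⟩

/-- Since `B 0` is inverse to the action, `γ x = β x` becomes `x = B 0 (β x)`, a form that needs no
division by `β`. -/
lemma hasEigenvalue_fibreAction_iff (he : γ.IsFrameOn F E U e) (h0 : 0 ∈ U)
    (hB : AnalyticOnNhd ℂ B (U ∩ γ.toDiffeo ⁻¹' U))
    (hBe : ∀ z : punctured n, (z : Cn n) ∈ U → γ.toDiffeo z ∈ U → ∀ x,
      LinearEquiv.cast (R := ℂ) (M := E) (γ.proj_perm z) (frameMap e (γ.perm z) x) =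
        frameMap e z (B z x)) (β : ℂ) :
    (γ.fibreAction F E).HasEigenvalue β ↔ ∃ x ≠ 0, B 0 (β • x) = x := by
  have hmk : ∀ s, (γ.maximalIdealSections F E).mkQ s = 0 ↔ he.evalZero h0 s = 0 := fun s => by
    rw [he.evalZero_eq_zero_iff, Submodule.mkQ_apply, Submodule.Quotient.mk_eq_zero]
  have hev : ∀ s, γ.fibreAction F E ((γ.maximalIdealSections F E).mkQ s) =
      β • (γ.maximalIdealSections F E).mkQ s ↔
      he.evalZero h0 (γ.actionNearZero F E s) = β • he.evalZero h0 s := fun s => by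
    rw [← sub_eq_zero, ← sub_eq_zero (a := he.evalZero h0 _), ← map_smul, ← map_smul, ← map_sub,
      ← hmk, map_sub]
    rfl
  constructor
  · intro h
    obtain ⟨q, hq⟩ := h.exists_hasEigenvector
    obtain ⟨s, rfl⟩ := (γ.maximalIdealSections F E).mkQ_surjective q
    refine ⟨he.evalZero h0 s, fun hs => hq.2 ((hmk s).2 hs), ?_⟩
    rw [← (hev s).1 hq.apply_eq_smul, ← he.evalZero_actionNearZero h0 hB hBe s]
  · rintro ⟨x, hx, hBx⟩
    obtain ⟨s, rfl⟩ := he.evalZero_surjective h0 x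
    refine Module.End.hasEigenvalue_of_hasEigenvector
      (x := (γ.maximalIdealSections F E).mkQ s)
      ⟨Module.End.mem_eigenspace_iff.2 ((hev s).2 ?_), fun hs => hx ((hmk s).1 hs)⟩
    apply he.cocycle_zero_injective h0 hB hBe
    rw [hBx, ← he.evalZero_actionNearZero h0 hB hBe s]

lemma isResonant_iff (he : γ.IsFrameOn F E U e) (h0 : 0 ∈ U)
    (hB : AnalyticOnNhd ℂ B (U ∩ γ.toDiffeo ⁻¹' U))
    (hBe : ∀ z : punctured n, (z : Cn n) ∈ U → γ.toDiffeo z ∈ U → ∀ x,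
      LinearEquiv.cast (R := ℂ) (M := E) (γ.proj_perm z) (frameMap e (γ.perm z) x) =
        frameMap e z (B z x)) :
    γ.IsResonant F E ↔ IsResonantPair (B 0) (fderiv ℂ γ.toDiffeo 0 : Cn n →ₗ[ℂ] Cn n) := by
  simp only [IsResonant, IsResonantPair, he.hasEigenvalue_fibreAction_iff h0 hB hBe]
  constructor
  · rintro ⟨β, β', h1, h2, h3⟩
    exact ⟨β, β', h1, h2, h3⟩
  · rintro ⟨β, β', h1, h2, h3⟩
    exact ⟨β, β', h1, h2, h3⟩

end IsFrameOn

end FibreAction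

end HolContraction

/-! ### From global forms to invariant matrix germs at `0` -/

namespace HolContraction

variable {n : ℕ} {γ : HolContraction n}

lemma analyticOnNhd_toDiffeo (γ : HolContraction n) : AnalyticOnNhd ℂ γ.toDiffeo Set.univ :=
  fun _ _ => γ.toDiffeo.contMDiff.contDiff.contDiffAt.analyticAt

lemma fderiv_injective (γ : HolContraction n) (z : Cn n) :
    Function.Injective (fderiv ℂ γ.toDiffeo z) := by
  have h1 : DifferentiableAt ℂ γ.toDiffeo z := (γ.analyticOnNhd_toDiffeo z trivial).differentiableAt
  have h2 : DifferentiableAt ℂ γ.toDiffeo.symm (γ.toDiffeo z) :=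
    γ.toDiffeo.symm.contMDiff.contDiff.contDiffAt.analyticAt.differentiableAt
  have h3 := fderiv_comp z h2 h1
  have h4 : γ.toDiffeo.symm ∘ γ.toDiffeo = id := funext γ.toDiffeo.symm_apply_apply
  rw [h4, fderiv_id] at h3
  intro v w hvw
  have h5 : ∀ u, u = fderiv ℂ γ.toDiffeo.symm (γ.toDiffeo z) (fderiv ℂ γ.toDiffeo z u) := fun u =>
    congrArg (fun T : Cn n →L[ℂ] Cn n => T u) h3
  rw [h5 v, h5 w, hvw]

lemma fderiv_surjective (γ : HolContraction n) (z : Cn n) :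
    Function.Surjective (fderiv ℂ γ.toDiffeo z) :=
  (LinearMap.injective_iff_surjective (f := (fderiv ℂ γ.toDiffeo z : Cn n →ₗ[ℂ] Cn n))).1
    (γ.fderiv_injective z)

/-- The contraction moves every orbit into `s`; hence data near `0` control everything on `H`. -/
lemma exists_proj_eq_of_mem_nhds (γ : HolContraction n) {s : Set (Cn n)} (hs : s ∈ 𝓝 0)
    (x : γ.Hopf) : ∃ z : punctured n, (z : Cn n) ∈ s ∧ γ.proj z = x := by
  obtain ⟨z, rfl⟩ : ∃ z, γ.proj z = x := Quotient.exists_rep x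
  obtain ⟨V, hVs, hV, h0V⟩ := mem_nhds_iff.1 hs
  obtain ⟨N, hN⟩ := γ.isContraction.2 {(z : Cn n)} isCompact_singleton V hV h0V
  refine ⟨(γ.perm ^ N) z, ?_, γ.proj_eq_iff.2
    ⟨⟨γ.perm ^ N, Subgroup.pow_mem _ (Subgroup.mem_zpowers _) N⟩, rfl⟩⟩
  rw [coe_perm_pow]
  exact hVs (hN N le_rfl ⟨z, rfl, rfl⟩)

lemma tangentLift_surjective (γ : HolContraction n) (z : punctured n) :
    Function.Surjective (γ.tangentLift z) :=
  let T : Cn n →L[ℂ] Cn n := γ.tangentLift z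
  (LinearMap.injective_iff_surjective (f := (T : Cn n →ₗ[ℂ] Cn n))).1 (γ.tangentLift_injective z)

section FormToMatrix

set_option maxSynthPendingDepth 3

variable {F : Type*} [NormedAddCommGroup F] [NormedSpace ℂ F]
  {E : γ.Hopf → Type*} [TopologicalSpace (Bundle.TotalSpace F E)]
  [∀ x, AddCommGroup (E x)] [∀ x, Module ℂ (E x)] [∀ x, TopologicalSpace (E x)]
  [∀ x, IsTopologicalAddGroup (E x)] [∀ x, ContinuousSMul ℂ (E x)]
  [FiberBundle F E] [VectorBundle ℂ F E]

lemma isPushforwardSection_form_apply (σ : γ.EndValuedOneForms F E) (v : Cn n)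
    {U : Set (Cn n)} {s : ∀ z : punctured n, E (γ.proj z)} (hs : γ.IsPushforwardSection F E U s) :
    γ.IsPushforwardSection F E U (fun z => σ (γ.proj z) (γ.tangentLift z v) (s z)) := by
  have h1 : ContMDiff 𝓘(ℂ, Cn n) (𝓘(ℂ, Cn n).prod 𝓘(ℂ, Cn n →L[ℂ] F →L[ℂ] F)) ω
      (fun z : punctured n => (⟨γ.proj z, σ (γ.proj z)⟩ :
        Bundle.TotalSpace (Cn n →L[ℂ] F →L[ℂ] F)
          (fun x : γ.Hopf => TangentSpace 𝓘(ℂ, Cn n) x →L[ℂ] E x →L[ℂ] E x))) :=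
    σ.contMDiff.comp γ.contMDiff_proj
  have h2 := ContMDiff.clm_bundle_apply (F₁ := Cn n)
    (E₁ := fun x : γ.Hopf => TangentSpace 𝓘(ℂ, Cn n) x) (F₂ := F →L[ℂ] F)
    (E₂ := fun x : γ.Hopf => E x →L[ℂ] E x) h1 (γ.contMDiff_tangentLift v)
  exact h2.contMDiffOn.clm_bundle_apply hs

lemma cast_form_apply (σ : γ.EndValuedOneForms F E) {x y : γ.Hopf} (h : x = y) (u : Cn n)
    (w : E x) :
    LinearEquiv.cast (R := ℂ) (M := E) h (σ x (show TangentSpace 𝓘(ℂ, Cn n) x from u) w) =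
      σ y (show TangentSpace 𝓘(ℂ, Cn n) y from u) (LinearEquiv.cast (R := ℂ) (M := E) h w) := by
  subst h
  rfl

namespace IsFrameOn

variable {U : Set (Cn n)} {r : ℕ} {e : Fin r → ∀ z : punctured n, E (γ.proj z)}

/-- The matrix of an endomorphism-valued form in a frame near `0`; it is holomorphic at `0`. -/
lemma exists_matrix_form (he : γ.IsFrameOn F E U e) (σ : γ.EndValuedOneForms F E) :
    ∃ Φ : Cn n → Cn n →L[ℂ] (Fin r → ℂ) →L[ℂ] (Fin r → ℂ), AnalyticOnNhd ℂ Φ U ∧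
      ∀ z : punctured n, (z : Cn n) ∈ U → ∀ v x,
        σ (γ.proj z) (γ.tangentLift z v) (frameMap e z x) = frameMap e z (Φ z v x) := by
  -- The form is contracted with constant vector fields and frame sections. Taking coordinates over
  -- all of `U` is what extends the matrix holomorphically across `0`.
  choose f hf hfs using fun (k : Fin n) (i : Fin r) => he.exists_coords he.1 subset_rfl
    (isPushforwardSection_form_apply σ (EuclideanSpace.single k 1) (he.2.1 i))
  refine ⟨fun z => ∑ k, (EuclideanSpace.proj k : Cn n →L[ℂ] ℂ).smulRight
    (matrixCLM fun j i => f k i j z), fun z hz => Finset.analyticAt_fun_sum _ fun k _ => ?_,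
    fun z hz v x => ?_⟩
  · exact (ContinuousLinearMap.smulRightL ℂ (Cn n) _ (EuclideanSpace.proj k)).analyticAt_apply
      (analyticAt_matrixCLM fun j i => hf k i j z hz)
  · have hv : v = ∑ k, v k • EuclideanSpace.single k (1 : ℂ) := by
      ext j
      simp [Finset.sum_apply, Pi.single_apply]
    have h1 : ∀ k, σ (γ.proj z) (γ.tangentLift z (EuclideanSpace.single k 1)) (frameMap e z x) =
        frameMap e z (matrixCLM (fun j i => f k i j z) x) := fun k => by
      rw [frameMap_matrixCLM, frameMap_apply, map_sum]
      refine Finset.sum_congr rfl fun i _ => ?_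
      rw [map_smul, hfs k i z hz]
    have h2 : (∑ k, (EuclideanSpace.proj k : Cn n →L[ℂ] ℂ).smulRight
        (matrixCLM fun j i => f k i j z)) v x = ∑ k, v k • matrixCLM (fun j i => f k i j z) x := by
      simp
    rw [h2, map_sum]
    conv_lhs => rw [hv]
    rw [map_sum, map_sum, sum_apply]
    refine Finset.sum_congr rfl fun k _ => ?_
    rw [map_smul, map_smul, map_smul, smul_apply, h1]

variable {Φ : Cn n → Cn n →L[ℂ] (Fin r → ℂ) →L[ℂ] (Fin r → ℂ)}
  {B : Cn n → (Fin r → ℂ) →L[ℂ] (Fin r → ℂ)} [ContMDiffVectorBundle ω F E 𝓘(ℂ, Cn n)]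

lemma frameMap_surjective (he : γ.IsFrameOn F E U e) {z : punctured n} (hz : (z : Cn n) ∈ U) :
    Function.Surjective (frameMap e z) := fun x => by
  obtain ⟨c, rfl⟩ := he.exists_eq_sum hz x
  exact ⟨c, rfl⟩

set_option synthInstance.maxHeartbeats 400000 in
set_option maxHeartbeats 1000000 in
lemma eq_zero_of_matrix_form_eq_zero (he : γ.IsFrameOn F E U e) (h0 : 0 ∈ U)
    {σ : γ.EndValuedOneForms F E}
    (hσ : ∀ z : punctured n, (z : Cn n) ∈ U → ∀ v x,
      σ (γ.proj z) (γ.tangentLift z v) (frameMap e z x) = frameMap e z (Φ z v x))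
    (hΦ : ∀ᶠ z in 𝓝 0, Φ z = 0) : σ = 0 := by
  ext1 y
  obtain ⟨z, ⟨hzΦ, hzU⟩, rfl⟩ := γ.exists_proj_eq_of_mem_nhds
    (Filter.inter_mem hΦ (he.1.mem_nhds h0)) y
  have hsurj := γ.tangentLift_surjective z
  ext u w
  obtain ⟨v, rfl⟩ := hsurj u
  obtain ⟨x, rfl⟩ := he.frameMap_surjective hzU w
  rw [hσ z hzU, show Φ z = 0 from hzΦ]
  exact LinearMap.map_zero (frameMap e z)

variable [FiniteDimensional ℂ F]

lemma frameMap_injective (he : γ.IsFrameOn F E U e) {z : punctured n} (hz : (z : Cn n) ∈ U) :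
    Function.Injective (frameMap e z) :=
  (he.linearIndependent hz).fintypeLinearCombination_injective

/-- The points `z` and `γ z` have the same image in `H`, so the two matrices represent the same
value of `σ`: `B z` changes the frame and the differential of `γ` changes the tangent vector. -/
lemma matrix_form_mul_cocycle (he : γ.IsFrameOn F E U e)
    (hBe : ∀ z : punctured n, (z : Cn n) ∈ U → γ.toDiffeo z ∈ U → ∀ x,
      LinearEquiv.cast (R := ℂ) (M := E) (γ.proj_perm z) (frameMap e (γ.perm z) x) =
        frameMap e z (B z x))
    {σ : γ.EndValuedOneForms F E}
    (hσ : ∀ z : punctured n, (z : Cn n) ∈ U → ∀ v x,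
      σ (γ.proj z) (γ.tangentLift z v) (frameMap e z x) = frameMap e z (Φ z v x))
    {z : punctured n} (hz : (z : Cn n) ∈ U) (hz' : γ.toDiffeo z ∈ U) (v : Cn n) :
    Φ z v * B z = B z * Φ (γ.toDiffeo z) (fderiv ℂ γ.toDiffeo z v) := by
  ext1 x
  refine he.frameMap_injective hz ?_
  change frameMap e z (Φ z v (B z x)) =
    frameMap e z (B z (Φ (γ.toDiffeo z) (fderiv ℂ γ.toDiffeo z v) x))
  rw [← hσ z hz, ← hBe z hz hz', ← hBe z hz hz']
  have h1 := hσ (γ.perm z) hz' (fderiv ℂ γ.toDiffeo z v) x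
  have h2 := cast_form_apply σ (γ.proj_perm z)
    (γ.tangentLift (γ.perm z) (fderiv ℂ γ.toDiffeo z v) : Cn n) (frameMap e (γ.perm z) x)
  have h3 := h2.symm.trans (congrArg _ h1)
  rw [γ.tangentLift_perm z v] at h3
  exact h3

/-- At `0` itself, which does not lie over `H`, the relation follows by continuity from the
punctured neighbourhood. -/
lemma eventually_matrix_form_mul_cocycle (hn : 2 ≤ n) (he : γ.IsFrameOn F E U e) (h0 : 0 ∈ U)
    (hB : AnalyticOnNhd ℂ B (U ∩ γ.toDiffeo ⁻¹' U))
    (hBe : ∀ z : punctured n, (z : Cn n) ∈ U → γ.toDiffeo z ∈ U → ∀ x,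
      LinearEquiv.cast (R := ℂ) (M := E) (γ.proj_perm z) (frameMap e (γ.perm z) x) =
        frameMap e z (B z x))
    {σ : γ.EndValuedOneForms F E} (hΦ : AnalyticOnNhd ℂ Φ U)
    (hσ : ∀ z : punctured n, (z : Cn n) ∈ U → ∀ v x,
      σ (γ.proj z) (γ.tangentLift z v) (frameMap e z x) = frameMap e z (Φ z v x)) :
    ∀ᶠ z in 𝓝 0, ∀ v, Φ z v * B z = B z * Φ (γ.toDiffeo z) (fderiv ℂ γ.toDiffeo z v) := by
  have hU' : IsOpen (U ∩ γ.toDiffeo ⁻¹' U) := he.1.inter (he.1.preimage γ.toDiffeo.continuous)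
  have h0' : (0 : Cn n) ∈ U ∩ γ.toDiffeo ⁻¹' U := ⟨h0, by rwa [Set.mem_preimage, γ.map_zero]⟩
  have key : ∀ z ∈ U ∩ γ.toDiffeo ⁻¹' U, z ≠ 0 → ∀ v,
      Φ z v * B z = B z * Φ (γ.toDiffeo z) (fderiv ℂ γ.toDiffeo z v) := fun z hz hz0 v =>
    he.matrix_form_mul_cocycle hBe hσ (z := ⟨z, hz0⟩) hz.1 hz.2 v
  filter_upwards [hU'.mem_nhds h0'] with z hz v
  rcases eq_or_ne z 0 with rfl | hz0
  · have : Nontrivial (Cn n) := by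
      have : Nonempty (Fin n) := ⟨⟨0, by omega⟩⟩
      infer_instance
    have : (𝓝[≠] (0 : Cn n)).NeBot := Module.punctured_nhds_neBot ℂ (Cn n) 0
    have hBc := (hB 0 h0').continuousAt
    have hΦc := (hΦ 0 h0).continuousAt
    have hγc : ContinuousAt γ.toDiffeo 0 := γ.toDiffeo.continuous.continuousAt
    have hDc := (γ.analyticOnNhd_toDiffeo.fderiv 0 trivial).continuousAt
    have hΦγ : ContinuousAt (fun z => Φ (γ.toDiffeo z)) 0 :=
      ContinuousAt.comp (by rwa [γ.map_zero]) hγc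
    have h1 : ContinuousAt (fun z => Φ z v * B z) 0 :=
      (hΦc.clm_apply continuousAt_const).mul hBc
    have h2 : ContinuousAt
        (fun z => B z * Φ (γ.toDiffeo z) (fderiv ℂ γ.toDiffeo z v)) 0 :=
      hBc.mul (hΦγ.clm_apply (hDc.clm_apply continuousAt_const))
    refine tendsto_nhds_unique (h1.tendsto.mono_left (nhdsWithin_le_nhds (s := {0}ᶜ)))
      ((h2.tendsto.mono_left nhdsWithin_le_nhds).congr' ?_)
    filter_upwards [mem_nhdsWithin_of_mem_nhds (hU'.mem_nhds h0'), self_mem_nhdsWithin]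
      with w hw hw0
    exact (key w hw hw0 v).symm
  · exact key z hz hz0 v

set_option synthInstance.maxHeartbeats 400000 in
set_option maxHeartbeats 1000000 in
/-- A nonzero form yields a resonance. -/
lemma isResonantPair_of_nontrivial (hn : 2 ≤ n) (he : γ.IsFrameOn F E U e) (h0 : 0 ∈ U)
    (hB : AnalyticOnNhd ℂ B (U ∩ γ.toDiffeo ⁻¹' U))
    (hBe : ∀ z : punctured n, (z : Cn n) ∈ U → γ.toDiffeo z ∈ U → ∀ x,
      LinearEquiv.cast (R := ℂ) (M := E) (γ.proj_perm z) (frameMap e (γ.perm z) x) =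
        frameMap e z (B z x)) [Nontrivial (γ.EndValuedOneForms F E)] :
    IsResonantPair (B 0) (fderiv ℂ γ.toDiffeo 0 : Cn n →ₗ[ℂ] Cn n) := by
  obtain ⟨σ, hσ0⟩ := exists_ne (0 : γ.EndValuedOneForms F E)
  obtain ⟨Φ, hΦ, hσ⟩ := he.exists_matrix_form σ
  have h0' : (0 : Cn n) ∈ U ∩ γ.toDiffeo ⁻¹' U := ⟨h0, by rwa [Set.mem_preimage, γ.map_zero]⟩
  exact isResonantPair_of_invariant (γ.analyticOnNhd_toDiffeo 0 trivial) γ.map_zero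
    (γ.fderiv_injective 0) (hB 0 h0')
    (isUnit_continuousLinearMap_iff_injective.2 (he.cocycle_zero_injective h0 hB hBe)) (hΦ 0 h0)
    (fun h => hσ0 (he.eq_zero_of_matrix_form_eq_zero h0 hσ h))
    (he.eventually_matrix_form_mul_cocycle hn h0 hB hBe hΦ hσ)

end IsFrameOn

end FormToMatrix

end HolContraction

/-! ### From invariant matrix germs to global forms -/

namespace HolContraction

variable {n : ℕ} {γ : HolContraction n}

section MatrixToForm

set_option maxSynthPendingDepth 3

variable {F : Type*} [NormedAddCommGroup F] [NormedSpace ℂ F] [FiniteDimensional ℂ F]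
  {E : γ.Hopf → Type*} [TopologicalSpace (Bundle.TotalSpace F E)]
  [∀ x, AddCommGroup (E x)] [∀ x, Module ℂ (E x)] [∀ x, TopologicalSpace (E x)]
  [∀ x, IsTopologicalAddGroup (E x)] [∀ x, ContinuousSMul ℂ (E x)]
  [FiberBundle F E] [VectorBundle ℂ F E] [ContMDiffVectorBundle ω F E 𝓘(ℂ, Cn n)]

/-- The element `T` of the fibre of `Ω¹ ⊗ End B_H` at `y = π z` has the matrix `A` in the frame `e`
of `π^* B_H` at `z`. -/
def HasMatrixAt {r : ℕ} (e : Fin r → ∀ z : punctured n, E (γ.proj z)) {y : γ.Hopf}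
    (T : TangentSpace 𝓘(ℂ, Cn n) y →L[ℂ] E y →L[ℂ] E y) (z : punctured n)
    (A : Cn n →L[ℂ] (Fin r → ℂ) →L[ℂ] (Fin r → ℂ)) : Prop :=
  ∃ h : γ.proj z = y, ∀ v x,
    T (show Cn n from γ.tangentLift z v)
        (LinearEquiv.cast (R := ℂ) (M := E) h (frameMap e z x)) =
      LinearEquiv.cast (R := ℂ) (M := E) h (frameMap e z (A v x))

namespace IsFrameOn

variable {U U₀ : Set (Cn n)} {r : ℕ} {e : Fin r → ∀ z : punctured n, E (γ.proj z)}
  {Φ : Cn n → Cn n →L[ℂ] (Fin r → ℂ) →L[ℂ] (Fin r → ℂ)}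
  {B : Cn n → (Fin r → ℂ) →L[ℂ] (Fin r → ℂ)}

/-- The isomorphism `ℂʳ → E (π z)` given by a frame. -/
def frameEquiv (he : γ.IsFrameOn F E U e) {z : punctured n} (hz : (z : Cn n) ∈ U) :
    (Fin r → ℂ) ≃L[ℂ] E (γ.proj z) :=
  -- The fibre carries only a topology; passing through the normed model `F` makes continuity
  -- automatic.
  let t := (trivializationAt F E (γ.proj z)).continuousLinearEquivAt ℂ (γ.proj z)
    (FiberBundle.mem_baseSet_trivializationAt F E _)
  ((LinearEquiv.ofBijective (frameMap e z)
    ⟨he.frameMap_injective hz, he.frameMap_surjective hz⟩).trans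
      t.toLinearEquiv).toContinuousLinearEquiv.trans t.symm

lemma frameEquiv_apply (he : γ.IsFrameOn F E U e) {z : punctured n} (hz : (z : Cn n) ∈ U)
    (x : Fin r → ℂ) : he.frameEquiv hz x = frameMap e z x :=
  ((trivializationAt F E (γ.proj z)).continuousLinearEquivAt ℂ (γ.proj z)
    (FiberBundle.mem_baseSet_trivializationAt F E _)).symm_apply_apply (frameMap e z x)

lemma exists_hasMatrixAt (he : γ.IsFrameOn F E U e) {z : punctured n} (hz : (z : Cn n) ∈ U)
    (A : Cn n →L[ℂ] (Fin r → ℂ) →L[ℂ] (Fin r → ℂ)) :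
    ∃ T : TangentSpace 𝓘(ℂ, Cn n) (γ.proj z) →L[ℂ] E (γ.proj z) →L[ℂ] E (γ.proj z),
      HasMatrixAt e T z A := by
  let φ := he.frameEquiv hz
  let L : Cn n →L[ℂ] Cn n := γ.tangentLift z
  let θ : Cn n ≃ₗ[ℂ] Cn n := LinearEquiv.ofBijective (L : Cn n →ₗ[ℂ] Cn n)
    ⟨γ.tangentLift_injective z, γ.tangentLift_surjective z⟩
  let S : Cn n →ₗ[ℂ] E (γ.proj z) →L[ℂ] E (γ.proj z) :=
    { toFun := fun u => (φ : (Fin r → ℂ) →L[ℂ] E (γ.proj z)) ∘L A (θ.symm u) ∘L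
        (φ.symm : E (γ.proj z) →L[ℂ] (Fin r → ℂ))
      map_add' := fun u w => by ext x; simp
      map_smul' := fun c u => by ext x; simp }
  let S' : Cn n →L[ℂ] E (γ.proj z) →L[ℂ] E (γ.proj z) := LinearMap.toContinuousLinearMap S
  refine ⟨S', rfl, fun v x => ?_⟩
  change φ (A (θ.symm (θ v)) (φ.symm (frameMap e z x))) = frameMap e z (A v x)
  rw [θ.symm_apply_apply, ← he.frameEquiv_apply hz, ← he.frameEquiv_apply hz,
    ContinuousLinearEquiv.symm_apply_apply]

lemma cocycle_surjective (he : γ.IsFrameOn F E U e)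
    (hBe : ∀ z : punctured n, (z : Cn n) ∈ U → γ.toDiffeo z ∈ U → ∀ x,
      LinearEquiv.cast (R := ℂ) (M := E) (γ.proj_perm z) (frameMap e (γ.perm z) x) =
        frameMap e z (B z x))
    {z : punctured n} (hz : (z : Cn n) ∈ U) (hz' : γ.toDiffeo z ∈ U) :
    Function.Surjective (B z) := fun y => by
  obtain ⟨w, hw⟩ := (LinearEquiv.cast (R := ℂ) (M := E) (γ.proj_perm z)).surjective (frameMap e z y)
  obtain ⟨x, rfl⟩ := he.frameMap_surjective (z := γ.perm z) hz' w
  refine ⟨x, he.frameMap_injective hz ?_⟩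
  rw [← hBe z hz hz', hw]

/-- Invariance of `Φ` makes the condition on `T` at `z` equivalent to that at `γ z`. Surjectivity of
`B z` in one direction, and of the differential of `γ` in the other, is needed to reach all
arguments. -/
lemma hasMatrixAt_perm_iff (he : γ.IsFrameOn F E U e)
    (hBe : ∀ z : punctured n, (z : Cn n) ∈ U → γ.toDiffeo z ∈ U → ∀ x,
      LinearEquiv.cast (R := ℂ) (M := E) (γ.proj_perm z) (frameMap e (γ.perm z) x) =
        frameMap e z (B z x))
    {z : punctured n} (hz : (z : Cn n) ∈ U) (hz' : γ.toDiffeo z ∈ U)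
    (hinv : ∀ v, Φ z v * B z = B z * Φ (γ.toDiffeo z) (fderiv ℂ γ.toDiffeo z v)) {y : γ.Hopf}
    (T : TangentSpace 𝓘(ℂ, Cn n) y →L[ℂ] E y →L[ℂ] E y) :
    HasMatrixAt e T (γ.perm z) (Φ (γ.toDiffeo z)) ↔ HasMatrixAt e T z (Φ z) := by
  have key : ∀ (h : γ.proj z = y) (h' : γ.proj (γ.perm z) = y) (v : Cn n) (x : Fin r → ℂ),
      (T (show Cn n from γ.tangentLift (γ.perm z) (fderiv ℂ γ.toDiffeo z v))
        (LinearEquiv.cast (R := ℂ) (M := E) h' (frameMap e (γ.perm z) x)) =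
      LinearEquiv.cast (R := ℂ) (M := E) h'
        (frameMap e (γ.perm z) (Φ (γ.toDiffeo z) (fderiv ℂ γ.toDiffeo z v) x))) ↔
      (T (show Cn n from γ.tangentLift z v)
        (LinearEquiv.cast (R := ℂ) (M := E) h (frameMap e z (B z x))) =
      LinearEquiv.cast (R := ℂ) (M := E) h (frameMap e z (Φ z v (B z x)))) := by
    rintro rfl h' v x
    have h1 : Φ z v (B z x) = B z (Φ (γ.toDiffeo z) (fderiv ℂ γ.toDiffeo z v) x) :=
      congrArg (fun S : (Fin r → ℂ) →L[ℂ] (Fin r → ℂ) => S x) (hinv v)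
    rw [h1, hBe z hz hz', hBe z hz hz', γ.tangentLift_perm z v]
    rfl
  constructor
  · rintro ⟨h', hT⟩
    have h := (γ.proj_perm z).symm.trans h'
    refine ⟨h, fun v x => ?_⟩
    obtain ⟨x, rfl⟩ := he.cocycle_surjective hBe hz hz' x
    exact (key h h' v x).1 (hT _ _)
  · rintro ⟨h, hT⟩
    have h' := (γ.proj_perm z).trans h
    refine ⟨h', fun v x => ?_⟩
    obtain ⟨v, rfl⟩ := γ.fderiv_surjective z v
    exact (key h h' v x).2 (hT _ _)

lemma hasMatrixAt_perm_pow_iff (he : γ.IsFrameOn F E U e)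
    (hBe : ∀ z : punctured n, (z : Cn n) ∈ U → γ.toDiffeo z ∈ U → ∀ x,
      LinearEquiv.cast (R := ℂ) (M := E) (γ.proj_perm z) (frameMap e (γ.perm z) x) =
        frameMap e z (B z x))
    (hU₀ : U₀ ⊆ U) (hmaps : Set.MapsTo γ.toDiffeo U₀ U₀)
    (hinv : ∀ z ∈ U₀, ∀ v, Φ z v * B z = B z * Φ (γ.toDiffeo z) (fderiv ℂ γ.toDiffeo z v))
    {z : punctured n} (hz : (z : Cn n) ∈ U₀) {y : γ.Hopf}
    (T : TangentSpace 𝓘(ℂ, Cn n) y →L[ℂ] E y →L[ℂ] E y) (k : ℕ) :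
    (((γ.perm ^ k) z : punctured n) : Cn n) ∈ U₀ ∧
      (HasMatrixAt e T ((γ.perm ^ k) z) (Φ ((γ.perm ^ k) z : punctured n)) ↔
        HasMatrixAt e T z (Φ z)) := by
  induction k with
  | zero => exact ⟨hz, Iff.rfl⟩
  | succ k ih =>
    rw [pow_succ', Equiv.Perm.mul_apply]
    refine ⟨hmaps ih.1, Iff.trans ?_ ih.2⟩
    exact he.hasMatrixAt_perm_iff hBe (hU₀ ih.1) (hU₀ (hmaps ih.1)) (hinv _ ih.1) T

/-- One of the two points is a nonnegative power of `γ` applied to the other, and forward orbits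
stay in `U₀`; a negative exponent exchanges the roles. -/
lemma hasMatrixAt_iff_of_proj_eq (he : γ.IsFrameOn F E U e)
    (hBe : ∀ z : punctured n, (z : Cn n) ∈ U → γ.toDiffeo z ∈ U → ∀ x,
      LinearEquiv.cast (R := ℂ) (M := E) (γ.proj_perm z) (frameMap e (γ.perm z) x) =
        frameMap e z (B z x))
    (hU₀ : U₀ ⊆ U) (hmaps : Set.MapsTo γ.toDiffeo U₀ U₀)
    (hinv : ∀ z ∈ U₀, ∀ v, Φ z v * B z = B z * Φ (γ.toDiffeo z) (fderiv ℂ γ.toDiffeo z v))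
    {z w : punctured n} (hz : (z : Cn n) ∈ U₀) (hw : (w : Cn n) ∈ U₀) (hzw : γ.proj z = γ.proj w)
    {y : γ.Hopf} (T : TangentSpace 𝓘(ℂ, Cn n) y →L[ℂ] E y →L[ℂ] E y) :
    HasMatrixAt e T z (Φ z) ↔ HasMatrixAt e T w (Φ w) := by
  obtain ⟨⟨g, k, rfl⟩, hg⟩ := γ.proj_eq_iff.1 hzw
  have hg' : (γ.perm ^ k) w = z := hg
  rcases Int.eq_nat_or_neg k with ⟨m, rfl | rfl⟩
  · rw [zpow_natCast] at hg'
    rw [← hg']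
    exact (he.hasMatrixAt_perm_pow_iff hBe hU₀ hmaps hinv hw T m).2
  · rw [zpow_neg, zpow_natCast, Equiv.Perm.inv_eq_iff_eq] at hg'
    rw [hg']
    exact (he.hasMatrixAt_perm_pow_iff hBe hU₀ hmaps hinv hz T m).2.symm

/-- Each point of `H` has a lift in `U₀`, whose matrix defines the value of `σ`; the value does not
depend on the lift. -/
lemma exists_form_pointwise (he : γ.IsFrameOn F E U e)
    (hBe : ∀ z : punctured n, (z : Cn n) ∈ U → γ.toDiffeo z ∈ U → ∀ x,
      LinearEquiv.cast (R := ℂ) (M := E) (γ.proj_perm z) (frameMap e (γ.perm z) x) =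
        frameMap e z (B z x))
    (hU₀ : U₀ ⊆ U) (h0 : U₀ ∈ 𝓝 0) (hmaps : Set.MapsTo γ.toDiffeo U₀ U₀)
    (hinv : ∀ z ∈ U₀, ∀ v, Φ z v * B z = B z * Φ (γ.toDiffeo z) (fderiv ℂ γ.toDiffeo z v)) :
    ∃ σ : ∀ y : γ.Hopf, TangentSpace 𝓘(ℂ, Cn n) y →L[ℂ] E y →L[ℂ] E y,
      ∀ z : punctured n, (z : Cn n) ∈ U₀ → ∀ v x,
        σ (γ.proj z) (γ.tangentLift z v) (frameMap e z x) = frameMap e z (Φ z v x) := by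
  have key : ∀ y : γ.Hopf, ∃ T : TangentSpace 𝓘(ℂ, Cn n) y →L[ℂ] E y →L[ℂ] E y,
      ∀ z : punctured n, (z : Cn n) ∈ U₀ → γ.proj z = y → HasMatrixAt e T z (Φ z) := fun y => by
    obtain ⟨w, hw, rfl⟩ := γ.exists_proj_eq_of_mem_nhds h0 y
    obtain ⟨T, hT⟩ := he.exists_hasMatrixAt (hU₀ hw) (Φ w)
    exact ⟨T, fun z hz hzw =>
      (he.hasMatrixAt_iff_of_proj_eq hBe hU₀ hmaps hinv hz hw hzw T).2 hT⟩
  choose σ hσ using key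
  refine ⟨σ, fun z hz v x => ?_⟩
  obtain ⟨h, hT⟩ := hσ (γ.proj z) z hz rfl
  exact hT v x

/-- The frame criterion is applied twice along `π`: with the frame `e`, to the endomorphisms
obtained from constant vector fields, and then with the tangent frame, to the form itself. -/
lemma contMDiffAt_form (he : γ.IsFrameOn F E U e) (hU₀ : U₀ ⊆ U) (hU₀o : IsOpen U₀)
    (hΦ : AnalyticOnNhd ℂ Φ U₀)
    {σ : ∀ y : γ.Hopf, TangentSpace 𝓘(ℂ, Cn n) y →L[ℂ] E y →L[ℂ] E y}
    (hσ : ∀ z : punctured n, (z : Cn n) ∈ U₀ → ∀ v x,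
      σ (γ.proj z) (γ.tangentLift z v) (frameMap e z x) = frameMap e z (Φ z v x))
    {z : punctured n} (hz : (z : Cn n) ∈ U₀) :
    ContMDiffAt 𝓘(ℂ, Cn n) (𝓘(ℂ, Cn n).prod 𝓘(ℂ, Cn n →L[ℂ] F →L[ℂ] F)) ω
      (fun y => (⟨y, σ y⟩ : Bundle.TotalSpace (Cn n →L[ℂ] F →L[ℂ] F)
        (fun x : γ.Hopf => TangentSpace 𝓘(ℂ, Cn n) x →L[ℂ] E x →L[ℂ] E x))) (γ.proj z) := by
  have hz' : Subtype.val ⁻¹' U₀ ∈ 𝓝 z := (hU₀o.preimage continuous_subtype_val).mem_nhds hz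
  have hzU : Subtype.val ⁻¹' U ∈ 𝓝 z := Filter.mem_of_superset hz' fun w hw => hU₀ hw
  have hπ : ContMDiffAt 𝓘(ℂ, Cn n) 𝓘(ℂ, Cn n) ω γ.proj z := γ.contMDiff_proj.contMDiffAt
  have h1 : ∀ v : Cn n, ContMDiffAt 𝓘(ℂ, Cn n) (𝓘(ℂ, Cn n).prod 𝓘(ℂ, F →L[ℂ] F)) ω
      (fun w => (⟨γ.proj w, σ (γ.proj w) (γ.tangentLift w v)⟩ :
        Bundle.TotalSpace (F →L[ℂ] F) (fun x : γ.Hopf => E x →L[ℂ] E x))) z := fun v => by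
    refine contMDiffAt_hom_of_frame (u := fun i w => e i w) hπ
      (fun i => (he.2.1 i).contMDiffAt hzU) (fun i => ?_) (he.linearIndependent (hU₀ hz)) ?_
    · have h2 := he.isPushforwardSection_sum_smul hU₀ (f := fun j w => Φ w v (Pi.single i 1) j)
        fun j w hw => analyticAt_pi_iff.1
          (analyticAt_clm_apply (analyticAt_clm_apply (hΦ w hw) analyticAt_const)
            analyticAt_const) j
      refine (ContMDiffOn.contMDiffAt h2 hz').congr_of_eventuallyEq ?_
      filter_upwards [hz'] with w hw
      have h3 := hσ w hw v (Pi.single i 1)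
      have h4 : frameMap e w (Pi.single i 1) = e i w := by
        rw [frameMap_apply, Finset.sum_eq_single i]
        · simp
        · intro j _ hj
          simp [hj]
        · simp
      rw [h4] at h3
      rw [h3]
      rfl
    · rintro x -
      obtain ⟨c, rfl⟩ := he.exists_eq_sum (hU₀ hz) x
      exact Submodule.sum_mem _ fun i _ =>
        Submodule.smul_mem _ _ (Submodule.subset_span ⟨i, rfl⟩)
  have h2 : ContMDiffAt 𝓘(ℂ, Cn n) (𝓘(ℂ, Cn n).prod 𝓘(ℂ, Cn n →L[ℂ] F →L[ℂ] F)) ω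
      (fun w => (⟨γ.proj w, σ (γ.proj w)⟩ : Bundle.TotalSpace (Cn n →L[ℂ] F →L[ℂ] F)
        (fun x : γ.Hopf => TangentSpace 𝓘(ℂ, Cn n) x →L[ℂ] E x →L[ℂ] E x))) z := by
    let L : Cn n →L[ℂ] Cn n := γ.tangentLift z
    refine contMDiffAt_hom_of_frame (F₁ := Cn n)
      (E₁ := fun x : γ.Hopf => TangentSpace 𝓘(ℂ, Cn n) x) (F₂ := F →L[ℂ] F)
      (E₂ := fun x : γ.Hopf => E x →L[ℂ] E x)
      (u := fun k w => γ.tangentLift w ((EuclideanSpace.basisFun (Fin n) ℂ).toBasis k)) hπ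
      (fun k => γ.contMDiff_tangentLift _ z) (fun k => h1 _) ?_ ?_
    · exact (EuclideanSpace.basisFun (Fin n) ℂ).toBasis.linearIndependent.map' (L : Cn n →ₗ[ℂ] Cn n)
        (LinearMap.ker_eq_bot.2 (γ.tangentLift_injective z))
    · have h3 := congrArg (Submodule.map (L : Cn n →ₗ[ℂ] Cn n))
        (EuclideanSpace.basisFun (Fin n) ℂ).toBasis.span_eq
      rw [Submodule.map_top, LinearMap.range_eq_top.2 (show Function.Surjective L from
        γ.tangentLift_surjective z), Submodule.map_span, ← Set.range_comp] at h3
      exact h3.ge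
  -- So far smoothness is known along `π` only; a local inverse of `π` transfers it to `H`.
  obtain ⟨ρ, hρ, hρz, hρy, -⟩ := γ.exists_contMDiffAt_localInverse z
  have h3 := ContMDiffAt.comp (γ.proj z) (by rw [hρz]; exact h2) hρ
  refine h3.congr_of_eventuallyEq ?_
  filter_upwards [hρy] with y hy
  rw [Function.comp_apply, hy]

set_option synthInstance.maxHeartbeats 400000 in
set_option maxHeartbeats 1000000 in
/-- A resonance yields a nonzero form. -/
lemma nontrivial_of_isResonantPair (hn : 2 ≤ n) (he : γ.IsFrameOn F E U e) (h0 : 0 ∈ U)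
    (hB : AnalyticOnNhd ℂ B (U ∩ γ.toDiffeo ⁻¹' U))
    (hBe : ∀ z : punctured n, (z : Cn n) ∈ U → γ.toDiffeo z ∈ U → ∀ x,
      LinearEquiv.cast (R := ℂ) (M := E) (γ.proj_perm z) (frameMap e (γ.perm z) x) =
        frameMap e z (B z x))
    (hres : IsResonantPair (B 0) (fderiv ℂ γ.toDiffeo 0 : Cn n →ₗ[ℂ] Cn n)) :
    Nontrivial (γ.EndValuedOneForms F E) := by
  have h0' : (0 : Cn n) ∈ U ∩ γ.toDiffeo ⁻¹' U := ⟨h0, by rwa [Set.mem_preimage, γ.map_zero]⟩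
  have : Nontrivial (Cn n) := by
    have : Nonempty (Fin n) := ⟨⟨0, by omega⟩⟩
    infer_instance
  obtain ⟨U₀, hU₀, h0U₀, hU₀U, hmaps, Φ, hΦ, hinv, z, hz, hz0, hΦz⟩ :=
    IsResonantPair.exists_invariant γ.isContraction γ.analyticOnNhd_toDiffeo (hB 0 h0')
      (isUnit_continuousLinearMap_iff_injective.2 (he.cocycle_zero_injective h0 hB hBe)) hres
      (he.1.mem_nhds h0)
  obtain ⟨σ, hσ⟩ := he.exists_form_pointwise hBe hU₀U (hU₀.mem_nhds h0U₀) hmaps hinv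
  let s : γ.EndValuedOneForms F E := ⟨σ, fun y => by
    obtain ⟨w, hw, rfl⟩ := γ.exists_proj_eq_of_mem_nhds (hU₀.mem_nhds h0U₀) y
    exact he.contMDiffAt_form hU₀U hU₀ hΦ hσ hw⟩
  refine ⟨s, 0, fun hs => hΦz ?_⟩
  ext1 v
  ext1 x
  refine he.frameMap_injective (z := ⟨z, hz0⟩) (hU₀U hz) ?_
  rw [← hσ ⟨z, hz0⟩ hz]
  have h1 : σ (γ.proj ⟨z, hz0⟩) = 0 :=
    congrArg (fun s : γ.EndValuedOneForms F E => s (γ.proj ⟨z, hz0⟩)) hs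
  rw [h1]
  exact (LinearMap.map_zero (frameMap e ⟨z, hz0⟩)).symm

end IsFrameOn

end MatrixToForm

end HolContraction

end HopfManifold

end

theorem mainTheorem5 {n : ℕ} (hn : 2 ≤ n) (γ : HopfManifold.HolContraction n)
    {F : Type*} [NormedAddCommGroup F] [NormedSpace ℂ F] [FiniteDimensional ℂ F]
    (E : γ.Hopf → Type*) [TopologicalSpace (Bundle.TotalSpace F E)]
    [∀ x, AddCommGroup (E x)] [∀ x, Module ℂ (E x)] [∀ x, TopologicalSpace (E x)]
    [∀ x, IsTopologicalAddGroup (E x)] [∀ x, ContinuousSMul ℂ (E x)]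
    [FiberBundle F E] [VectorBundle ℂ F E]
    [ContMDiffVectorBundle ω F E 𝓘(ℂ, HopfManifold.Cn n)]
    (hE : γ.IsMall F E) :
    γ.IsResonant F E ↔ Nontrivial (γ.EndValuedOneForms F E) := by
  -- Only the frame around the fixed point is needed, since every orbit enters its domain.
  obtain ⟨U, hU, h0, r, e, he⟩ := hE 0
  have he : γ.IsFrameOn F E U e := ⟨hU, he⟩
  obtain ⟨B, hB, hBe⟩ := he.exists_cocycle
  rw [he.isResonant_iff h0 hB hBe]
  exact ⟨he.nontrivial_of_isResonantPair hn h0 hB hBe, fun _ =>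
    he.isResonantPair_of_nontrivial hn h0 hB hBe⟩
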